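/- Let $K$ be an infinite field, $Q$ a finite quiver with vertices $e_1,\dots,e_n$, and $L\ge 1$ an integer. Let $\Lambda = KQ/I$ be the truncated path algebra, where $I$ is the ideal of the path algebra $KQ$ generated by all paths of length $L+1$; let $J$ be its Jacobson radical and $S_i=\Lambda e_i/Je_i$ the simple left modules. For $d\ge 0$, let $\mathrm{Mod}_d(\Lambda)$ be the affine variety of all families of endomorphisms $x_a\in \mathrm{End}_K(K^d)$, one for each vertex and each arrow $a$ of $Q$, that satisfy all relations satisfied by the corresponding generators of $\Lambda$; each point defines a $d$-dimensional left $\Lambda$-module. A semisimple sequence is a sequence $\mathbb S=(\mathbb S_0,\dots,\mathbb S_L)$ of finitely generated semisimple left $\Lambda$-modules, taken up to isomorphism. $\mathrm{Mod}(\mathbb S)\subseteq \mathrm{Mod}_d(\Lambda)$, with $d=\sum_l\dim_K\mathbb S_l$, is the set of the points whose module $M$ has radical layering $\mathbb S$, that is, $J^lM/J^{l+1}M\cong \mathbb S_l$ for $0\le l\le L$. Write $\mathbb S'\ge\mathbb S$ if $\bigoplus_{l}\mathbb S_l\cong\bigoplus_{l}\mathbb S'_l$ and, for every $r$, $\bigoplus_{l\le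 r}\mathbb S_l$ is isomorphic to a direct summand of $\bigoplus_{l\le r}\mathbb S'_l$. For a vertex $e$, let $c(e)\in\mathbb N\cup\{0,\infty\}$ be the supremum of the lengths of the paths in $Q$ starting in $e$, and put $l\text{-}\deg(c)=\left\lfloor \frac{c}{L+1}\right\rfloor+\left\lfloor\frac{c+l}{L+1}\right\rfloor$ for finite $c$ and $l\text{-}\deg(\infty)=\infty$. The projective dimension is constant on each nonempty $\mathrm{Mod}(\mathbb S)$; denote this constant value by $\operatorname{pdim}\mathbb S$. Theorem. Let $\mathbb S$ be a semisimple sequence of total dimension $d$ with $\mathrm{Mod}(\mathbb S)\neq\varnothing$, and let $\overline{\mathrm{Mod}(\mathbb S)}$ be the Zariski closure of $\mathrm{Mod}(\mathbb S)$ in $\mathrm{Mod}_d(\Lambda)$. Then $$\{\operatorname{pdim} M \mid M \text{ in } \overline{\mathrm{Mod}(\mathbb S)}\}=\{\operatorname{pdim}\mathbb S'\mid \mathbb S'\ge\mathbb S,\ \mathrm{Mod}(\mathbb S')\ne\varnothing\}=\{\operatorname{pdim}\mathbb S\}\cup\{n_1,\dots,n_v\},$$ where $n_1,\dots,n_v$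 are those elements of $\{1+l\text{-}\deg(c(e_j))\mid 1\le l\le L,\ S_j \text{ isomorphic to a direct summand of } \mathbb S_l\}\subseteq\mathbb N\cup\{\infty\}$ that are strictly larger than $\operatorname{pdim}\mathbb S$. -/

import Mathlib

open CategoryTheory

universe u

namespace TruncPath

noncomputable section

/-! ## The path algebra `KQ` -/

/-- The paths of the quiver `V`: triples (start, end, path). -/
abbrev PathIdx (V : Type) [Quiver.{0} V] : Type := Σ i : V, Σ j : V, Quiver.Path i j

/-- The path algebra `KQ`: the vector space with basis the set of paths. -/
def PathAlgebra (K : Type u) (V : Type) [Field K] [Quiver.{0} V] : Type u := PathIdx V →₀ K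

section PathAlgebra

variable (K : Type u) {V : Type} [Field K] [Quiver.{0} V]

instance : AddCommGroup (PathAlgebra K V) := inferInstanceAs (AddCommGroup (PathIdx V →₀ K))
instance : Module K (PathAlgebra K V) := inferInstanceAs (Module K (PathIdx V →₀ K))

/-- The basis element of `KQ` given by a path. -/
def pathElt (p : PathIdx V) : PathAlgebra K V := (Finsupp.single p 1 : PathIdx V →₀ K)

open Classical in
/-- The product `q p` of two paths, read as "`q` after `p`": the concatenation if `p` ends where `q`
starts, and `0` otherwise. -/
def pathMul (q p : PathIdx V) : PathAlgebra K V :=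
  if h : p.2.1 = q.1 then pathElt K ⟨p.1, q.2.1, (p.2.2.cast rfl h).comp q.2.2⟩ else 0

/-- The bilinear extension of the product of paths. -/
def mulLin : PathAlgebra K V →ₗ[K] PathAlgebra K V →ₗ[K] PathAlgebra K V :=
  Finsupp.linearCombination K fun q =>
    (Finsupp.linearCombination K fun p => pathMul K q p : (PathIdx V →₀ K) →ₗ[K] PathAlgebra K V)

instance : Mul (PathAlgebra K V) := ⟨fun x y => mulLin K x y⟩

variable {K}

theorem mul_def' (x y : PathAlgebra K V) : x * y = mulLin K x y := rfl

theorem pathElt_mul (q p : PathIdx V) : pathElt K q * pathElt K p = pathMul K q p := by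
  have h₁ : mulLin K (pathElt K q) = (Finsupp.linearCombination K fun p => pathMul K q p :
      (PathIdx V →₀ K) →ₗ[K] PathAlgebra K V) :=
    (Finsupp.linearCombination_single K 1 q).trans (one_smul _ _)
  rw [mul_def', h₁]
  exact (Finsupp.linearCombination_single K 1 p).trans (one_smul _ _)

theorem pathElt_mul_comp {i j k : V} (p : Quiver.Path i j) (q : Quiver.Path j k) :
    pathElt K ⟨j, k, q⟩ * pathElt K ⟨i, j, p⟩ = pathElt K ⟨i, k, p.comp q⟩ := by
  simp [pathElt_mul, pathMul]

theorem pathElt_mul_ne {q p : PathIdx V} (h : p.2.1 ≠ q.1) :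
    pathElt K q * pathElt K p = 0 := by
  simp [pathElt_mul, pathMul, h]

theorem linMap_ext {M : Type*} [AddCommGroup M] [Module K M] {f g : PathAlgebra K V →ₗ[K] M}
    (h : ∀ p, f (pathElt K p) = g (pathElt K p)) : f = g :=
  Finsupp.lhom_ext' fun p => LinearMap.ext_ring (h p)

theorem pathElt_mul_assoc (r q p : PathIdx V) :
    pathElt K r * pathElt K q * pathElt K p = pathElt K r * (pathElt K q * pathElt K p) := by
  have hz : ∀ x : PathAlgebra K V, x * 0 = 0 := fun x => by simp [mul_def']
  have zh : ∀ x : PathAlgebra K V, 0 * x = 0 := fun x => by simp [mul_def']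
  obtain ⟨k, l, r⟩ := r
  obtain ⟨j, k', q⟩ := q
  obtain ⟨i, j', p⟩ := p
  by_cases h₁ : k' = k
  · subst h₁
    by_cases h₂ : j' = j
    · subst h₂
      simp only [pathElt_mul_comp, Quiver.Path.comp_assoc]
    · have e₁ : pathElt K (⟨j, k', q⟩ : PathIdx V) * pathElt K ⟨i, j', p⟩ = 0 := pathElt_mul_ne h₂
      rw [e₁, hz, pathElt_mul_comp, pathElt_mul_ne h₂]
  · have e₁ : pathElt K (⟨k, l, r⟩ : PathIdx V) * pathElt K ⟨j, k', q⟩ = 0 := pathElt_mul_ne h₁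
    rw [e₁, zh]
    by_cases h₂ : j' = j
    · subst h₂
      rw [pathElt_mul_comp, pathElt_mul_ne h₁]
    · have e₂ : pathElt K (⟨j, k', q⟩ : PathIdx V) * pathElt K ⟨i, j', p⟩ = 0 := pathElt_mul_ne h₂
      rw [e₂, hz]

@[elab_as_elim]
theorem path_induction {P : PathAlgebra K V → Prop} (h0 : P 0)
    (hadd : ∀ x y, P x → P y → P (x + y)) (hs : ∀ (a : K) (p : PathIdx V), P (a • pathElt K p))
    (x : PathAlgebra K V) : P x := by
  refine Finsupp.induction_linear (motive := P) x h0 hadd fun p a => ?_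
  have h := hs a p
  have e : a • pathElt K p = (Finsupp.single p a : PathIdx V →₀ K) :=
    (Finsupp.smul_single a p (1 : K)).trans (by rw [smul_eq_mul, mul_one])
  rwa [e] at h

theorem mul_assoc' (x y z : PathAlgebra K V) : x * y * z = x * (y * z) := by
  have h := pathElt_mul_assoc (K := K) (V := V)
  simp only [mul_def'] at h ⊢
  induction x using path_induction with
  | h0 => simp
  | hadd a b ha hb => simp [ha, hb]
  | hs a r =>
    induction y using path_induction with
    | h0 => simp
    | hadd c d hc hd => simp only [map_add, LinearMap.add_apply, hc, hd]
    | hs b q =>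
      induction z using path_induction with
      | h0 => simp
      | hadd c d hc hd => simp only [map_add, hc, hd]
      | hs c p => simp only [map_smul, LinearMap.smul_apply, h]

variable [Fintype V]

/-- The unit of `KQ` is the sum of the paths of length `0`. -/
instance : One (PathAlgebra K V) := ⟨∑ i : V, pathElt K ⟨i, i, .nil⟩⟩

theorem one_def' : (1 : PathAlgebra K V) = ∑ i : V, pathElt K ⟨i, i, .nil⟩ := rfl

theorem one_mul' (x : PathAlgebra K V) : 1 * x = x := by
  have h : mulLin K (1 : PathAlgebra K V) = LinearMap.id := by
    refine linMap_ext fun ⟨i, j, p⟩ => ?_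
    rw [one_def', map_sum, LinearMap.sum_apply, Finset.sum_eq_single j]
    · exact pathElt_mul_comp p .nil
    · intro k _ hk
      exact pathElt_mul_ne (K := K) (q := ⟨k, k, .nil⟩) (p := ⟨i, j, p⟩) hk.symm
    · simp
  rw [mul_def', h, LinearMap.id_apply]

theorem mul_one' (x : PathAlgebra K V) : x * 1 = x := by
  have h : (mulLin K).flip (1 : PathAlgebra K V) = LinearMap.id := by
    refine linMap_ext fun ⟨i, j, p⟩ => ?_
    rw [LinearMap.flip_apply, one_def', map_sum, Finset.sum_eq_single i]
    · exact (pathElt_mul_comp .nil p).trans (by rw [Quiver.Path.nil_comp]; rfl)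
    · intro k _ hk
      exact pathElt_mul_ne (K := K) (q := ⟨i, j, p⟩) (p := ⟨k, k, .nil⟩) hk
    · simp
  rw [mul_def', ← LinearMap.flip_apply, h, LinearMap.id_apply]

instance : Ring (PathAlgebra K V) :=
  { (inferInstance : AddCommGroup (PathAlgebra K V)),
    (inferInstance : Mul (PathAlgebra K V)), (inferInstance : One (PathAlgebra K V)) with
    left_distrib := fun x y z => by simp only [mul_def', map_add]
    right_distrib := fun x y z => by simp only [mul_def', map_add, LinearMap.add_apply]
    zero_mul := fun x => by simp only [mul_def', map_zero, LinearMap.zero_apply]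
    mul_zero := fun x => by simp only [mul_def', map_zero]
    mul_assoc := mul_assoc'
    one_mul := one_mul'
    mul_one := mul_one' }

instance : Algebra K (PathAlgebra K V) :=
  Algebra.ofModule (fun r x y => by simp only [mul_def', map_smul, LinearMap.smul_apply])
    (fun r x y => by simp only [mul_def', map_smul])

end PathAlgebra

/-! ## The truncated path algebra `Λ = KQ / I` -/

section Trunc

variable (K : Type u) (V : Type) [Field K] [Fintype V] [Quiver.{0} V] (L : ℕ)

/-- The two-sided ideal of `KQ` generated by all paths of length `L + 1`. -/
def truncIdeal : TwoSidedIdeal (PathAlgebra K V) :=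
  TwoSidedIdeal.span {x | ∃ p : PathIdx V, p.2.2.length = L + 1 ∧ x = pathElt K p}

/-- The truncated path algebra `Λ = KQ / I`. -/
def TruncAlg : Type u := (truncIdeal K V L).ringCon.Quotient

instance : Ring (TruncAlg K V L) := inferInstanceAs (Ring (truncIdeal K V L).ringCon.Quotient)
instance : Algebra K (TruncAlg K V L) :=
  inferInstanceAs (Algebra K (truncIdeal K V L).ringCon.Quotient)

/-- The residue map `KQ → Λ`. -/
def toTrunc : PathAlgebra K V →ₐ[K] TruncAlg K V L :=
  { (truncIdeal K V L).ringCon.mk' with commutes' := fun _ => rfl }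

theorem toTrunc_surjective : Function.Surjective (toTrunc K V L) :=
  (truncIdeal K V L).ringCon.mk'_surjective

/-- The generators of the algebra: the vertices and the arrows of the quiver. -/
abbrev Gen : Type := V ⊕ (Σ i : V, Σ j : V, (i ⟶ j))

variable {V}

/-- The idempotent `e_i` of `Λ`. -/
def idem (i : V) : TruncAlg K V L := toTrunc K V L (pathElt K ⟨i, i, .nil⟩)

/-- The algebra generators of `Λ`: the idempotents `e_i` and the residue classes of the arrows. -/
def gen : Gen V → TruncAlg K V L
  | .inl i => idem K L i
  | .inr a => toTrunc K V L (pathElt K ⟨a.1, a.2.1, a.2.2.toPath⟩)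

theorem lift_gen_surjective : Function.Surjective (FreeAlgebra.lift K (gen K L (V := V))) := by
  rw [← AlgHom.range_eq_top, eq_top_iff]
  rintro x -
  obtain ⟨x, rfl⟩ := toTrunc_surjective K V L x
  have hg : ∀ g : Gen V, gen K L g ∈ (FreeAlgebra.lift K (gen K L (V := V))).range :=
    fun g => ⟨FreeAlgebra.ι K g, FreeAlgebra.lift_ι_apply _ _⟩
  have hp : ∀ (i j : V) (p : Quiver.Path i j),
      toTrunc K V L (pathElt K ⟨i, j, p⟩) ∈ (FreeAlgebra.lift K (gen K L (V := V))).range := by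
    intro i j p
    induction p with
    | nil => exact hg (.inl i)
    | cons p a ih =>
      have := mul_mem (hg (.inr ⟨_, _, a⟩)) ih
      rwa [gen, ← map_mul, pathElt_mul_comp] at this
  induction x using path_induction with
  | h0 => rw [map_zero]; exact zero_mem _
  | hadd x y hx hy => rw [map_add]; exact add_mem hx hy
  | hs a p => rw [map_smul]; exact Subalgebra.smul_mem _ (hp _ _ _) a

/-- The left ideal `Λ e_i`. -/
abbrev projIdeal (i : V) : Ideal (TruncAlg K V L) := Ideal.span {idem K L i}

/-- The simple module `S_i = Λ e_i / J e_i`. -/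
abbrev SimpleMod (i : V) : Type u :=
  projIdeal K L i ⧸ (Ring.jacobson (TruncAlg K V L) • (⊤ : Submodule (TruncAlg K V L) (projIdeal K L i)))

/-! ## The module variety `Mod_d(Λ)` -/

variable (V)

/-- The affine variety `Mod_d(Λ)`: families of endomorphisms of `K^d`, one for each generator of `Λ`,
which satisfy all relations satisfied by the generators. -/
def ModVariety (d : ℕ) : Type u :=
  {x : Gen V → Module.End K (Fin d → K) //
    ∀ f : FreeAlgebra K (Gen V), FreeAlgebra.lift K (gen K L) f = 0 → FreeAlgebra.lift K x f = 0}

variable {K V L} {d : ℕ}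

theorem ModVariety.lift_eq (x : ModVariety K V L d) {f g : FreeAlgebra K (Gen V)}
    (h : FreeAlgebra.lift K (gen K L) f = FreeAlgebra.lift K (gen K L) g) :
    FreeAlgebra.lift K x.1 f = FreeAlgebra.lift K x.1 g := by
  rw [← sub_eq_zero, ← map_sub] at h ⊢
  exact x.2 _ h

/-- The action of `Λ` on `K^d` given by a point of the module variety: the algebra homomorphism that
sends each generator `a` to the endomorphism `x_a`. -/
def ModVariety.action (x : ModVariety K V L d) : TruncAlg K V L →ₐ[K] Module.End K (Fin d → K) :=
  let s := Function.surjInv (lift_gen_surjective K L (V := V))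
  have hs : ∀ a, FreeAlgebra.lift K (gen K L) (s a) = a :=
    Function.surjInv_eq (lift_gen_surjective K L (V := V))
  { toFun := fun a => FreeAlgebra.lift K x.1 (s a)
    map_one' := (x.lift_eq (g := 1) (by rw [hs, map_one])).trans (map_one _)
    map_mul' := fun a b =>
      (x.lift_eq (g := s a * s b) (by rw [hs, map_mul, hs, hs])).trans (map_mul _ _ _)
    map_zero' := (x.lift_eq (g := 0) (by rw [hs, map_zero])).trans (map_zero _)
    map_add' := fun a b =>
      (x.lift_eq (g := s a + s b) (by rw [hs, map_add, hs, hs])).trans (map_add _ _ _)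
    commutes' := fun r =>
      (x.lift_eq (g := algebraMap K _ r) (by rw [hs, AlgHom.commutes])).trans
        (AlgHom.commutes _ _) }

theorem ModVariety.action_gen (x : ModVariety K V L d) (g : Gen V) :
    x.action (gen K L g) = x.1 g := by
  have h := x.lift_eq (f := Function.surjInv (lift_gen_surjective K L (V := V)) (gen K L g))
    (g := FreeAlgebra.ι K g)
    (by rw [Function.surjInv_eq (lift_gen_surjective K L (V := V)), FreeAlgebra.lift_ι_apply])
  rw [FreeAlgebra.lift_ι_apply] at h
  exact h

/-- The left `Λ`-module represented by a point of the module variety: the space `K^d`. -/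
def ModVariety.Carrier (_x : ModVariety K V L d) : Type u := Fin d → K

instance (x : ModVariety K V L d) : AddCommGroup x.Carrier :=
  inferInstanceAs (AddCommGroup (Fin d → K))

instance (x : ModVariety K V L d) : Module (TruncAlg K V L) x.Carrier :=
  letI : Module (Module.End K (Fin d → K)) x.Carrier :=
    inferInstanceAs (Module (Module.End K (Fin d → K)) (Fin d → K))
  Module.compHom x.Carrier x.action.toRingHom

/-- The projective dimension of the module represented by a point. -/
def ModVariety.pdim (x : ModVariety K V L d) : WithBot ℕ∞ :=
  projectiveDimension (ModuleCat.of (TruncAlg K V L) x.Carrier)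

/-- The coordinates of a point: the entries of the matrices of the endomorphisms `x_a`. -/
def ModVariety.coords (x : ModVariety K V L d) : Gen V × Fin d × Fin d → K :=
  fun c => LinearMap.toMatrix' (x.1 c.1) c.2.1 c.2.2

/-- The Zariski closure in `Mod_d(Λ)` of a set of points. -/
def zariskiClosure (Z : Set (ModVariety K V L d)) : Set (ModVariety K V L d) :=
  {x | x.coords ∈
    MvPolynomial.zeroLocus K (MvPolynomial.vanishingIdeal K (ModVariety.coords '' Z))}

end Trunc

/-! ## Semisimple sequences and radical layerings -/

section Layer

/-- The layer `J^l M / J^(l+1) M` of a module. -/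
abbrev RadLayer (R M : Type*) [Ring R] [AddCommGroup M] [Module R M] (l : ℕ) : Type _ :=
  ↥(Ring.jacobson R ^ l • (⊤ : Submodule R M)) ⧸
    (Ring.jacobson R ^ (l + 1) • (⊤ : Submodule R M)).submoduleOf
      (Ring.jacobson R ^ l • (⊤ : Submodule R M))

/-- A sequence `(𝕊_0, …, 𝕊_L)` of finitely generated semisimple `Λ`-modules, up to isomorphism,
where `𝕊 l i` is the multiplicity of the simple module `S_i` in `𝕊_l`. -/
abbrev SemisimpleSeq (V : Type) (L : ℕ) : Type := Fin (L + 1) → V → ℕ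

variable {K : Type u} {V : Type} [Field K] [Fintype V] [Quiver.{0} V] {L d : ℕ}

/-- The total dimension of a semisimple sequence (each `S_i` has dimension `1`). -/
def totalDim (S : SemisimpleSeq V L) : ℕ := ∑ l, ∑ i, S l i

/-- The partial order `S' ≥ S` of semisimple sequences, written `dominates S' S`: the two have the
same total multiplicities, and `⨁_{l ≤ r} S_l` is a direct summand of `⨁_{l ≤ r} S'_l` for
all `r`. -/
def dominates (S' S : SemisimpleSeq V L) : Prop :=
  (∀ i, ∑ l, S l i = ∑ l, S' l i) ∧
    ∀ r i, ∑ l ∈ Finset.Iic r, S l i ≤ ∑ l ∈ Finset.Iic r, S' l i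

/-- The module `M` has radical layering `S`: `J^l M / J^(l+1) M ≅ ⨁_i S_i^(S l i)` for all `l ≤ L`. -/
def HasRadLayering (S : SemisimpleSeq V L) (M : Type u) [AddCommGroup M]
    [Module (TruncAlg K V L) M] : Prop :=
  ∀ l : Fin (L + 1), Nonempty
    (RadLayer (TruncAlg K V L) M l ≃ₗ[TruncAlg K V L]
      ((c : Σ i : V, Fin (S l i)) → SimpleMod K L c.1))

variable (K d)

/-- `Mod(𝕊)`: the points of `Mod_d(Λ)` whose modules have radical layering `𝕊`. -/
def layerStratum (S : SemisimpleSeq V L) : Set (ModVariety K V L d) :=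
  {x | HasRadLayering (K := K) S x.Carrier}

open Classical in
/-- `pdim 𝕊`, for a semisimple sequence with `Mod(𝕊) ≠ ∅`: the projective dimension of the modules
with radical layering `𝕊`, taken at one of them. -/
def seqPdim (S : SemisimpleSeq V L) : WithBot ℕ∞ :=
  if h : (layerStratum K d S).Nonempty then h.some.pdim else ⊥

end Layer

/-! ## Path lengths and degrees -/

/-- `c(e)`: the supremum of the lengths of the paths of `Q` starting in `e`. -/
def pathSup {V : Type} [Quiver.{0} V] (e : V) : ℕ∞ :=
  ⨆ (j : V) (p : Quiver.Path e j), (p.length : ℕ∞)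

/-- `l-deg(c) = ⌊c / (L+1)⌋ + ⌊(c + l) / (L+1)⌋`, and `l-deg(∞) = ∞`. -/
def ldeg (L l : ℕ) : ℕ∞ → ℕ∞
  | ⊤ => ⊤
  | (c : ℕ) => ((c / (L + 1) + (c + l) / (L + 1) : ℕ) : ℕ∞)

end

end TruncPath

open TruncPath

/-! The theorem reduces to counting in the radical layers. A finite-dimensional module M has a
skeleton: a basis of paths applied to generators, closed under dropping the last arrow, in which the
paths of length at least l give a basis of J^l M. It is a forest whose nodes of depth l with label i
number the multiplicity of S_i in layer l (`exists_isForestBasis`,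
`IsForestBasis.hasRadLayering_iff`).

Call a node y together with an arrow a leaving its vertex critical if y has no child along a. In the
projective module on the roots every critical pair yields a relation, and these relations exhibit
the first syzygy as the direct sum of the modules Λe_j/J^(L-depth y)e_j, with j the end of a: they
generate it by rewriting (`range_syzMap`), and there is nothing more to divide out by a dimension
count (`syzMap_injective`). The same argument for Λe/J^m e with 1 ≤ m ≤ L shows inductively that its
projective dimension is (L+1-m)-deg(c(e)) (`pdLT_freeMod_iff`). Hence for M ≠ 0 the projective
dimension is the supremum, 0 if empty, of the weights 1 + (l+1)-deg(c(e_j)) over critical pairs of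
depth l < L ending in j (`IsForestBasis.projectiveDimension_eq`). Such a pair exists exactly when
layer l+1 contains fewer copies of S_j than there are arrows from layer l to j, so the formula
depends on the layering alone.

Layerings in the closure dominate 𝕊, because the dimension of e_i J^r M can only drop in a limit
(`dominates_of_mem_zariskiClosure`). Along the dominance order the numerical projective dimension
never drops, and a larger value is the weight of a composition factor of 𝕊 (`critSup_le_critSup`,
`exists_of_critSup_lt`). Both facts rest on two observations: weights do not decrease from a node to
its parent, and a position whose weight exceeds the supremum is saturated, that is, every arrow into
it is used.

Conversely, scaling the edge above a node by t and letting t tend to 0 stays in the closure and cuts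
off the branch at that node; if the weight of the node exceeds pdim 𝕊, it becomes the new projective
dimension (`Forest.critSup_cut`, `exists_pdim_eq_of_lt`). -/

set_option linter.unusedSectionVars false

namespace TruncPath
noncomputable section

/-! ## Generators and relations of the truncated path algebra -/

/-- The arrows of the quiver, bundled with their end points. -/
abbrev Arr (V : Type) [Quiver.{0} V] : Type := Σ i : V, Σ j : V, (i ⟶ j)

section Alg

variable (K : Type u) {V : Type} [Field K] [Fintype V] [Quiver.{0} V] (L : ℕ)

/-- The residue class of an arrow. -/
def arrElt (a : Arr V) : TruncAlg K V L := gen K L (.inr a)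

/-- The residue class of a path. -/
def pathCls {i j : V} (p : Quiver.Path i j) : TruncAlg K V L := toTrunc K V L (pathElt K ⟨i, j, p⟩)

theorem idem_eq_pathCls (i : V) : idem K L i = pathCls K L (.nil : Quiver.Path i i) := rfl

theorem pathCls_comp {i j k : V} (p : Quiver.Path i j) (q : Quiver.Path j k) :
    pathCls K L (p.comp q) = pathCls K L q * pathCls K L p := by
  simp only [pathCls, ← map_mul, pathElt_mul_comp]

theorem pathCls_mul_ne {i j k l : V} (p : Quiver.Path i j) (q : Quiver.Path k l) (h : j ≠ k) :
    pathCls K L q * pathCls K L p = 0 := by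
  simp only [pathCls, ← map_mul]
  rw [pathElt_mul_ne (q := ⟨k, l, q⟩) (p := ⟨i, j, p⟩) h, map_zero]

theorem arrElt_eq_pathCls (a : Arr V) : arrElt K L a = pathCls K L a.2.2.toPath := rfl

theorem pathCls_cons {i j k : V} (p : Quiver.Path i j) (a : j ⟶ k) :
    pathCls K L (p.cons a) = arrElt K L ⟨j, k, a⟩ * pathCls K L p :=
  pathCls_comp K L p a.toPath

theorem idem_mul_pathCls {i j : V} (p : Quiver.Path i j) :
    idem K L j * pathCls K L p = pathCls K L p :=
  (pathCls_comp K L p .nil).symm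

theorem idem_mul_self (i : V) : idem K L i * idem K L i = idem K L i :=
  idem_mul_pathCls K L .nil

theorem idem_mul_ne {i j : V} (h : i ≠ j) : idem K L i * idem K L j = 0 :=
  pathCls_mul_ne K L .nil .nil h.symm

theorem sum_idem : ∑ i : V, idem K L i = 1 := by
  rw [← map_one (toTrunc K V L), one_def', map_sum]
  rfl

theorem idem_mul_arrElt (a : Arr V) : idem K L a.2.1 * arrElt K L a = arrElt K L a :=
  idem_mul_pathCls K L a.2.2.toPath

theorem arrElt_mul_idem_ne {a : Arr V} {i : V} (h : i ≠ a.1) : arrElt K L a * idem K L i = 0 :=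
  pathCls_mul_ne K L .nil a.2.2.toPath h

theorem pathCls_eq_zero_of_length_eq {i j : V} (p : Quiver.Path i j) (h : p.length = L + 1) :
    pathCls K L p = 0 := by
  have : pathElt K ⟨i, j, p⟩ ∈ truncIdeal K V L := TwoSidedIdeal.subset_span ⟨_, h, rfl⟩
  rw [← TwoSidedIdeal.ker_ringCon_mk' (truncIdeal K V L), TwoSidedIdeal.mem_ker] at this
  exact this

theorem pathCls_eq_zero {i j : V} (p : Quiver.Path i j) (h : L + 1 ≤ p.length) :
    pathCls K L p = 0 := by
  induction p with
  | nil => simp at h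
  | cons p a ih =>
    by_cases h' : L + 1 ≤ p.length
    · rw [pathCls_cons, ih h', mul_zero]
    · refine pathCls_eq_zero_of_length_eq K L _ ?_
      simp only [Quiver.Path.length_cons] at h ⊢
      omega

@[elab_as_elim]
theorem trunc_induction {P : TruncAlg K V L → Prop} (h0 : P 0)
    (hadd : ∀ x y, P x → P y → P (x + y))
    (hs : ∀ (c : K) (i j : V) (p : Quiver.Path i j), P (c • pathCls K L p)) (x : TruncAlg K V L) :
    P x := by
  obtain ⟨x, rfl⟩ := toTrunc_surjective K V L x
  induction x using path_induction with
  | h0 => rwa [map_zero]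
  | hadd x y hx hy => rw [map_add]; exact hadd _ _ hx hy
  | hs c p => rw [map_smul]; exact hs c _ _ _

/-! ### Algebra homomorphisms out of the truncated path algebra -/

variable {K}

/-- The product of the images of the arrows of a path. -/
def evalPath {A : Type*} [Mul A] (f : Gen V → A) {i : V} : ∀ {j : V}, Quiver.Path i j → A
  | _, .nil => f (.inl i)
  | _, .cons p a => f (.inr ⟨_, _, a⟩) * evalPath f p

/-- A family of elements satisfying the relations of the quiver, with vanishing paths of length
`L + 1`, defines an algebra homomorphism. -/
theorem exists_algHom {A : Type*} [Ring A] [Algebra K A] (f : Gen V → A)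
    (hself : ∀ i, f (.inl i) * f (.inl i) = f (.inl i))
    (horth : ∀ i j, i ≠ j → f (.inl i) * f (.inl j) = 0) (hsum : ∑ i, f (.inl i) = 1)
    (hsrc : ∀ a : Arr V, f (.inr a) * f (.inl a.1) = f (.inr a))
    (htgt : ∀ a : Arr V, f (.inl a.2.1) * f (.inr a) = f (.inr a))
    (hnil : ∀ (i j : V) (p : Quiver.Path i j), p.length = L + 1 → evalPath f p = 0) :
    ∃ φ : TruncAlg K V L →ₐ[K] A, ∀ g, φ (gen K L g) = f g := by
  have hcomp : ∀ {i j k : V} (p : Quiver.Path i j) (q : Quiver.Path j k),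
      evalPath f q * evalPath f p = evalPath f (p.comp q) := by
    intro i j k p q
    induction q with
    | nil =>
      cases p with
      | nil => exact hself _
      | cons p a => simp only [evalPath, Quiver.Path.comp_nil, ← mul_assoc, htgt ⟨_, _, a⟩]
    | cons q a ih => simp only [evalPath, Quiver.Path.comp_cons, mul_assoc, ih]
  have hidl : ∀ {i j : V} (p : Quiver.Path i j), f (.inl j) * evalPath f p = evalPath f p :=
    fun p => hcomp p .nil
  have hidr : ∀ {i j : V} (p : Quiver.Path i j), evalPath f p * f (.inl i) = evalPath f p := by
    intro i j p
    have := hcomp .nil p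
    rwa [Quiver.Path.nil_comp] at this
  have hne : ∀ {i j k l : V} (p : Quiver.Path i j) (q : Quiver.Path k l), j ≠ k →
      evalPath f q * evalPath f p = 0 := by
    intro i j k l p q h
    rw [← hidr q, ← hidl p, mul_assoc, ← mul_assoc (f (.inl k)), horth _ _ h.symm, zero_mul,
      mul_zero]
  let lin : PathAlgebra K V →ₗ[K] A :=
    (Finsupp.linearCombination K fun p : PathIdx V => evalPath f p.2.2 : (PathIdx V →₀ K) →ₗ[K] A)
  have hlin : ∀ p : PathIdx V, lin (pathElt K p) = evalPath f p.2.2 := fun p =>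
    (Finsupp.linearCombination_single K 1 p).trans (one_smul _ _)
  have hmul : ∀ x y, lin (x * y) = lin x * lin y := by
    intro x y
    induction x using path_induction with
    | h0 => simp
    | hadd x y hx hy => simp only [add_mul, map_add, hx, hy]
    | hs c q =>
      induction y using path_induction with
      | h0 => simp
      | hadd x y hx hy => simp only [mul_add, map_add, hx, hy]
      | hs d p =>
        simp only [smul_mul_smul_comm, map_smul, hlin]
        congr 1
        obtain ⟨k, l, q⟩ := q
        obtain ⟨i, j, p⟩ := p
        by_cases h : j = k
        · subst h
          rw [pathElt_mul_comp, hlin, hcomp]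
        · rw [pathElt_mul_ne (q := ⟨k, l, q⟩) (p := ⟨i, j, p⟩) h, map_zero, hne p q h]
  have hone : lin 1 = 1 := by
    rw [one_def', map_sum, ← hsum]
    exact Finset.sum_congr rfl fun i _ => hlin _
  let ψ : PathAlgebra K V →ₐ[K] A := AlgHom.ofLinearMap lin hone hmul
  have hker : truncIdeal K V L ≤ TwoSidedIdeal.ker ψ := by
    rw [truncIdeal, TwoSidedIdeal.span_le]
    rintro _ ⟨p, hp, rfl⟩
    exact (TwoSidedIdeal.mem_ker ψ).2 ((hlin p).trans (hnil _ _ _ hp))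
  have hker' : ∀ x y, (truncIdeal K V L).ringCon x y → ψ x = ψ y := by
    intro x y h
    rw [TwoSidedIdeal.rel_iff] at h
    have := (TwoSidedIdeal.mem_ker ψ).1 (hker h)
    rwa [map_sub, sub_eq_zero] at this
  let φ₀ : (truncIdeal K V L).ringCon.Quotient →+* A :=
    (truncIdeal K V L).ringCon.lift ψ.toRingHom (fun x y h => hker' x y h)
  have hφ₀ : ∀ x, φ₀ (toTrunc K V L x) = ψ x := fun x => rfl
  let φ : TruncAlg K V L →ₐ[K] A :=
    { φ₀ with
      commutes' := fun r => by
        have : algebraMap K (TruncAlg K V L) r = toTrunc K V L (algebraMap K _ r) :=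
          ((toTrunc K V L).commutes r).symm
        rw [this]
        exact (hφ₀ _).trans (ψ.commutes r) }
  refine ⟨φ, ?_⟩
  rintro (i | a)
  · exact (hφ₀ _).trans (hlin _)
  · refine (hφ₀ _).trans ((hlin _).trans ?_)
    -- As a path of length one, the arrow evaluates to its image times the image of its source
    -- vertex.
    exact hsrc a

end Alg

section Mod

variable {K : Type u} {V : Type} [Field K] [Fintype V] [Quiver.{0} V] {L : ℕ}
variable {M : Type*} [AddCommGroup M] [Module K M] [Module (TruncAlg K V L) M]
  [IsScalarTower K (TruncAlg K V L) M]
variable {N : Type*} [AddCommGroup N] [Module K N] [Module (TruncAlg K V L) N]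
  [IsScalarTower K (TruncAlg K V L) N]

/-- A subspace closed under the action of the generators is closed under `Λ`. -/
theorem smul_mem_of_gen {U : Submodule K M} (hi : ∀ i : V, ∀ m ∈ U, idem K L i • m ∈ U)
    (ha : ∀ a : Arr V, ∀ m ∈ U, arrElt K L a • m ∈ U) (r : TruncAlg K V L) {m : M} (hm : m ∈ U) :
    r • m ∈ U := by
  induction r using trunc_induction with
  | h0 => simp
  | hadd x y hx hy => rw [add_smul]; exact add_mem hx hy
  | hs c i j p =>
    rw [smul_assoc]
    refine U.smul_mem c ?_
    induction p with
    | nil => exact hi _ _ hm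
    | cons p a ih => rw [pathCls_cons, mul_smul]; exact ha _ _ ih

theorem smul_comm_scalar (r : TruncAlg K V L) (c : K) (m : M) : r • c • m = c • r • m := by
  rw [← algebraMap_smul (TruncAlg K V L) c m, ← algebraMap_smul (TruncAlg K V L) c (r • m),
    ← mul_smul, ← mul_smul, Algebra.commutes]

/-- A `K`-linear map commuting with the generators is `Λ`-linear. -/
def linOfGen (f : M →ₗ[K] N) (hi : ∀ (i : V) m, f (idem K L i • m) = idem K L i • f m)
    (ha : ∀ (a : Arr V) m, f (arrElt K L a • m) = arrElt K L a • f m) : M →ₗ[TruncAlg K V L] N :=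
  { f with
    map_smul' := fun r m => by
      simp only [RingHom.id_apply, LinearMap.coe_toAddHom, AddHom.toFun_eq_coe]
      induction r using trunc_induction with
      | h0 => simp
      | hadd x y hx hy => simp only [add_smul, map_add, hx, hy]
      | hs c i j p =>
        rw [smul_assoc, smul_assoc, map_smul]
        congr 1
        induction p with
        | nil => exact hi _ _
        | cons p a ih => rw [pathCls_cons, mul_smul, mul_smul, ha, ih] }

/-- Multiplication by an element of `Λ`, as a `K`-linear map. -/
def lsmulK (M : Type*) [AddCommGroup M] [Module K M] [Module (TruncAlg K V L) M]
    [IsScalarTower K (TruncAlg K V L) M] (r : TruncAlg K V L) : M →ₗ[K] M where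
  toFun m := r • m
  map_add' := smul_add r
  map_smul' c m := smul_comm_scalar r c m

@[simp]
theorem lsmulK_apply (r : TruncAlg K V L) (m : M) : lsmulK M r m = r • m := rfl

theorem sum_idem_smul (m : M) : ∑ i : V, idem K L i • m = m := by
  rw [← Finset.sum_smul, sum_idem, one_smul]

end Mod

/-! ## The Jacobson radical -/

/-- If a maximal left ideal misses `x`, it contains some `1 - y * x`, which is a unit because `y *
x` is nilpotent. -/
theorem mem_jacobson_of_isNilpotent_mul {R : Type*} [Ring R] {x : R}
    (h : ∀ y, IsNilpotent (y * x)) : x ∈ Ring.jacobson R := by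
  rw [Ring.jacobson_eq_sInf_isMaximal, Submodule.mem_sInf]
  intro I hI
  by_contra hxI
  obtain ⟨y, u, hu, huz⟩ := hI.exists_inv hxI
  have hunit : IsUnit (1 - y * x) := (h y).isUnit_one_sub
  rw [← huz, add_sub_cancel_left] at hunit
  exact hI.ne_top (Ideal.eq_top_of_isUnit_mem I hu hunit)

section Jacobson

variable (K : Type u) (V : Type) [Field K] [Fintype V] [Quiver.{0} V] (L : ℕ)

/-- The one-dimensional representation at a vertex. Its kernel is a maximal ideal; these kernels
bound the Jacobson radical from above. -/
theorem exists_vertex_hom (i : V) : ∃ φ : TruncAlg K V L →ₐ[K] K,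
    φ (idem K L i) = 1 ∧ (∀ j, j ≠ i → φ (idem K L j) = 0) ∧ ∀ a, φ (arrElt K L a) = 0 := by
  classical
  obtain ⟨φ, hφ⟩ := exists_algHom (K := K) L
    (fun g : Gen V => Sum.elim (fun j => if j = i then (1 : K) else 0) (fun _ => 0) g)
    (by intro j; by_cases h : j = i <;> simp [h])
    (by
      intro j k h
      by_cases hj : j = i
      · have : k ≠ i := fun hk => h (hj.trans hk.symm)
        simp [this]
      · simp [hj])
    (by simp) (by simp) (by simp)
    (by
      intro j k p hp
      cases p with
      | nil => simp at hp
      | cons p a => simp [evalPath])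
  refine ⟨φ, ?_, fun j hj => ?_, fun a => ?_⟩
  · exact (hφ (.inl i)).trans (by simp)
  · exact (hφ (.inl j)).trans (by simp [hj])
  · exact (hφ (.inr a)).trans (by simp)

variable {V}

/-- The algebra homomorphism `Λ → K` at the vertex `i`. -/
def vertexHom (i : V) : TruncAlg K V L →ₐ[K] K := (exists_vertex_hom K V L i).choose

theorem vertexHom_self (i : V) : vertexHom K L i (idem K L i) = 1 :=
  (exists_vertex_hom K V L i).choose_spec.1

theorem vertexHom_ne {i j : V} (h : j ≠ i) : vertexHom K L i (idem K L j) = 0 :=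
  (exists_vertex_hom K V L i).choose_spec.2.1 j h

theorem vertexHom_arr (i : V) (a : Arr V) : vertexHom K L i (arrElt K L a) = 0 :=
  (exists_vertex_hom K V L i).choose_spec.2.2 a

variable (V)

/-- The span of the residue classes of the paths of length at least `l`. -/
def pathSpan (l : ℕ) : Submodule K (TruncAlg K V L) :=
  Submodule.span K {x | ∃ (i j : V) (p : Quiver.Path i j), l ≤ p.length ∧ x = pathCls K L p}

variable {V L}

/-- Modulo paths of positive length only the idempotents survive, and the vertex homomorphisms read
off their coefficients. -/
theorem sub_sum_vertexHom_mem (x : TruncAlg K V L) :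
    x - ∑ i, vertexHom K L i x • idem K L i ∈ pathSpan K V L 1 := by
  classical
  induction x using trunc_induction with
  | h0 => simp
  | hadd x y hx hy =>
    have : x + y - ∑ i, vertexHom K L i (x + y) • idem K L i =
        (x - ∑ i, vertexHom K L i x • idem K L i) +
          (y - ∑ i, vertexHom K L i y • idem K L i) := by
      simp only [map_add, add_smul, Finset.sum_add_distrib]
      abel
    rw [this]
    exact add_mem hx hy
  | hs c i j p =>
    cases p with
    | nil =>
      rw [Finset.sum_eq_single i]
      · rw [← idem_eq_pathCls, map_smul, vertexHom_self, smul_eq_mul, mul_one, sub_self]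
        exact zero_mem _
      · intro k _ hk
        rw [← idem_eq_pathCls, map_smul, vertexHom_ne K L hk.symm, smul_zero, zero_smul]
      · simp
    | cons p a =>
      rw [Finset.sum_eq_zero, sub_zero]
      · exact Submodule.smul_mem _ _ (Submodule.subset_span ⟨_, _, p.cons a, by simp, rfl⟩)
      · intro k _
        rw [pathCls_cons, map_smul, map_mul, vertexHom_arr, zero_mul, smul_zero, zero_smul]

theorem vertexHom_eq_zero_of_mem_jacobson {x : TruncAlg K V L}
    (hx : x ∈ Ring.jacobson (TruncAlg K V L)) (i : V) : vertexHom K L i x = 0 := by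
  have hsurj : Function.Surjective (vertexHom K L i).toRingHom := fun c =>
    ⟨algebraMap K _ c, (vertexHom K L i).commutes c⟩
  have : (RingHom.ker (vertexHom K L i).toRingHom).IsMaximal :=
    RingHom.ker_isMaximal_of_surjective _ hsurj
  exact RingHom.mem_ker.1 (Ring.jacobson_le_of_isMaximal (RingHom.ker (vertexHom K L i).toRingHom) hx)

theorem mem_pathSpan_of_mem_jacobson {x : TruncAlg K V L}
    (hx : x ∈ Ring.jacobson (TruncAlg K V L)) : x ∈ pathSpan K V L 1 := by
  have := sub_sum_vertexHom_mem K x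
  simpa [vertexHom_eq_zero_of_mem_jacobson K hx] using this

theorem mul_mem_pathSpan {k l : ℕ} {x y : TruncAlg K V L} (hx : x ∈ pathSpan K V L k)
    (hy : y ∈ pathSpan K V L l) : x * y ∈ pathSpan K V L (k + l) := by
  induction hx using Submodule.span_induction with
  | zero => simp
  | add x x' _ _ h h' => rw [add_mul]; exact add_mem h h'
  | smul c x _ h => rw [smul_mul_assoc]; exact Submodule.smul_mem _ _ h
  | mem x hx =>
    obtain ⟨i, j, p, hp, rfl⟩ := hx
    induction hy using Submodule.span_induction with
    | zero => simp
    | add x x' _ _ h h' => rw [mul_add]; exact add_mem h h'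
    | smul c x _ h => rw [mul_smul_comm]; exact Submodule.smul_mem _ _ h
    | mem y hy =>
      obtain ⟨i', j', q, hq, rfl⟩ := hy
      by_cases h : j' = i
      · subst h
        rw [← pathCls_comp]
        refine Submodule.subset_span ⟨_, _, _, ?_, rfl⟩
        rw [Quiver.Path.length_comp]
        omega
      · rw [pathCls_mul_ne K L q p h]
        exact zero_mem _

theorem pathSpan_zero : pathSpan K V L 0 = ⊤ := by
  rw [eq_top_iff]
  rintro x -
  induction x using trunc_induction with
  | h0 => exact zero_mem _
  | hadd x y hx hy => exact add_mem hx hy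
  | hs c i j p => exact Submodule.smul_mem _ _ (Submodule.subset_span ⟨_, _, p, zero_le, rfl⟩)

theorem pathSpan_eq_bot : pathSpan K V L (L + 1) = ⊥ := by
  rw [pathSpan, Submodule.span_eq_bot]
  rintro _ ⟨i, j, p, hp, rfl⟩
  exact pathCls_eq_zero K L p hp

theorem pow_mem_pathSpan {x : TruncAlg K V L} (hx : x ∈ pathSpan K V L 1) (n : ℕ) :
    x ^ n ∈ pathSpan K V L n := by
  induction n with
  | zero => rw [pathSpan_zero]; trivial
  | succ n ih => rw [pow_succ]; exact mul_mem_pathSpan K ih hx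

/-- The vertex homomorphisms kill the radical, which leaves only paths of positive length.
Conversely the span of these absorbs left multiplication, and (L+1)-st powers of its elements
vanish, so the nilpotence criterion applies. -/
theorem mem_jacobson_iff {x : TruncAlg K V L} :
    x ∈ Ring.jacobson (TruncAlg K V L) ↔ x ∈ pathSpan K V L 1 := by
  refine ⟨mem_pathSpan_of_mem_jacobson K, fun hx => mem_jacobson_of_isNilpotent_mul fun y => ?_⟩
  have hy : y ∈ pathSpan K V L 0 := by rw [pathSpan_zero]; trivial
  have hyx : y * x ∈ pathSpan K V L 1 := by
    rw [← zero_add 1]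
    exact mul_mem_pathSpan K hy hx
  have hpow := pow_mem_pathSpan K hyx (L + 1)
  rw [pathSpan_eq_bot] at hpow
  exact ⟨L + 1, (Submodule.mem_bot K).1 hpow⟩

theorem arrElt_mem_jacobson (a : Arr V) : arrElt K L a ∈ Ring.jacobson (TruncAlg K V L) :=
  (mem_jacobson_iff K).2 (Submodule.subset_span ⟨_, _, a.2.2.toPath, le_rfl, rfl⟩)

end Jacobson

/-! ## The radical filtration -/

section Rad

variable {K : Type u} {V : Type} [Field K] [Fintype V] [Quiver.{0} V] {L : ℕ}
variable {M : Type*} [AddCommGroup M] [Module K M] [Module (TruncAlg K V L) M]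
  [IsScalarTower K (TruncAlg K V L) M]

variable (K V L M) in
/-- The submodule `J^l M`. -/
abbrev rad (l : ℕ) : Submodule (TruncAlg K V L) M := Ring.jacobson (TruncAlg K V L) ^ l • ⊤

theorem rad_zero : rad K V L M 0 = ⊤ := by
  rw [rad, Submodule.pow_zero, Ideal.one_eq_top, Submodule.top_smul]

theorem rad_succ (l : ℕ) :
    rad K V L M (l + 1) = Ring.jacobson (TruncAlg K V L) • rad K V L M l := by
  rw [rad, Ideal.IsTwoSided.pow_succ, Submodule.mul_smul]

theorem rad_succ_le (l : ℕ) : rad K V L M (l + 1) ≤ rad K V L M l := by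
  rw [rad_succ]
  exact Submodule.smul_le_right

theorem rad_antitone : Antitone (rad K V L M) := antitone_nat_of_succ_le rad_succ_le

theorem arrElt_smul_mem_rad (a : Arr V) {l : ℕ} {m : M} (hm : m ∈ rad K V L M l) :
    arrElt K L a • m ∈ rad K V L M (l + 1) := by
  rw [rad_succ]
  exact Submodule.smul_mem_smul (arrElt_mem_jacobson K a) hm

theorem pathCls_smul_mem_rad {i j : V} (p : Quiver.Path i j) {l : ℕ} {m : M}
    (hm : m ∈ rad K V L M l) : pathCls K L p • m ∈ rad K V L M (l + p.length) := by
  induction p with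
  | nil => exact Submodule.smul_mem _ _ hm
  | cons p a ih => rw [pathCls_cons, mul_smul]; exact arrElt_smul_mem_rad _ ih

/-- `J N` is spanned by the images of `N` under the arrows. -/
theorem jacobson_smul_eq_span (N : Submodule (TruncAlg K V L) M) :
    (Ring.jacobson (TruncAlg K V L) • N).restrictScalars K =
      Submodule.span K {x | ∃ a : Arr V, ∃ n ∈ N, x = arrElt K L a • n} := by
  apply le_antisymm
  · intro x hx
    rw [Submodule.restrictScalars_mem] at hx
    refine Submodule.smul_induction_on hx (fun r hr n hn => ?_) fun x y hx hy => add_mem hx hy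
    rw [mem_jacobson_iff] at hr
    induction hr using Submodule.span_induction with
    | zero => rw [zero_smul]; exact zero_mem _
    | add x y _ _ hx hy => rw [add_smul]; exact add_mem hx hy
    | smul c x _ hx => rw [smul_assoc]; exact Submodule.smul_mem _ _ hx
    | mem x hx =>
      obtain ⟨i, j, p, hp, rfl⟩ := hx
      cases p with
      | nil => simp at hp
      | cons p a =>
        rw [pathCls_cons, mul_smul]
        exact Submodule.subset_span ⟨_, _, N.smul_mem _ hn, rfl⟩
  · rw [Submodule.span_le]
    rintro _ ⟨a, n, hn, rfl⟩
    have : arrElt K L a • n ∈ Ring.jacobson (TruncAlg K V L) • N :=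
      Submodule.smul_mem_smul (arrElt_mem_jacobson K a) hn
    exact this

theorem rad_succ_eq_span (l : ℕ) : (rad K V L M (l + 1)).restrictScalars K =
    Submodule.span K {x | ∃ a : Arr V, ∃ n ∈ rad K V L M l, x = arrElt K L a • n} := by
  rw [rad_succ, jacobson_smul_eq_span]

/-- `J^l M` is spanned by the images of the generators of `M` under the paths of length `l`. -/
theorem rad_eq_span {ι : Type*} (g : ι → M) (hg : Submodule.span K (Set.range g) = ⊤) (l : ℕ) :
    (rad K V L M l).restrictScalars K = Submodule.span K
      {x | ∃ (i j : V) (p : Quiver.Path i j) (k : ι), p.length = l ∧ x = pathCls K L p • g k} := by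
  induction l with
  | zero =>
    rw [rad_zero, Submodule.restrictScalars_top, eq_comm, eq_top_iff, ← hg, Submodule.span_le]
    rintro _ ⟨k, rfl⟩
    rw [← sum_idem_smul (K := K) (V := V) (L := L) (g k)]
    exact sum_mem fun i _ => Submodule.subset_span ⟨i, i, .nil, k, rfl, rfl⟩
  | succ l ih =>
    rw [rad_succ_eq_span]
    apply le_antisymm
    · rw [Submodule.span_le]
      rintro _ ⟨a, n, hn, rfl⟩
      have hn' : n ∈ (rad K V L M l).restrictScalars K := hn
      rw [ih] at hn'
      induction hn' using Submodule.span_induction with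
      | zero => rw [smul_zero]; exact zero_mem _
      | add x y _ _ hx hy =>
        rw [smul_add]
        refine add_mem (hx ?_) (hy ?_)
        all_goals
          rw [← Submodule.restrictScalars_mem K, ih]
          assumption
      | smul c x h hx =>
        rw [smul_comm_scalar]
        refine Submodule.smul_mem _ _ (hx ?_)
        rw [← Submodule.restrictScalars_mem K, ih]
        exact h
      | mem x hx =>
        obtain ⟨i, j, p, k, hp, rfl⟩ := hx
        obtain ⟨s, t, a⟩ := a
        by_cases h : s = j
        · subst h
          refine Submodule.subset_span ⟨i, t, p.cons a, k, by simp [hp], ?_⟩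
          rw [pathCls_cons, mul_smul]
        · rw [← mul_smul, arrElt_eq_pathCls, pathCls_mul_ne K L p a.toPath (Ne.symm h), zero_smul]
          exact zero_mem _
    · rw [Submodule.span_le]
      rintro _ ⟨i, j, p, k, hp, rfl⟩
      cases p with
      | nil => simp at hp
      | cons p a =>
        rw [pathCls_cons, mul_smul]
        refine Submodule.subset_span ⟨_, _, ?_, rfl⟩
        have := pathCls_smul_mem_rad (K := K) (L := L) p (l := 0) (m := g k)
          (by rw [rad_zero]; trivial)
        simp only [Quiver.Path.length_cons, Nat.add_right_cancel_iff] at hp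
        rwa [zero_add, hp] at this

theorem rad_eq_bot : rad K V L M (L + 1) = ⊥ := by
  have h := rad_eq_span (K := K) (V := V) (L := L) (fun m : M => m) (by simp) (L + 1)
  have h' : (rad K V L M (L + 1)).restrictScalars K = ⊥ := by
    rw [h, Submodule.span_eq_bot]
    rintro _ ⟨i, j, p, k, hp, rfl⟩
    rw [pathCls_eq_zero K L p hp.ge, zero_smul]
  rwa [Submodule.restrictScalars_eq_bot_iff] at h'

theorem rad_eq_bot_of_le {l : ℕ} (hl : L + 1 ≤ l) : rad K V L M l = ⊥ :=
  le_bot_iff.1 ((rad_antitone hl).trans rad_eq_bot.le)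

end Rad

/-! ## Dimension vectors -/

section DimVec

variable {K : Type u} {V : Type} [Field K] [Fintype V] [Quiver.{0} V] {L : ℕ}

variable (K V L) in
/-- The dimension of `e_i M`. -/
def vdim (M : Type*) [AddCommGroup M] [Module K M] [Module (TruncAlg K V L) M]
    [IsScalarTower K (TruncAlg K V L) M] (i : V) : ℕ :=
  Module.finrank K (LinearMap.range (lsmulK M (idem K L i)))

variable {M : Type*} [AddCommGroup M] [Module K M] [Module (TruncAlg K V L) M]
  [IsScalarTower K (TruncAlg K V L) M]
variable {N : Type*} [AddCommGroup N] [Module K N] [Module (TruncAlg K V L) N]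
  [IsScalarTower K (TruncAlg K V L) N]

theorem idem_smul_idem_smul (i : V) (m : M) : idem K L i • idem K L i • m = idem K L i • m := by
  rw [← mul_smul, idem_mul_self]

theorem idem_smul_idem_smul_ne {i j : V} (h : i ≠ j) (m : M) :
    idem K L i • idem K L j • m = 0 := by
  rw [← mul_smul, idem_mul_ne K L h, zero_smul]

theorem mem_range_idem_iff {i : V} {m : M} :
    m ∈ LinearMap.range (lsmulK M (idem K L i)) ↔ idem K L i • m = m := by
  constructor
  · rintro ⟨x, rfl⟩
    exact idem_smul_idem_smul i x
  · intro h
    exact ⟨m, h⟩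

/-- Multiplication by an idempotent is an exact functor, so rank-nullity applies to the components
at `i`. -/
theorem vdim_add_of_exact [FiniteDimensional K M] {P : Type*} [AddCommGroup P] [Module K P]
    [Module (TruncAlg K V L) P] [IsScalarTower K (TruncAlg K V L) P]
    (f : N →ₗ[TruncAlg K V L] M) (g : M →ₗ[TruncAlg K V L] P)
    (hf : Function.Injective f) (hfg : ∀ m, g m = 0 ↔ m ∈ LinearMap.range f)
    (hg : Function.Surjective g) (i : V) :
    vdim K V L M i = vdim K V L N i + vdim K V L P i := by
  let g' : LinearMap.range (lsmulK M (idem K L i)) →ₗ[K] P :=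
    (g.restrictScalars K).domRestrict _
  have hr : LinearMap.range g' = LinearMap.range (lsmulK P (idem K L i)) := by
    ext x
    constructor
    · rintro ⟨⟨_, m, rfl⟩, rfl⟩
      exact ⟨g m, (map_smul g _ _).symm⟩
    · rintro ⟨x, rfl⟩
      obtain ⟨m, rfl⟩ := hg x
      exact ⟨⟨_, m, rfl⟩, map_smul g _ _⟩
  have hk : Module.finrank K (LinearMap.ker g') = vdim K V L N i := by
    let f' : LinearMap.range (lsmulK N (idem K L i)) →ₗ[K]
        LinearMap.range (lsmulK M (idem K L i)) :=
      (f.restrictScalars K).restrict (by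
        rintro _ ⟨n, rfl⟩
        exact ⟨f n, (map_smul f _ _).symm⟩)
    have hf' : Function.Injective f' := fun x y h => Subtype.ext (hf (congrArg Subtype.val h))
    have hrf : LinearMap.range f' = LinearMap.ker g' := by
      ext ⟨m, hm⟩
      rw [LinearMap.mem_ker]
      constructor
      · rintro ⟨n, hn⟩
        exact (hfg m).2 ⟨n, congrArg Subtype.val hn⟩
      · intro h
        obtain ⟨n, rfl⟩ := (hfg m).1 h
        refine ⟨⟨idem K L i • n, n, rfl⟩, Subtype.ext ?_⟩
        exact (map_smul f _ _).trans (mem_range_idem_iff.1 hm)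
    rw [← hrf, LinearMap.finrank_range_of_inj hf', vdim]
  have := LinearMap.finrank_range_add_finrank_ker g'
  rw [hk, hr] at this
  rw [vdim, ← this, add_comm]
  rfl

theorem vdim_congr (e : M ≃ₗ[TruncAlg K V L] N) (i : V) : vdim K V L M i = vdim K V L N i := by
  refine LinearEquiv.finrank_eq ?_
  refine (e.restrictScalars K).submoduleMap (LinearMap.range (lsmulK M (idem K L i))) |>.trans
    (LinearEquiv.ofEq _ _ ?_)
  ext x
  constructor
  · rintro ⟨_, ⟨m, rfl⟩, rfl⟩
    exact ⟨e m, (map_smul e _ _).symm⟩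
  · rintro ⟨x, rfl⟩
    refine ⟨_, ⟨e.symm x, rfl⟩, ?_⟩
    exact (map_smul e _ _).trans (by simp)

variable (K V L M) in
/-- The dimension of `e_i J^l M`. -/
def radDim (l : ℕ) (i : V) : ℕ := vdim K V L (rad K V L M l) i

theorem radDim_eq_add [FiniteDimensional K M] (l : ℕ) (i : V) :
    radDim K V L M l i = radDim K V L M (l + 1) i + vdim K V L (RadLayer (TruncAlg K V L) M l) i := by
  have : FiniteDimensional K (rad K V L M l) :=
    inferInstanceAs (FiniteDimensional K ((rad K V L M l).restrictScalars K))
  refine vdim_add_of_exact (Submodule.inclusion (rad_succ_le l)) (Submodule.mkQ _)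
    (Submodule.inclusion_injective _) (fun m => ?_) (Submodule.mkQ_surjective _) i
  rw [← LinearMap.mem_ker, Submodule.ker_mkQ, Submodule.range_inclusion]
  rfl

theorem radDim_eq_zero {l : ℕ} (hl : L + 1 ≤ l) (i : V) : radDim K V L M l i = 0 := by
  have : Subsingleton (rad K V L M l) := by
    rw [rad_eq_bot_of_le hl]
    infer_instance
  have h : LinearMap.range (lsmulK (rad K V L M l) (idem K L i)) = ⊥ := Subsingleton.elim _ _
  rw [radDim, vdim, h, finrank_bot]

end DimVec

/-! ## The simple modules and radical layerings -/

section Simple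

variable {K : Type u} {V : Type} [Field K] [Fintype V] [Quiver.{0} V] {L : ℕ}
variable {M : Type*} [AddCommGroup M] [Module K M] [Module (TruncAlg K V L) M]
  [IsScalarTower K (TruncAlg K V L) M]

/-- The action factors through Λ/J, which the vertex homomorphisms identify with a product of copies
of K. -/
theorem smul_eq_sum_of_arr_smul_eq_zero (h : ∀ (a : Arr V) (m : M), arrElt K L a • m = 0)
    (r : TruncAlg K V L) (m : M) :
    r • m = ∑ i, vertexHom K L i r • idem K L i • m := by
  have h' : ∀ s ∈ pathSpan K V L 1, s • m = 0 := by
    intro s hs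
    induction hs using Submodule.span_induction with
    | zero => rw [zero_smul]
    | add x y _ _ hx hy => rw [add_smul, hx, hy, add_zero]
    | smul c x _ hx => rw [smul_assoc, hx, smul_zero]
    | mem x hx =>
      obtain ⟨i, j, p, hp, rfl⟩ := hx
      cases p with
      | nil => simp at hp
      | cons p a => rw [pathCls_cons, mul_smul, h]
  have := h' _ (sub_sum_vertexHom_mem K r)
  rw [sub_smul, sub_eq_zero, Finset.sum_smul] at this
  rw [this]
  exact Finset.sum_congr rfl fun i _ => smul_assoc _ _ _

theorem arr_smul_quotient_eq_zero {M : Type*} [AddCommGroup M] [Module (TruncAlg K V L) M]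
    {N : Submodule (TruncAlg K V L) M} (h : ∀ (a : Arr V) (m : M), arrElt K L a • m ∈ N)
    (a : Arr V) (m : M ⧸ N) : arrElt K L a • m = 0 := by
  obtain ⟨m, rfl⟩ := N.mkQ_surjective m
  rw [← map_smul, Submodule.mkQ_apply, Submodule.Quotient.mk_eq_zero]
  exact h a m

/-- The residue class of `e_i` in `S_i`. -/
def simpleGen (K : Type u) {V : Type} [Field K] [Fintype V] [Quiver.{0} V] (L : ℕ) (i : V) :
    SimpleMod K L i :=
  Submodule.Quotient.mk ⟨idem K L i, Ideal.mem_span_singleton_self _⟩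

theorem arr_smul_simple (i : V) (a : Arr V) (s : SimpleMod K L i) : arrElt K L a • s = 0 :=
  arr_smul_quotient_eq_zero
    (fun a _ => Submodule.smul_mem_smul (arrElt_mem_jacobson K a) Submodule.mem_top) a s

theorem smul_simpleGen (i : V) (r : TruncAlg K V L) :
    r • simpleGen K L i = vertexHom K L i r • simpleGen K L i := by
  have hid : idem K L i • simpleGen K L i = simpleGen K L i := by
    refine congrArg Submodule.Quotient.mk (Subtype.ext ?_)
    exact idem_mul_self K L i
  rw [smul_eq_sum_of_arr_smul_eq_zero (arr_smul_simple i), Finset.sum_eq_single i]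
  · rw [hid]
  · intro j _ hj
    rw [← hid, idem_smul_idem_smul_ne hj, smul_zero]
  · simp

/-- The vertex homomorphism at `i` vanishes on `J e_i` but not on `e_i`. -/
theorem simpleGen_ne_zero (i : V) : simpleGen K L i ≠ 0 := by
  intro h
  have h' := (Submodule.Quotient.mk_eq_zero _).1 h
  have hJ : ∀ y : projIdeal K L i, y ∈ Ring.jacobson (TruncAlg K V L) •
      (⊤ : Submodule (TruncAlg K V L) (projIdeal K L i)) → vertexHom K L i y.1 = 0 := by
    intro y hy
    refine Submodule.smul_induction_on hy (fun r hr n _ => ?_) fun x y hx hy => ?_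
    · rw [Submodule.coe_smul, smul_eq_mul, map_mul,
        vertexHom_eq_zero_of_mem_jacobson K hr, zero_mul]
    · rw [Submodule.coe_add, map_add, hx, hy, add_zero]
  have := hJ _ h'
  rw [vertexHom_self] at this
  exact one_ne_zero this

theorem exists_smul_simpleGen (i : V) (s : SimpleMod K L i) :
    ∃ c : K, s = c • simpleGen K L i := by
  obtain ⟨⟨y, hy⟩, rfl⟩ := Submodule.mkQ_surjective _ s
  obtain ⟨r, rfl⟩ := Ideal.mem_span_singleton'.1 hy
  refine ⟨vertexHom K L i r, ?_⟩
  rw [← smul_simpleGen i r]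
  rfl

/-- A product of simple modules. -/
abbrev SimpleProd (K : Type u) {V : Type} [Field K] [Fintype V] [Quiver.{0} V] (L : ℕ)
    (n : V → ℕ) : Type u := (c : Σ i : V, Fin (n i)) → SimpleMod K L c.1

/-- The coordinates of a product of simple modules. -/
def simpleProdEquiv (n : V → ℕ) : ((Σ i : V, Fin (n i)) → K) ≃ₗ[K] SimpleProd K L n :=
  LinearEquiv.piCongrRight fun c => LinearEquiv.ofBijective
    (LinearMap.toSpanSingleton K _ (simpleGen K L c.1))
    ⟨by
      rw [← LinearMap.ker_eq_bot]
      exact LinearMap.ker_toSpanSingleton K (simpleGen_ne_zero c.1), fun s => by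
      obtain ⟨k, rfl⟩ := exists_smul_simpleGen c.1 s
      exact ⟨k, rfl⟩⟩

theorem simpleProdEquiv_apply (n : V → ℕ) (k : (Σ i : V, Fin (n i)) → K) (c : Σ i : V, Fin (n i)) :
    (simpleProdEquiv (L := L) n k) c = k c • simpleGen K L c.1 := rfl

theorem vdim_simpleProd (n : V → ℕ) (i : V) : vdim K V L (SimpleProd K L n) i = n i := by
  classical
  -- Extension by zero from the copies of `S_i` to all factors; its image is the component at `i`.
  let f : (Fin (n i) → K) →ₗ[K] ((Σ i : V, Fin (n i)) → K) :=
    { toFun := fun g c => if h : c.1 = i then g (h ▸ c.2) else 0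
      map_add' := fun g g' => by
        funext c
        by_cases h : c.1 = i <;> simp [h]
      map_smul' := fun r g => by
        funext c
        by_cases h : c.1 = i <;> simp [h] }
  have hf : Function.Injective f := by
    intro g g' h
    funext k
    simpa [f] using congrFun h ⟨i, k⟩
  have hr : LinearMap.range (lsmulK (SimpleProd K L n) (idem K L i)) =
      LinearMap.range ((simpleProdEquiv (L := L) n).toLinearMap ∘ₗ f) := by
    ext x
    constructor
    · rintro ⟨x, rfl⟩
      obtain ⟨k, rfl⟩ := (simpleProdEquiv n).surjective x
      refine ⟨fun j => k ⟨i, j⟩, ?_⟩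
      funext ⟨j, c⟩
      rw [LinearMap.comp_apply, LinearEquiv.coe_coe, simpleProdEquiv_apply, lsmulK_apply,
        Pi.smul_apply, simpleProdEquiv_apply, smul_comm_scalar, smul_simpleGen]
      by_cases h : j = i
      · subst h
        rw [vertexHom_self, one_smul]
        simp [f]
      · rw [vertexHom_ne K L (Ne.symm h)]
        simp [f, h]
    · rintro ⟨g, rfl⟩
      rw [mem_range_idem_iff]
      funext ⟨j, c⟩
      rw [Pi.smul_apply, LinearMap.comp_apply, LinearEquiv.coe_coe, simpleProdEquiv_apply,
        smul_comm_scalar, smul_simpleGen]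
      by_cases h : j = i
      · subst h
        rw [vertexHom_self, one_smul]
      · simp [f, h]
  rw [vdim, hr, LinearMap.finrank_range_of_inj, Module.finrank_fin_fun]
  exact (simpleProdEquiv n).injective.comp hf

/-- A module killed by the arrows is the direct sum of its vertex components, and a basis of each
component splits it into simples. Hence layers can be compared through dimension vectors. -/
theorem nonempty_equiv_simpleProd [FiniteDimensional K M]
    (hJ : ∀ (a : Arr V) (m : M), arrElt K L a • m = 0) (n : V → ℕ)
    (hn : ∀ i, vdim K V L M i = n i) :
    Nonempty (M ≃ₗ[TruncAlg K V L] SimpleProd K L n) := by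
  have e : ∀ i, LinearMap.range (lsmulK M (idem K L i)) ≃ₗ[K] (Fin (n i) → K) := fun i =>
    LinearEquiv.ofFinrankEq _ _ (by rw [Module.finrank_fin_fun]; exact hn i)
  let f₀ : M →ₗ[K] ((Σ i : V, Fin (n i)) → K) := LinearMap.pi fun c =>
    LinearMap.proj c.2 ∘ₗ (e c.1).toLinearMap ∘ₗ (lsmulK M (idem K L c.1)).rangeRestrict
  have hf₀ : ∀ m c, f₀ m c = e c.1 ⟨idem K L c.1 • m, m, rfl⟩ c.2 := fun m c => rfl
  have hzero : ∀ {i j : V}, i ≠ j → ∀ m : M, (⟨idem K L i • idem K L j • m, _, rfl⟩ :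
      LinearMap.range (lsmulK M (idem K L i))) = 0 := fun h m =>
    Subtype.ext (idem_smul_idem_smul_ne h m)
  let f₁ : M →ₗ[K] SimpleProd K L n := (simpleProdEquiv n).toLinearMap ∘ₗ f₀
  have hf₁ : ∀ m c, f₁ m c = f₀ m c • simpleGen K L c.1 := fun m c => rfl
  let f : M →ₗ[TruncAlg K V L] SimpleProd K L n := linOfGen f₁
    (fun i m => by
      funext ⟨j, c⟩
      rw [Pi.smul_apply, hf₁, hf₁, smul_comm_scalar, smul_simpleGen]
      by_cases h : j = i
      · subst h
        rw [vertexHom_self, one_smul, hf₀, hf₀]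
        simp only [idem_smul_idem_smul]
      · rw [vertexHom_ne K L (Ne.symm h), zero_smul, smul_zero, hf₀, hzero h, map_zero]
        exact zero_smul _ _)
    (fun a m => by
      rw [hJ, map_zero]
      funext c
      exact (arr_smul_simple c.1 a _).symm)
  refine ⟨LinearEquiv.ofBijective f ⟨?_, ?_⟩⟩
  · rw [injective_iff_map_eq_zero]
    intro m hm
    have hm₀ : f₀ m = 0 := (simpleProdEquiv n).injective (hm.trans (map_zero _).symm)
    rw [← sum_idem_smul (K := K) (V := V) (L := L) m]
    refine Finset.sum_eq_zero fun i _ => ?_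
    have : e i ⟨idem K L i • m, m, rfl⟩ = 0 := by
      funext c
      exact congrFun hm₀ ⟨i, c⟩
    rw [LinearEquiv.map_eq_zero_iff] at this
    exact congrArg Subtype.val this
  · intro y
    obtain ⟨k, rfl⟩ := (simpleProdEquiv n).surjective y
    let w : ∀ i : V, LinearMap.range (lsmulK M (idem K L i)) := fun i =>
      (e i).symm fun c => k ⟨i, c⟩
    refine ⟨∑ i, (w i : M), ?_⟩
    refine congrArg (simpleProdEquiv n) ?_
    funext ⟨i, c⟩
    rw [hf₀]
    have : (⟨idem K L i • ∑ j, (w j : M), _, rfl⟩ : LinearMap.range (lsmulK M (idem K L i))) =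
        w i := by
      refine Subtype.ext ?_
      change idem K L i • ∑ j, (w j : M) = w i
      rw [Finset.smul_sum, Finset.sum_eq_single i]
      · exact mem_range_idem_iff.1 (w i).2
      · intro j _ hj
        rw [← mem_range_idem_iff.1 (w j).2, idem_smul_idem_smul_ne hj.symm]
      · simp
    rw [this, LinearEquiv.apply_symm_apply]

/-- The radical layering is determined by the dimensions of the spaces `e_i J^l M`. -/
theorem hasRadLayering_iff (S : SemisimpleSeq V L) (M : Type u) [AddCommGroup M] [Module K M]
    [Module (TruncAlg K V L) M] [IsScalarTower K (TruncAlg K V L) M] [FiniteDimensional K M] :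
    HasRadLayering (K := K) S M ↔
      ∀ (l : Fin (L + 1)) i, radDim K V L M l i = radDim K V L M (l + 1) i + S l i := by
  have : ∀ l, FiniteDimensional K (RadLayer (TruncAlg K V L) M l) := fun l => by
    have : FiniteDimensional K (rad K V L M l) :=
      inferInstanceAs (FiniteDimensional K ((rad K V L M l).restrictScalars K))
    infer_instance
  refine forall_congr' fun l => ?_
  have hlayer : (∀ i, radDim K V L M l i = radDim K V L M (l + 1) i + S l i) ↔
      ∀ i, vdim K V L (RadLayer (TruncAlg K V L) M l) i = S l i := by
    refine forall_congr' fun i => ?_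
    rw [radDim_eq_add, Nat.add_left_cancel_iff]
  rw [hlayer]
  constructor
  · rintro ⟨e⟩ i
    rw [vdim_congr e, vdim_simpleProd]
  · intro h
    refine nonempty_equiv_simpleProd (fun a m => ?_) _ h
    refine arr_smul_quotient_eq_zero (fun a m => ?_) a m
    exact arrElt_smul_mem_rad a m.2

end Simple

/-! ## Forests -/

/-- A forest of paths in a quiver: the nodes are labelled by vertices and each node that is not a root
is reached from its parent by an arrow. Distinct nodes are distinct children. -/
structure Forest (V : Type) [Quiver.{0} V] (L : ℕ) (σ : Type) where
  /-- the label of a node -/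
  vtx : σ → V
  /-- the depth of a node -/
  depth : σ → ℕ
  /-- the parent of a node, with the arrow leading to the node -/
  par : σ → Option (σ × Arr V)
  src : ∀ {z y a}, par z = some (y, a) → a.1 = vtx y
  tgt : ∀ {z y a}, par z = some (y, a) → a.2.1 = vtx z
  depth_succ : ∀ {z y a}, par z = some (y, a) → depth z = depth y + 1
  depth_root : ∀ {z}, par z = none → depth z = 0
  inj : ∀ {z z' q}, par z = some q → par z' = some q → z = z'
  depth_le : ∀ z, depth z ≤ L

/-! ### Skeleta and the radical filtration -/

section ForestBasis

variable {K : Type u} {V : Type} [Field K] [Fintype V] [Quiver.{0} V] {L : ℕ}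
variable {M : Type*} [AddCommGroup M] [Module K M] [Module (TruncAlg K V L) M]
  [IsScalarTower K (TruncAlg K V L) M] {σ : Type}

/-- The nodes of the forest form a basis of the module which is compatible with the radical
filtration: a skeleton of the module. -/
structure IsForestBasis (F : Forest V L σ) (b : Module.Basis σ K M) : Prop where
  idem_smul : ∀ y, idem K L (F.vtx y) • b y = b y
  arr_smul : ∀ {z y a}, F.par z = some (y, a) → arrElt K L a • b y = b z
  childless : ∀ {y : σ} {a : Arr V}, a.1 = F.vtx y → (∀ z, F.par z ≠ some (y, a)) →
    arrElt K L a • b y ∈ Submodule.span K (b '' {z | F.depth y + 1 ≤ F.depth z})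

namespace IsForestBasis

variable {F : Forest V L σ} {b : Module.Basis σ K M}

theorem idem_smul_ne (h : IsForestBasis F b) {y : σ} {i : V} (hi : i ≠ F.vtx y) :
    idem K L i • b y = 0 := by
  rw [← h.idem_smul, idem_smul_idem_smul_ne hi]

theorem arr_smul_ne (h : IsForestBasis F b) {y : σ} {a : Arr V} (ha : a.1 ≠ F.vtx y) :
    arrElt K L a • b y = 0 := by
  rw [← h.idem_smul, ← mul_smul, arrElt_mul_idem_ne K L (Ne.symm ha), zero_smul]

theorem mem_rad (h : IsForestBasis F b) (z : σ) : b z ∈ rad K V L M (F.depth z) := by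
  generalize hn : F.depth z = n
  induction n generalizing z with
  | zero => rw [rad_zero]; trivial
  | succ n ih =>
    rcases hp : F.par z with _ | ⟨y, a⟩
    · rw [F.depth_root hp] at hn
      omega
    · have hd := F.depth_succ hp
      rw [← h.arr_smul hp]
      exact arrElt_smul_mem_rad a (ih y (by omega))

/-- An arrow sends a node to a child, to a combination of strictly deeper nodes, or to zero; so J
raises the depth by at least one. Conversely a node of depth l is reached from a root by l arrows.
-/
theorem rad_eq_span_image (h : IsForestBasis F b) (l : ℕ) :
    (rad K V L M l).restrictScalars K = Submodule.span K (b '' {z | l ≤ F.depth z}) := by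
  apply le_antisymm
  · induction l with
    | zero =>
      have : {z | 0 ≤ F.depth z} = Set.univ := by ext; simp
      rw [this, Set.image_univ, b.span_eq]
      exact le_top
    | succ l ih =>
      rw [rad_succ_eq_span, Submodule.span_le]
      rintro _ ⟨a, n, hn, rfl⟩
      have hn' := ih hn
      clear hn
      induction hn' using Submodule.span_induction with
      | zero => rw [smul_zero]; exact zero_mem _
      | add x y _ _ hx hy => rw [smul_add]; exact add_mem hx hy
      | smul c x _ hx => rw [smul_comm_scalar]; exact Submodule.smul_mem _ _ hx
      | mem x hx =>
        obtain ⟨y, hy, rfl⟩ := hx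
        rw [Set.mem_ofPred_eq] at hy
        by_cases ha : a.1 = F.vtx y
        · by_cases hc : ∃ z, F.par z = some (y, a)
          · obtain ⟨z, hz⟩ := hc
            rw [h.arr_smul hz]
            refine Submodule.subset_span ⟨z, ?_, rfl⟩
            rw [Set.mem_ofPred_eq, F.depth_succ hz]
            omega
          · push Not at hc
            refine Submodule.span_mono (Set.image_mono ?_) (h.childless ha hc)
            intro z hz
            rw [Set.mem_ofPred_eq] at hz ⊢
            omega
        · rw [h.arr_smul_ne ha]
          exact zero_mem _
  · rw [Submodule.span_le]
    rintro _ ⟨z, hz, rfl⟩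
    exact rad_antitone hz (h.mem_rad z)

end IsForestBasis

theorem radDim_eq_finrank_map (l : ℕ) (i : V) : radDim K V L M l i =
    Module.finrank K (((rad K V L M l).restrictScalars K).map (lsmulK M (idem K L i))) := by
  let f : rad K V L M l →ₗ[K] M := ((rad K V L M l).restrictScalars K).subtype
  have : ((rad K V L M l).restrictScalars K).map (lsmulK M (idem K L i)) =
      (LinearMap.range (lsmulK (rad K V L M l) (idem K L i))).map f := by
    ext x
    constructor
    · rintro ⟨m, hm, rfl⟩
      exact ⟨_, ⟨⟨m, hm⟩, rfl⟩, rfl⟩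
    · rintro ⟨_, ⟨m, rfl⟩, rfl⟩
      exact ⟨m.1, m.2, rfl⟩
  rw [this, radDim, vdim]
  exact (Submodule.equivMapOfInjective f Subtype.val_injective _).finrank_eq

theorem IsForestBasis.radDim_eq [Fintype σ] {F : Forest V L σ} {b : Module.Basis σ K M}
    (h : IsForestBasis F b) (l : ℕ) (i : V) :
    radDim K V L M l i = Nat.card {z // l ≤ F.depth z ∧ F.vtx z = i} := by
  classical
  rw [radDim_eq_finrank_map, h.rad_eq_span_image, Submodule.map_span]
  have : Submodule.span K (lsmulK M (idem K L i) '' (b '' {z | l ≤ F.depth z})) =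
      Submodule.span K (Set.range fun z : {z // l ≤ F.depth z ∧ F.vtx z = i} => b z) := by
    apply le_antisymm
    · rw [Submodule.span_le]
      rintro _ ⟨_, ⟨z, hz, rfl⟩, rfl⟩
      rw [lsmulK_apply]
      by_cases hi : F.vtx z = i
      · subst hi
        rw [h.idem_smul]
        exact Submodule.subset_span ⟨⟨z, hz, rfl⟩, rfl⟩
      · rw [h.idem_smul_ne (Ne.symm hi)]
        exact zero_mem _
    · apply Submodule.span_mono
      rintro _ ⟨⟨z, hz, rfl⟩, rfl⟩
      exact ⟨b z, ⟨z, hz, rfl⟩, h.idem_smul z⟩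
  rw [this, finrank_span_eq_card, Nat.card_eq_fintype_card]
  exact b.linearIndependent.comp _ Subtype.val_injective

/-- The number of nodes of given depth and label. -/
def Forest.count (F : Forest V L σ) (l : ℕ) (i : V) : ℕ :=
  Nat.card {z // F.depth z = l ∧ F.vtx z = i}

theorem IsForestBasis.radDim_eq_add_count [Fintype σ] {F : Forest V L σ}
    {b : Module.Basis σ K M} (h : IsForestBasis F b) (l : ℕ) (i : V) :
    radDim K V L M l i = radDim K V L M (l + 1) i + F.count l i := by
  classical
  rw [h.radDim_eq, h.radDim_eq, Forest.count]
  simp only [Nat.card_eq_fintype_card]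
  rw [Fintype.card_subtype, Fintype.card_subtype, Fintype.card_subtype, ← Finset.card_union_of_disjoint]
  · congr 1
    ext z
    simp only [Finset.mem_filter, Finset.mem_univ, true_and, Finset.mem_union]
    constructor
    · rintro ⟨h1, h2⟩
      by_cases h3 : F.depth z = l
      · exact Or.inr ⟨h3, h2⟩
      · exact Or.inl ⟨by omega, h2⟩
    · rintro (⟨h1, h2⟩ | ⟨h1, h2⟩)
      · exact ⟨by omega, h2⟩
      · exact ⟨h1.ge, h2⟩
  · rw [Finset.disjoint_left]
    intro z hz hz'
    simp only [Finset.mem_filter, Finset.mem_univ, true_and] at hz hz'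
    omega

theorem IsForestBasis.hasRadLayering_iff {M : Type u} [AddCommGroup M] [Module K M]
    [Module (TruncAlg K V L) M] [IsScalarTower K (TruncAlg K V L) M] [Fintype σ]
    {F : Forest V L σ} {b : Module.Basis σ K M} (h : IsForestBasis F b) (S : SemisimpleSeq V L) :
    HasRadLayering (K := K) S M ↔ ∀ (l : Fin (L + 1)) i, S l i = F.count l i := by
  have : FiniteDimensional K M := b.finiteDimensional_of_finite
  rw [TruncPath.hasRadLayering_iff]
  refine forall_congr' fun l => forall_congr' fun i => ?_
  rw [h.radDim_eq_add_count, Nat.add_left_cancel_iff, eq_comm]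

end ForestBasis

/-! ### The module of a forest -/

section ForestMod

variable (K : Type u) {V : Type} [Field K] [Fintype V] [Quiver.{0} V] {L : ℕ} {σ : Type}

namespace Forest

variable (F : Forest V L σ)

open Classical in
/-- The action of the generators on the functions on the nodes of a forest, where the edge above a
node `z` has the weight `w z`. -/
def act (w : σ → K) : Gen V → Module.End K (σ → K)
  | .inl i =>
    { toFun := fun f z => if F.vtx z = i then f z else 0
      map_add' := fun f g => by funext z; by_cases h : F.vtx z = i <;> simp [h]
      map_smul' := fun c f => by funext z; by_cases h : F.vtx z = i <;> simp [h] }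
  | .inr a =>
    { toFun := fun f z => (F.par z).elim 0 fun q => if q.2 = a then w z * f q.1 else 0
      map_add' := fun f g => by
        funext z
        rw [Pi.add_apply]
        rcases F.par z with _ | q
        · exact (add_zero (0 : K)).symm
        · by_cases h : q.2 = a <;> simp [h, mul_add]
      map_smul' := fun c f => by
        funext z
        rw [Pi.smul_apply]
        rcases F.par z with _ | q
        · exact (smul_zero c).symm
        · by_cases h : q.2 = a <;> simp [h, mul_left_comm] }

variable {K} (w : σ → K)

open Classical in
theorem act_inl (i : V) (f : σ → K) (z : σ) :
    F.act K w (.inl i) f z = if F.vtx z = i then f z else 0 := rfl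

open Classical in
theorem act_inr_of_none (a : Arr V) (f : σ → K) {z : σ} (h : F.par z = none) :
    F.act K w (.inr a) f z = 0 := by
  change (F.par z).elim 0 _ = _
  rw [h]
  rfl

open Classical in
theorem act_inr_of_some (a : Arr V) (f : σ → K) {z y : σ} {a' : Arr V}
    (h : F.par z = some (y, a')) :
    F.act K w (.inr a) f z = if a' = a then w z * f y else 0 := by
  change (F.par z).elim 0 _ = _
  rw [h]
  rfl

/-- Evaluating at `z` after applying an arrow looks at the parent of `z`; a path longer than the
depth of `z` runs out of ancestors. This gives the vanishing of paths of length L+1. -/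
theorem evalPath_act_eq_zero {i j : V} (p : Quiver.Path i j) (f : σ → K) (z : σ)
    (hz : F.depth z < p.length) : evalPath (F.act K w) p f z = 0 := by
  induction p generalizing z with
  | nil => simp at hz
  | cons p a ih =>
    rcases hp : F.par z with _ | ⟨y, a'⟩
    · exact F.act_inr_of_none w _ _ hp
    · refine (F.act_inr_of_some w _ _ hp).trans ?_
      rw [ih y, mul_zero, ite_self]
      have := F.depth_succ hp
      rw [Quiver.Path.length_cons] at hz
      omega

theorem exists_algHom_act :
    ∃ φ : TruncAlg K V L →ₐ[K] Module.End K (σ → K), ∀ g, φ (gen K L g) = F.act K w g := by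
  classical
  refine exists_algHom L (F.act K w) ?_ ?_ ?_ ?_ ?_ ?_
  · intro i
    ext1 f
    funext z
    rw [Module.End.mul_apply]
    simp only [act_inl]
    by_cases h : F.vtx z = i <;> simp [h]
  · intro i j hij
    ext1 f
    funext z
    rw [Module.End.mul_apply]
    simp only [act_inl]
    by_cases h : F.vtx z = i
    · simp [h, hij]
    · simp [h]
  · ext1 f
    funext z
    rw [LinearMap.sum_apply, Finset.sum_apply]
    simp [act_inl]
  · intro a
    ext1 f
    funext z
    rw [Module.End.mul_apply]
    rcases hp : F.par z with _ | ⟨y, a'⟩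
    · rw [F.act_inr_of_none w _ _ hp, F.act_inr_of_none w _ _ hp]
    · rw [F.act_inr_of_some w _ _ hp, F.act_inr_of_some w _ _ hp, act_inl]
      by_cases h : a' = a
      · subst h
        rw [if_pos rfl, if_pos rfl, if_pos (F.src hp).symm]
      · rw [if_neg h, if_neg h]
  · intro a
    ext1 f
    funext z
    rw [Module.End.mul_apply, act_inl]
    rcases hp : F.par z with _ | ⟨y, a'⟩
    · rw [F.act_inr_of_none w _ _ hp, ite_self]
    · rw [F.act_inr_of_some w _ _ hp]
      by_cases h : a' = a
      · subst h
        rw [if_pos (F.tgt hp).symm]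
      · rw [if_neg h, ite_self]
  · intro i j p hp
    ext1 f
    funext z
    refine F.evalPath_act_eq_zero w p f z ?_
    have := F.depth_le z
    omega

open Classical in
theorem act_inl_single (i : V) (y : σ) :
    F.act K w (.inl i) (Pi.single y 1) = if F.vtx y = i then Pi.single y 1 else 0 := by
  funext z
  rw [act_inl]
  by_cases h : z = y
  · subst h
    by_cases h' : F.vtx z = i <;> simp [h']
  · by_cases h' : F.vtx y = i <;> simp [h, h']

open Classical in
theorem act_inr_single {z y : σ} {a : Arr V} (h : F.par z = some (y, a)) :
    F.act K w (.inr a) (Pi.single y 1) = w z • Pi.single z 1 := by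
  funext x
  rcases hp : F.par x with _ | ⟨y', a'⟩
  · rw [F.act_inr_of_none w _ _ hp]
    have : x ≠ z := by
      rintro rfl
      rw [h] at hp
      cases hp
    simp [this]
  · rw [F.act_inr_of_some w _ _ hp]
    by_cases hx : x = z
    · subst hx
      rw [h] at hp
      cases hp
      simp
    · rw [Pi.smul_apply, Pi.single_eq_of_ne hx, smul_zero]
      by_cases ha : a' = a
      · subst ha
        have : y' ≠ y := by
          rintro rfl
          exact hx (F.inj hp h)
        simp [this]
      · rw [if_neg ha]

open Classical in
theorem act_inr_single_of_childless {y : σ} {a : Arr V} (h : ∀ z, F.par z ≠ some (y, a)) :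
    F.act K w (.inr a) (Pi.single y 1) = 0 := by
  funext x
  rcases hp : F.par x with _ | ⟨y', a'⟩
  · rw [F.act_inr_of_none w _ _ hp]
    rfl
  · rw [F.act_inr_of_some w _ _ hp]
    by_cases ha : a' = a
    · subst ha
      have : y' ≠ y := by
        rintro rfl
        exact h x hp
      simp [this]
    · rw [if_neg ha]
      rfl

end Forest

/-- The module with basis the nodes of a forest. -/
def ForestMod (_F : Forest V L σ) : Type u := σ → K

variable (F : Forest V L σ)

instance : AddCommGroup (ForestMod K F) := inferInstanceAs (AddCommGroup (σ → K))
instance : Module K (ForestMod K F) := inferInstanceAs (Module K (σ → K))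

variable {K} in
/-- The action of the truncated path algebra on the module of a forest. -/
def Forest.algHom (w : σ → K) : TruncAlg K V L →ₐ[K] Module.End K (σ → K) :=
  (F.exists_algHom_act w).choose

variable {K} in
theorem Forest.algHom_gen (w : σ → K) (g : Gen V) : F.algHom w (gen K L g) = F.act K w g :=
  (F.exists_algHom_act w).choose_spec g

instance : Module (TruncAlg K V L) (ForestMod K F) :=
  letI : Module (Module.End K (σ → K)) (ForestMod K F) :=
    inferInstanceAs (Module (Module.End K (σ → K)) (σ → K))
  Module.compHom (ForestMod K F) (F.algHom fun _ => (1 : K)).toRingHom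

theorem ForestMod.smul_def (r : TruncAlg K V L) (f : ForestMod K F) :
    r • f = F.algHom (fun _ => (1 : K)) r f := rfl

instance : IsScalarTower K (TruncAlg K V L) (ForestMod K F) where
  smul_assoc c r f := by
    rw [ForestMod.smul_def, ForestMod.smul_def, map_smul]
    rfl

/-- The standard basis of the module of a forest. -/
def ForestMod.basis [Finite σ] : Module.Basis σ K (ForestMod K F) := Pi.basisFun K σ

variable [Finite σ]

open Classical in
theorem ForestMod.basis_apply (y : σ) : ForestMod.basis K F y = (Pi.single y 1 : σ → K) :=
  Pi.basisFun_apply K σ y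

theorem ForestMod.arr_smul_of_childless {y : σ} {a : Arr V} (h : ∀ z, F.par z ≠ some (y, a)) :
    arrElt K L a • ForestMod.basis K F y = 0 := by
  rw [ForestMod.smul_def, ForestMod.basis_apply, arrElt, Forest.algHom_gen]
  exact F.act_inr_single_of_childless _ h

theorem ForestMod.isForestBasis : IsForestBasis F (ForestMod.basis K F) where
  idem_smul y := by
    rw [ForestMod.smul_def, ForestMod.basis_apply]
    change F.algHom _ (gen K L (.inl _)) _ = _
    rw [Forest.algHom_gen, F.act_inl_single, if_pos rfl]
  arr_smul h := by
    rw [ForestMod.smul_def, ForestMod.basis_apply, ForestMod.basis_apply, arrElt,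
      Forest.algHom_gen, F.act_inr_single _ h, one_smul]
  childless _ h := by
    rw [ForestMod.arr_smul_of_childless K F h]
    exact zero_mem _

end ForestMod

/-! ## Existence of skeleta -/

section Skeleton

variable {K : Type u} {V : Type} [Field K] [Fintype V] [Quiver.{0} V] {L : ℕ}
variable {M : Type*} [AddCommGroup M] [Module K M] [Module (TruncAlg K V L) M]
  [IsScalarTower K (TruncAlg K V L) M]

/-- Words of arrows, applied to the component of a generator at a vertex. -/
abbrev Word (V : Type) [Quiver.{0} V] (ι : Type) : Type := List (Arr V) × V × ι

variable {ι : Type}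

namespace Word

/-- The vertex at which a word ends. -/
def vtx : Word V ι → V
  | ([], i, _) => i
  | (a :: _, _, _) => a.2.1

variable (K L) in
/-- The value of a word. -/
def val (g : ι → M) (w : Word V ι) : M :=
  w.1.foldr (fun a m => arrElt K L a • m) (idem K L w.2.1 • g w.2.2)

variable (g : ι → M)

theorem idem_smul_val (w : Word V ι) : idem K L w.vtx • val K L g w = val K L g w := by
  obtain ⟨_ | ⟨a, w⟩, i, k⟩ := w
  · exact idem_smul_idem_smul (K := K) i (g k)
  · rw [val, vtx, List.foldr_cons, ← mul_smul, idem_mul_arrElt]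

theorem val_mem_rad (w : Word V ι) : val K L g w ∈ rad K V L M w.1.length := by
  obtain ⟨w, i, k⟩ := w
  induction w with
  | nil =>
    change _ ∈ rad K V L M 0
    rw [rad_zero]
    trivial
  | cons a w ih => exact arrElt_smul_mem_rad (l := w.length) a ih

variable (K V L) in
/-- Selected words of length `l`, whose values form a basis of `J^l M` modulo `J^(l+1) M`. -/
def layer (g : ι → M) : ℕ → Set (Word V ι)
  | 0 => (linearIndepOn_empty K (fun w => ((rad K V L M 1).restrictScalars K).mkQ (val K L g w))).extend
      (Set.empty_subset {w | w.1 = []})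
  | l + 1 => (linearIndepOn_empty K
      (fun w => ((rad K V L M (l + 2)).restrictScalars K).mkQ (val K L g w))).extend
      (Set.empty_subset {w | ∃ a w', w' ∈ layer g l ∧ a.1 = w'.vtx ∧ w = (a :: w'.1, w'.2)})

variable (K V L) in
/-- The words from which those of length `l` are selected. -/
def candidates (g : ι → M) : ℕ → Set (Word V ι)
  | 0 => {w | w.1 = []}
  | l + 1 => {w | ∃ a w', w' ∈ layer K V L g l ∧ a.1 = w'.vtx ∧ w = (a :: w'.1, w'.2)}

theorem layer_subset (l : ℕ) : layer K V L g l ⊆ candidates K V L g l := by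
  cases l <;> exact LinearIndepOn.extend_subset _ _

theorem layer_linearIndepOn (l : ℕ) : LinearIndepOn K
    (fun w => ((rad K V L M (l + 1)).restrictScalars K).mkQ (val K L g w)) (layer K V L g l) := by
  cases l <;> exact LinearIndepOn.linearIndepOn_extend _ _

theorem image_candidates_subset (l : ℕ) :
    (fun w => ((rad K V L M (l + 1)).restrictScalars K).mkQ (val K L g w)) '' candidates K V L g l ⊆
      Submodule.span K ((fun w => ((rad K V L M (l + 1)).restrictScalars K).mkQ (val K L g w)) ''
        layer K V L g l) := by
  cases l <;> exact LinearIndepOn.image_subset_span_image_extend _ _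

theorem val_candidate_mem {l : ℕ} {w : Word V ι} (hw : w ∈ candidates K V L g l) :
    val K L g w ∈ Submodule.span K (val K L g '' layer K V L g l) ⊔
      (rad K V L M (l + 1)).restrictScalars K := by
  have h := image_candidates_subset g l ⟨w, hw, rfl⟩
  rw [← Set.image_image, SetLike.mem_coe, ← Submodule.map_span] at h
  obtain ⟨y, hy, hyw⟩ := h
  replace hyw := (Submodule.Quotient.eq _).1 hyw.symm
  rw [← add_sub_cancel y (val K L g w)]
  exact Submodule.add_mem_sup hy hyw

theorem length_of_mem_layer {l : ℕ} {w : Word V ι} (hw : w ∈ layer K V L g l) : w.1.length = l := by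
  induction l generalizing w with
  | zero =>
    have : w.1 = [] := layer_subset g 0 hw
    rw [this, List.length_nil]
  | succ l ih =>
    obtain ⟨a, w', hw', -, rfl⟩ := layer_subset g (l + 1) hw
    rw [List.length_cons, ih hw']

/-- An arrow applied to a selected word is zero or a candidate of the next length, and the selected
candidates span all candidates modulo the next power of J. -/
theorem rad_le_sup (hg : Submodule.span K (Set.range g) = ⊤) (l : ℕ) :
    (rad K V L M l).restrictScalars K ≤ Submodule.span K (val K L g '' layer K V L g l) ⊔
      (rad K V L M (l + 1)).restrictScalars K := by
  induction l with
  | zero =>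
    rw [rad_eq_span g hg, Submodule.span_le]
    rintro _ ⟨i, j, p, k, hp, rfl⟩
    cases p with
    | nil => exact val_candidate_mem (K := K) (L := L) g (l := 0) (w := ([], i, k)) rfl
    | cons p a => simp at hp
  | succ l ih =>
    rw [rad_succ_eq_span, Submodule.span_le]
    rintro _ ⟨a, n, hn, rfl⟩
    obtain ⟨x, hx, y, hy, rfl⟩ := Submodule.mem_sup.1 (ih hn)
    rw [smul_add]
    refine add_mem ?_ (Submodule.mem_sup_right (arrElt_smul_mem_rad a hy))
    induction hx using Submodule.span_induction with
    | zero => rw [smul_zero]; exact zero_mem _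
    | add x y hx' hy' hx hy =>
      rw [smul_add]
      have hmem : ∀ z ∈ Submodule.span K (val K L g '' layer K V L g l),
          z ∈ rad K V L M l := by
        intro z hz
        refine (Submodule.span_le (p := (rad K V L M l).restrictScalars K)).2 ?_ hz
        rintro _ ⟨w, hw, rfl⟩
        have := val_mem_rad (K := K) (L := L) g w
        rwa [length_of_mem_layer g hw] at this
      refine add_mem (hx ?_) (hy ?_)
      · exact add_mem (hmem _ hx') (rad_succ_le l (by assumption))
      · exact add_mem (hmem _ hy') (rad_succ_le l (by assumption))
    | smul c x hx' hx =>
      have hmem : ∀ z ∈ Submodule.span K (val K L g '' layer K V L g l),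
          z ∈ rad K V L M l := by
        intro z hz
        refine (Submodule.span_le (p := (rad K V L M l).restrictScalars K)).2 ?_ hz
        rintro _ ⟨w, hw, rfl⟩
        have := val_mem_rad (K := K) (L := L) g w
        rwa [length_of_mem_layer g hw] at this
      rw [smul_comm_scalar]
      exact Submodule.smul_mem _ _ (hx (add_mem (hmem _ hx') (rad_succ_le l (by assumption))))
    | mem x hx =>
      obtain ⟨w, hw, rfl⟩ := hx
      by_cases ha : a.1 = w.vtx
      · exact val_candidate_mem g (l := l + 1) (w := (a :: w.1, w.2)) ⟨a, w, hw, ha, rfl⟩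
      · rw [← idem_smul_val, ← mul_smul, arrElt_mul_idem_ne K L (Ne.symm ha), zero_smul]
        exact zero_mem _

variable (K V L) in
/-- The selected words of length at least `l` and at most `L`. -/
def tail (g : ι → M) (l : ℕ) : Set (Word V ι) :=
  {w | l ≤ w.1.length ∧ w.1.length ≤ L ∧ w ∈ layer K V L g w.1.length}

theorem tail_eq_union {l : ℕ} (hl : l ≤ L) :
    tail K V L g l = tail K V L g (l + 1) ∪ layer K V L g l := by
  ext w
  constructor
  · rintro ⟨h1, h2, h3⟩
    by_cases h : l = w.1.length
    · subst h
      exact Or.inr h3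
    · exact Or.inl ⟨by omega, h2, h3⟩
  · rintro (⟨h1, h2, h3⟩ | h)
    · exact ⟨by omega, h2, h3⟩
    · have := length_of_mem_layer g h
      exact ⟨this.ge, this.le.trans hl, this.symm ▸ h⟩

theorem tail_spec (hg : Submodule.span K (Set.range g) = ⊤) (l : ℕ) :
    Submodule.span K (val K L g '' tail K V L g l) = (rad K V L M l).restrictScalars K ∧
      LinearIndepOn K (val K L g) (tail K V L g l) := by
  -- Downward induction on `l`, starting beyond L where both sides vanish: a basis of J^(l+1) M is
  -- completed by a basis of the layer J^l M / J^(l+1) M.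
  generalize hn : L + 1 - l = n
  induction n generalizing l with
  | zero =>
    have hl : L + 1 ≤ l := by omega
    have : tail K V L g l = ∅ := by
      ext w
      simp only [Set.mem_empty_iff_false, iff_false]
      rintro ⟨h1, h2, -⟩
      omega
    rw [this, rad_eq_bot_of_le hl]
    simp
  | succ n ih =>
    replace ih := ih (l + 1) (by omega)
    have hu := tail_eq_union (K := K) (V := V) (L := L) g (show l ≤ L by omega)
    rw [hu, Set.image_union, Submodule.span_union, ih.1]
    constructor
    · apply le_antisymm
      · refine sup_le (rad_succ_le l) (Submodule.span_le.2 ?_)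
        rintro _ ⟨w, hw, rfl⟩
        have := val_mem_rad (K := K) (L := L) g w
        rwa [length_of_mem_layer g hw] at this
      · rw [sup_comm]
        exact rad_le_sup g hg l
    · refine ih.2.union_of_quotient ?_
      rw [ih.1]
      exact layer_linearIndepOn g l

/-- The head of the list is the arrow applied last. Candidates only extend selected words, so the
selection is closed under dropping the head, which makes it a forest. -/
theorem mem_layer_of_cons {a : Arr V} {w : List (Arr V)} {q : V × ι} {l : ℕ}
    (h : ((a :: w, q) : Word V ι) ∈ layer K V L g (l + 1)) :
    ((w, q) : Word V ι) ∈ layer K V L g l ∧ a.1 = vtx (w, q) := by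
  obtain ⟨a', w', hw', ha', he⟩ := layer_subset g (l + 1) h
  simp only [Prod.mk.injEq, List.cons.injEq] at he
  obtain ⟨⟨rfl, rfl⟩, rfl⟩ := he
  exact ⟨hw', ha'⟩

variable (K V L) in
/-- The parent of a selected word. -/
def parent (g : ι → M) : tail K V L g 0 → Option (tail K V L g 0 × Arr V)
  | ⟨([], _), _⟩ => none
  | ⟨(a :: w, q), h⟩ => some (⟨(w, q), Nat.zero_le _, (Nat.le_succ _).trans h.2.1,
      (mem_layer_of_cons g h.2.2).1⟩, a)

theorem parent_eq_some {z y : tail K V L g 0} {a : Arr V} (h : parent K V L g z = some (y, a)) :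
    z.1 = (a :: y.1.1, y.1.2) := by
  obtain ⟨⟨_ | ⟨a', w⟩, q⟩, hz⟩ := z
  · cases h
  · cases h
    rfl

variable (K V L) in
/-- The forest of the selected words. -/
def forest (g : ι → M) : Forest V L (tail K V L g 0) where
  vtx z := z.1.vtx
  depth z := z.1.1.length
  par := parent K V L g
  src {z y a} h := by
    have hz := z.2.2.2
    have he := parent_eq_some g h
    rw [he, List.length_cons] at hz
    exact (mem_layer_of_cons g hz).2
  tgt {z y a} h := by
    rw [parent_eq_some g h]
    rfl
  depth_succ {z y a} h := by
    rw [parent_eq_some g h]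
    rfl
  depth_root {z} h := by
    obtain ⟨⟨_ | ⟨a', w⟩, q⟩, hz⟩ := z
    · rfl
    · cases h
  inj {z z' q} h h' := by
    obtain ⟨y, a⟩ := q
    exact Subtype.ext ((parent_eq_some g h).trans (parent_eq_some g h').symm)
  depth_le z := z.2.2.1

end Word

variable (K V L M) in
/-- Every finite-dimensional module has a skeleton. -/
theorem exists_isForestBasis [FiniteDimensional K M] :
    ∃ (σ : Type) (_ : Fintype σ) (F : Forest V L σ) (b : Module.Basis σ K M),
      IsForestBasis F b := by
  classical
  let g := Module.finBasis K M
  have hg := g.span_eq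
  have h0 := Word.tail_spec (K := K) (V := V) (L := L) (g : _ → M) hg 0
  let b : Module.Basis (Word.tail K V L (g : _ → M) 0) K M := Module.Basis.mk h0.2 (by
    rw [← Set.image_eq_range, h0.1, rad_zero]
    exact fun _ _ => trivial)
  have hb : ∀ w, b w = Word.val K L (g : _ → M) w.1 := fun w => Module.Basis.mk_apply _ _ _
  have : Finite (Word.tail K V L (g : _ → M) 0) := Module.Finite.finite_basis b
  refine ⟨_, Fintype.ofFinite _, Word.forest K V L (g : _ → M), b, ⟨?_, ?_, ?_⟩⟩
  · intro y
    rw [hb]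
    exact Word.idem_smul_val _ _
  · intro z y a h
    rw [hb, hb, Word.parent_eq_some _ h]
    rfl
  · intro y a _ _
    -- The condition on missing children needs no choice: the product lies in J^(depth y + 1) M,
    -- which the selected words of at least that length span.
    have h1 : arrElt K L a • b y ∈ (rad K V L M (y.1.1.length + 1)).restrictScalars K := by
      rw [hb]
      exact arrElt_smul_mem_rad a (Word.val_mem_rad _ _)
    rw [← (Word.tail_spec (K := K) (V := V) (L := L) (g : _ → M) hg _).1] at h1
    refine Submodule.span_mono ?_ h1
    rintro _ ⟨w, hw, rfl⟩
    exact ⟨⟨w, Nat.zero_le _, hw.2⟩, hw.1, hb _⟩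

end Skeleton

/-! ## Free forests -/

section FreeForest

variable {V : Type} [Quiver.{0} V] {L : ℕ}

/-- The paths of length less than `n` starting in `e`. -/
abbrev ShortPath (e : V) (n : ℕ) : Type := {x : Σ j : V, Quiver.Path e j // x.2.length < n}

instance [Finite V] [∀ i j : V, Finite (i ⟶ j)] (e : V) (n : ℕ) : Finite (ShortPath e n) := by
  induction n with
  | zero => exact @Finite.of_subsingleton _ ⟨fun x => absurd x.2 (Nat.not_lt_zero _)⟩
  | succ n ih =>
    let f : Option (Σ x : ShortPath e n, Σ k : V, (x.1.1 ⟶ k)) → ShortPath e (n + 1) := fun o =>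
      match o with
      | none => ⟨⟨e, .nil⟩, Nat.succ_pos n⟩
      | some ⟨x, k, a⟩ => ⟨⟨k, x.1.2.cons a⟩, Nat.succ_lt_succ x.2⟩
    refine Finite.of_surjective f ?_
    rintro ⟨⟨j, p⟩, hp⟩
    cases p with
    | nil => exact ⟨none, rfl⟩
    | cons p a => exact ⟨some ⟨⟨⟨_, p⟩, Nat.lt_of_succ_lt_succ hp⟩, _, a⟩, rfl⟩

/-- Paths are built by appending at the end, so splitting off the first arrow uniquely takes an
induction. -/
theorem toPath_comp_injective {e k k' j : V} {a : e ⟶ k} {a' : e ⟶ k'} {p : Quiver.Path k j}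
    {p' : Quiver.Path k' j} (h : a.toPath.comp p = a'.toPath.comp p') :
    (⟨k, a, p⟩ : Σ k, (e ⟶ k) × Quiver.Path k j) = ⟨k', a', p'⟩ := by
  have hlen : p.length = p'.length := by
    have := congrArg Quiver.Path.length h
    simpa [Quiver.Path.length_comp] using this
  induction p with
  | nil =>
    cases p' with
    | nil =>
      rw [Quiver.Path.comp_nil, Quiver.Path.comp_nil] at h
      cases h
      rfl
    | cons p' b' => simp at hlen
  | cons p b ih =>
    cases p' with
    | nil => simp at hlen
    | cons p' b' =>
      rw [Quiver.Path.comp_cons, Quiver.Path.comp_cons] at h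
      have h1 := Quiver.Path.obj_eq_of_cons_eq_cons h
      subst h1
      have h2 := eq_of_heq (Quiver.Path.heq_of_cons_eq_cons h)
      have h3 := eq_of_heq (Quiver.Path.hom_heq_of_cons_eq_cons h)
      subst h3
      have := ih h2 (by simpa using hlen)
      cases this
      rfl

/-- The trivial path and the paths with a chosen first arrow are all distinct. This inequality
suffices for the dimension count of the syzygy. -/
theorem card_shortPath_succ_ge [Finite V] [∀ i j : V, Finite (i ⟶ j)] (e : V) (n : ℕ)
    [Fintype {a : Arr V // a.1 = e}] :
    1 + ∑ a : {a : Arr V // a.1 = e}, Nat.card (ShortPath a.1.2.1 n) ≤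
      Nat.card (ShortPath e (n + 1)) := by
  let f : Option (Σ a : {a : Arr V // a.1 = e}, ShortPath a.1.2.1 n) → ShortPath e (n + 1) :=
    fun o => match o with
      | none => ⟨⟨e, .nil⟩, Nat.succ_pos n⟩
      | some ⟨⟨⟨i, j, a⟩, (h : i = e)⟩, x⟩ =>
        ⟨⟨x.1.1, (((a.toPath).cast h rfl).comp x.1.2 : Quiver.Path e x.1.1)⟩, by
          subst h
          rw [Quiver.Path.length_comp]
          change 1 + _ < _
          have := x.2
          omega⟩
  have hf : Function.Injective f := by
    rintro (_ | ⟨⟨⟨i, j, a⟩, h⟩, ⟨⟨k, p⟩, hp⟩⟩) (_ | ⟨⟨⟨i', j', a'⟩, h'⟩, ⟨⟨k', p'⟩, hp'⟩⟩) he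
    · rfl
    · change i' = e at h'
      subst h'
      exfalso
      have : 0 = (a'.toPath.comp p').length :=
        congrArg (fun x : ShortPath i' (n + 1) => x.1.2.length) he
      rw [Quiver.Path.length_comp] at this
      change 0 = 1 + _ at this
      omega
    · change i = e at h
      subst h
      exfalso
      have : (a.toPath.comp p).length = 0 :=
        congrArg (fun x : ShortPath i (n + 1) => x.1.2.length) he
      rw [Quiver.Path.length_comp] at this
      change 1 + _ = 0 at this
      omega
    · change i = e at h
      subst h
      change i' = i at h'
      subst h'
      have he' : (⟨k, a.toPath.comp p⟩ : Σ k, Quiver.Path i' k) = ⟨k', a'.toPath.comp p'⟩ :=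
        congrArg Subtype.val he
      rw [Sigma.mk.injEq] at he'
      obtain ⟨rfl, he'⟩ := he'
      have := toPath_comp_injective (eq_of_heq he')
      cases this
      rfl
  have := Nat.card_le_card_of_injective f hf
  rwa [Finite.card_option, Nat.card_sigma, add_comm] at this

variable {R : Type} (v : R → V) (m : R → ℕ)

/-- The nodes of a free forest: a path for each index, of bounded length. -/
abbrev FreeNode : Type := Σ r : R, ShortPath (v r) (m r)

/-- The parent in a free forest: remove the last arrow. -/
def freePar : FreeNode v m → Option (FreeNode v m × Arr V)
  | ⟨_, ⟨⟨_, .nil⟩, _⟩⟩ => none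
  | ⟨r, ⟨⟨_, .cons p a⟩, h⟩⟩ => some (⟨r, ⟨⟨_, p⟩, (Nat.lt_succ_self _).trans h⟩⟩, ⟨_, _, a⟩)

/-- The disjoint union of the trees of all paths of length less than `m r` starting in `v r`. -/
def freeForest (hm : ∀ r, m r ≤ L + 1) : Forest V L (FreeNode v m) where
  vtx z := z.2.1.1
  depth z := z.2.1.2.length
  par := freePar v m
  src {z y a} h := by
    obtain ⟨r, ⟨⟨k, _ | ⟨p, b⟩⟩, hz⟩⟩ := z <;> cases h
    rfl
  tgt {z y a} h := by
    obtain ⟨r, ⟨⟨k, _ | ⟨p, b⟩⟩, hz⟩⟩ := z <;> cases h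
    rfl
  depth_succ {z y a} h := by
    obtain ⟨r, ⟨⟨k, _ | ⟨p, b⟩⟩, hz⟩⟩ := z <;> cases h
    rfl
  depth_root {z} h := by
    obtain ⟨r, ⟨⟨k, _ | ⟨p, b⟩⟩, hz⟩⟩ := z
    · rfl
    · cases h
  inj {z z' q} h h' := by
    obtain ⟨r, ⟨⟨k, _ | ⟨p, b⟩⟩, hz⟩⟩ := z <;> cases h
    obtain ⟨r', ⟨⟨k', _ | ⟨p', b'⟩⟩, hz'⟩⟩ := z' <;> cases h'
    rfl
  depth_le z := by
    have := z.2.2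
    have := hm z.1
    omega

variable {v m}

theorem freePar_cons {r : R} {j k : V} (p : Quiver.Path (v r) j) (a : j ⟶ k)
    (h : p.length + 1 < m r) :
    freePar v m ⟨r, ⟨⟨k, p.cons a⟩, h⟩⟩ = some (⟨r, ⟨⟨j, p⟩, (Nat.lt_succ_self _).trans h⟩⟩, ⟨j, k, a⟩) := rfl

theorem freePar_ne_some {r : R} {j : V} {p : Quiver.Path (v r) j} {hp : p.length < m r}
    (h : m r ≤ p.length + 1) (a : Arr V) (z : FreeNode v m) :
    freePar v m z ≠ some (⟨r, ⟨⟨j, p⟩, hp⟩⟩, a) := by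
  intro hz
  obtain ⟨r', ⟨⟨k', _ | ⟨p', b'⟩⟩, hz'⟩⟩ := z <;> cases hz
  simp only [Quiver.Path.length_cons] at hz'
  omega

end FreeForest

/-! ### Modules of free forests and their universal property -/

section Lift

variable {K : Type u} {V : Type} [Field K] [Fintype V] [Quiver.{0} V] [∀ i j : V, Finite (i ⟶ j)]
  {L : ℕ}
variable {M : Type*} [AddCommGroup M] [Module K M] [Module (TruncAlg K V L) M]
  [IsScalarTower K (TruncAlg K V L) M]
variable {R : Type} [Finite R] {v : R → V} {m : R → ℕ}

instance : Finite (FreeNode v m) := inferInstanceAs (Finite (Σ r : R, ShortPath (v r) (m r)))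

variable (K v m) in
/-- The module of a free forest. -/
abbrev FreeMod (hm : ∀ r, m r ≤ L + 1) : Type u := ForestMod K (freeForest v m hm)

variable (hm : ∀ r, m r ≤ L + 1)

/-- The linear map from a free forest determined by the images of the roots. -/
def freeLiftK (x : R → M) : FreeMod K v m hm →ₗ[K] M :=
  (ForestMod.basis K (freeForest v m hm)).constr K fun z => pathCls K L z.2.1.2 • x z.1

theorem freeLiftK_basis (x : R → M) (z : FreeNode v m) :
    freeLiftK hm x (ForestMod.basis K _ z) = pathCls K L z.2.1.2 • x z.1 :=
  (ForestMod.basis K (freeForest v m hm)).constr_basis K _ z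

/-- The universal property of a free forest. -/
def freeLift (x : R → M) (hx : ∀ r (j : V) (p : Quiver.Path (v r) j), m r ≤ p.length →
    pathCls K L p • x r = 0) : FreeMod K v m hm →ₗ[TruncAlg K V L] M :=
  linOfGen (freeLiftK hm x)
    (fun i f => by
      have hF := ForestMod.isForestBasis K (freeForest v m hm)
      have : freeLiftK hm x ∘ₗ lsmulK (FreeMod K v m hm) (idem K L i) =
          lsmulK M (idem K L i) ∘ₗ freeLiftK hm x := by
        refine (ForestMod.basis K (freeForest v m hm)).ext fun z => ?_
        simp only [LinearMap.comp_apply, lsmulK_apply, freeLiftK_basis]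
        by_cases h : i = (freeForest v m hm).vtx z
        · subst h
          rw [hF.idem_smul, freeLiftK_basis, ← mul_smul]
          congr 1
          exact (idem_mul_pathCls K L z.2.1.2).symm
        · rw [hF.idem_smul_ne h, map_zero, ← mul_smul, idem_eq_pathCls,
            pathCls_mul_ne K L z.2.1.2 _ (Ne.symm h), zero_smul]
      exact LinearMap.congr_fun this f)
    (fun a f => by
      have hF := ForestMod.isForestBasis K (freeForest v m hm)
      have : freeLiftK hm x ∘ₗ lsmulK (FreeMod K v m hm) (arrElt K L a) =
          lsmulK M (arrElt K L a) ∘ₗ freeLiftK hm x := by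
        refine (ForestMod.basis K (freeForest v m hm)).ext fun z => ?_
        simp only [LinearMap.comp_apply, lsmulK_apply, freeLiftK_basis]
        by_cases h : a.1 = (freeForest v m hm).vtx z
        · obtain ⟨i, k, a⟩ := a
          obtain ⟨r, ⟨⟨j, p⟩, hp⟩⟩ := z
          change i = j at h
          subst h
          by_cases hp' : p.length + 1 < m r
          · have hc : (freeForest v m hm).par (⟨r, ⟨⟨k, p.cons a⟩, hp'⟩⟩ : FreeNode v m) =
                some (⟨r, ⟨⟨i, p⟩, hp⟩⟩, ⟨i, k, a⟩) := freePar_cons p a hp'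
            rw [hF.arr_smul hc, freeLiftK_basis, pathCls_cons, mul_smul]
          · rw [ForestMod.arr_smul_of_childless K _ (freePar_ne_some (by omega) _), map_zero,
              ← mul_smul, ← pathCls_cons]
            refine (hx r k (p.cons a) ?_).symm
            rw [Quiver.Path.length_cons]
            omega
        · rw [hF.arr_smul_ne h, map_zero, ← mul_smul, arrElt_eq_pathCls,
            pathCls_mul_ne K L z.2.1.2 _ (Ne.symm h), zero_smul]
      exact LinearMap.congr_fun this f)

theorem freeLift_basis (x : R → M) (hx : ∀ r (j : V) (p : Quiver.Path (v r) j), m r ≤ p.length →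
    pathCls K L p • x r = 0) (z : FreeNode v m) :
    freeLift hm x hx (ForestMod.basis K _ z) = pathCls K L z.2.1.2 • x z.1 :=
  freeLiftK_basis hm x z

variable (K) in
/-- The root of a free forest with a given index. -/
def freeGen (r : R) (h : 0 < m r) : FreeMod K v m hm :=
  ForestMod.basis K (freeForest v m hm) ⟨r, ⟨⟨_, .nil⟩, h⟩⟩

theorem pathCls_smul_freeGen {r : R} {j : V} (p : Quiver.Path (v r) j) (hp : p.length < m r) :
    pathCls K L p • freeGen K hm r (by omega) =
      ForestMod.basis K (freeForest v m hm) ⟨r, ⟨⟨j, p⟩, hp⟩⟩ := by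
  have hF := ForestMod.isForestBasis K (freeForest v m hm)
  induction p with
  | nil => exact hF.idem_smul (⟨r, ⟨⟨v r, .nil⟩, hp⟩⟩ : FreeNode v m)
  | cons p a ih =>
    rw [pathCls_cons, mul_smul, ih (by rw [Quiver.Path.length_cons] at hp; omega)]
    exact hF.arr_smul (freePar_cons p a hp)

/-- With truncation length L+1 the condition for mapping out of the roots is void, since such paths
are zero in Λ; so arbitrary preimages of the roots define a lift. -/
theorem freeMod_projective {v : R → V} :
    Module.Projective (TruncAlg K V L) (FreeMod K v (fun _ => L + 1) fun _ => le_rfl) := by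
  refine Module.Projective.of_lifting_property fun {M N} _ _ _ _ f g hf => ?_
  let _ : Module K M := Module.compHom M (algebraMap K (TruncAlg K V L))
  let _ : Module K N := Module.compHom N (algebraMap K (TruncAlg K V L))
  have : IsScalarTower K (TruncAlg K V L) M := IsScalarTower.of_algebraMap_smul fun _ _ => rfl
  have : IsScalarTower K (TruncAlg K V L) N := IsScalarTower.of_algebraMap_smul fun _ _ => rfl
  choose x hx using fun r : R => hf (g (freeGen K _ r (Nat.succ_pos L)))
  have hx' : ∀ r (j : V) (p : Quiver.Path (v r) j), L + 1 ≤ p.length → pathCls K L p • x r = 0 := by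
    intro r j p hp
    rw [pathCls_eq_zero K L p hp, zero_smul]
  refine ⟨freeLift _ x hx', ?_⟩
  have : (f ∘ₗ freeLift (fun _ => le_rfl) x hx').restrictScalars K = g.restrictScalars K := by
    refine (ForestMod.basis K (freeForest v (fun _ => L + 1) fun _ => le_rfl)).ext fun z => ?_
    change f (freeLift _ x hx' _) = g _
    rw [freeLift_basis, map_smul, hx, ← map_smul]
    exact congrArg g (pathCls_smul_freeGen _ z.2.1.2 z.2.2)
  exact LinearMap.ext fun y => LinearMap.congr_fun this y

theorem finrank_forestMod {σ : Type} [Finite σ] (F : Forest V L σ) :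
    Module.finrank K (ForestMod K F) = Nat.card σ :=
  Module.finrank_eq_nat_card_basis (ForestMod.basis K F)

end Lift

/-! ### Counting -/

section Count

variable {V : Type} [Quiver.{0} V] [Finite V] [∀ i j : V, Finite (i ⟶ j)] {L : ℕ} {σ : Type}
  [Finite σ]

/-- The pairs of a node and an arrow starting there without corresponding child. -/
abbrev Forest.Critical (F : Forest V L σ) : Type :=
  {q : σ × Arr V // q.2.1 = F.vtx q.1 ∧ ∀ z, F.par z ≠ some q}

/-- The roots of a forest. -/
abbrev Forest.Root (F : Forest V L σ) : Type := {z : σ // F.par z = none}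

/-- In dimensions: module plus prospective syzygy fit into the projective cover. A short path from a
node is trivial or has a first arrow, which leads to a child or is critical; summing over all nodes,
the contributions of the children cancel and only the roots remain. -/
theorem Forest.card_add_card_le (F : Forest V L σ) :
    Nat.card σ + Nat.card (FreeNode (fun q : F.Critical => q.1.2.2.1)
      fun q => L - F.depth q.1.1) ≤
    Nat.card (FreeNode (fun r : F.Root => F.vtx r.1) fun _ => L + 1) := by
  classical
  have := Fintype.ofFinite σ
  have : Fintype (Arr V) := Fintype.ofFinite _
  rw [Nat.card_sigma, Nat.card_sigma]
  -- `g z` counts the paths of length at most `L - depth z` from `z`, and `G q` counts those of them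
  -- that begin with a given arrow.
  let g : σ → ℕ := fun z => Nat.card (ShortPath (F.vtx z) (L + 1 - F.depth z))
  let G : σ × Arr V → ℕ := fun q => Nat.card (ShortPath q.2.2.1 (L - F.depth q.1))
  have h1 : ∑ r : F.Root, Nat.card (ShortPath (F.vtx r.1) (L + 1)) =
      ∑ z with F.par z = none, g z := by
    rw [Finset.sum_subtype (p := fun z => F.par z = none) _ (by simp)]
    refine Finset.sum_congr rfl fun r _ => ?_
    simp only [g]
    rw [F.depth_root r.2, Nat.sub_zero]
  have h2 : ∑ q : F.Critical, Nat.card (ShortPath q.1.2.2.1 (L - F.depth q.1.1)) =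
      ∑ q with q.2.1 = F.vtx q.1 ∧ ∀ z, F.par z ≠ some q, G q := by
    rw [Finset.sum_subtype (p := fun q : σ × Arr V =>
      q.2.1 = F.vtx q.1 ∧ ∀ z, F.par z ≠ some q) _ (by simp)]
  have h3 : ∑ q : σ × Arr V with q.2.1 = F.vtx q.1 ∧ ¬ ∀ z, F.par z ≠ some q, G q =
      ∑ z with ¬ F.par z = none, g z := by
    symm
    refine Finset.sum_bij (fun z hz => (F.par z).get (Option.isSome_iff_ne_none.2
      (Finset.mem_filter.1 hz).2)) ?_ ?_ ?_ ?_
    · intro z hz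
      rw [Finset.mem_filter]
      refine ⟨Finset.mem_univ _, ?_, ?_⟩
      · exact F.src (z := z) (by simp)
      · push Not
        exact ⟨z, by simp⟩
    · intro z hz z' hz' he
      refine F.inj (z := z) (z' := z') (q := (F.par z).get (Option.isSome_iff_ne_none.2
        (Finset.mem_filter.1 hz).2)) (by simp) ?_
      rw [he]
      simp
    · intro q hq
      have := (Finset.mem_filter.1 hq).2.2
      push Not at this
      obtain ⟨z, hz⟩ := this
      exact ⟨z, by simp [hz], by simp [hz]⟩
    · intro z hz
      obtain ⟨⟨y, a⟩, hq⟩ := Option.ne_none_iff_exists'.1 (Finset.mem_filter.1 hz).2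
      simp only [hq, Option.get_some, g, G]
      rw [F.tgt hq, F.depth_succ hq, Nat.add_sub_add_right]
  have h4 : ∀ z : σ, 1 + ∑ a with a.1 = F.vtx z, G (z, a) ≤ g z := by
    intro z
    have hd := F.depth_le z
    have := card_shortPath_succ_ge (F.vtx z) (L - F.depth z)
    rw [← Nat.sub_add_comm hd] at this
    refine le_trans (le_of_eq ?_) this
    rw [Finset.sum_subtype (p := fun a : Arr V => a.1 = F.vtx z) _ (by simp)]
  have h5 : ∑ z : σ, ∑ a with a.1 = F.vtx z, G (z, a) =
      ∑ q : σ × Arr V with q.2.1 = F.vtx q.1, G q := by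
    rw [Finset.sum_filter, Fintype.sum_prod_type]
    simp only [Finset.sum_filter]
  have h6 := Finset.sum_le_sum fun z (_ : z ∈ (Finset.univ : Finset σ)) => h4 z
  rw [Finset.sum_add_distrib, Finset.sum_const, smul_eq_mul, mul_one, Finset.card_univ, h5,
    ← Finset.sum_filter_add_sum_filter_not _ (fun q : σ × Arr V => ∀ z, F.par z ≠ some q),
    Finset.filter_filter, Finset.filter_filter, h3, ← h2,
    ← Finset.sum_filter_add_sum_filter_not Finset.univ (fun z => F.par z = none) g, ← h1] at h6
  rw [Nat.card_eq_fintype_card]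
  exact Nat.le_of_add_le_add_right (by rwa [← add_assoc] at h6)

end Count

/-! ## Syzygies -/

section Extend

variable {K : Type u} {V : Type} [Field K] [Fintype V] [Quiver.{0} V] {L : ℕ} {σ : Type}
variable {P : Type*} [AddCommGroup P] [Module K P] [Module (TruncAlg K V L) P]
  [IsScalarTower K (TruncAlg K V L) P]

/-- One step in the extension of a function on the roots of a forest. -/
def Forest.extendStep (F : Forest V L σ) (g f : σ → P) (z : σ) : P :=
  (F.par z).elim (g z) fun q => arrElt K L q.2 • f q.1

variable (K) in
/-- The extension of a function on the roots of a forest, using the action of the arrows. -/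
def Forest.extend (F : Forest V L σ) (g : σ → P) (z : σ) : P :=
  ((F.extendStep (K := K) g)^[F.depth z + 1] 0) z

theorem Forest.extend_root (F : Forest V L σ) (g : σ → P) {z : σ} (h : F.par z = none) :
    F.extend K g z = g z := by
  rw [extend, Function.iterate_succ_apply', extendStep, h]
  rfl

/-- One iteration is spent on the last edge, and the remaining ones are just those used for the
parent. -/
theorem Forest.extend_child (F : Forest V L σ) (g : σ → P) {z y : σ} {a : Arr V}
    (h : F.par z = some (y, a)) : F.extend K g z = arrElt K L a • F.extend K g y := by
  rw [extend, Function.iterate_succ_apply', extendStep, h, F.depth_succ h]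
  rfl

theorem Forest.extend_mem_rad (F : Forest V L σ) (g : σ → P) (z : σ) :
    F.extend K g z ∈ rad K V L P (F.depth z) := by
  generalize hn : F.depth z = n
  induction n generalizing z with
  | zero => rw [rad_zero]; trivial
  | succ n ih =>
    rcases hp : F.par z with _ | ⟨y, a⟩
    · rw [F.depth_root hp] at hn
      omega
    · have hd := F.depth_succ hp
      rw [F.extend_child g hp]
      exact arrElt_smul_mem_rad a (ih y (by omega))

end Extend

/-! ### The first syzygy of a module with a skeleton -/

section Syzygy

variable {K : Type u} {V : Type} [Field K] [Fintype V] [Quiver.{0} V] [∀ i j : V, Finite (i ⟶ j)]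
  {L : ℕ} {σ : Type} [Finite σ]
variable {M : Type*} [AddCommGroup M] [Module K M] [Module (TruncAlg K V L) M]
  [IsScalarTower K (TruncAlg K V L) M]

variable (K) in
/-- The projective module on the roots of a forest. -/
abbrev Forest.Cover (F : Forest V L σ) : Type u :=
  FreeMod K (fun r : F.Root => F.vtx r.1) (fun _ => L + 1) fun _ => le_rfl

theorem Forest.sub_depth_le (F : Forest V L σ) (q : F.Critical) :
    L - F.depth q.1.1 ≤ L + 1 := (Nat.sub_le _ _).trans (Nat.le_succ L)

variable (K) in
/-- The first syzygy of a module with a given skeleton. -/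
abbrev Forest.Syz (F : Forest V L σ) : Type u :=
  FreeMod K (fun q : F.Critical => q.1.2.2.1) (fun q => L - F.depth q.1.1) F.sub_depth_le

open Classical in
variable (K) in
/-- The generators of the projective module on the roots. -/
def Forest.coverGen (F : Forest V L σ) (z : σ) : F.Cover K :=
  if h : F.par z = none then freeGen K (v := fun r : F.Root => F.vtx r.1) (m := fun _ => L + 1)
    (fun _ => le_rfl) ⟨z, h⟩ (Nat.succ_pos L) else 0

variable (K) in
/-- The lifts of the skeleton elements to the projective module on the roots. -/
def Forest.coverElt (F : Forest V L σ) : σ → F.Cover K := F.extend K (F.coverGen K)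

theorem Forest.idem_smul_coverElt (F : Forest V L σ) (z : σ) :
    idem K L (F.vtx z) • F.coverElt K z = F.coverElt K z := by
  rcases hp : F.par z with _ | ⟨y, a⟩
  · rw [coverElt, F.extend_root _ hp, coverGen, dif_pos hp]
    exact (ForestMod.isForestBasis K (freeForest (fun r : F.Root => F.vtx r.1) (fun _ => L + 1)
      fun _ => le_rfl)).idem_smul ⟨⟨z, hp⟩, ⟨⟨_, .nil⟩, Nat.succ_pos L⟩⟩
  · rw [coverElt, F.extend_child _ hp, ← F.tgt hp, ← mul_smul, idem_mul_arrElt]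

namespace IsForestBasis

variable {F : Forest V L σ} {b : Module.Basis σ K M}

theorem pathCls_smul_root_eq_zero (b : Module.Basis σ K M) (r : F.Root) (j : V)
    (p : Quiver.Path (F.vtx r.1) j) (hp : L + 1 ≤ p.length) : pathCls K L p • b r.1 = 0 := by
  rw [pathCls_eq_zero K L p hp, zero_smul]

variable (F b) in
/-- The map from the projective module on the roots to the module. -/
def coverMap : F.Cover K →ₗ[TruncAlg K V L] M :=
  freeLift _ (fun r : F.Root => b r.1) (pathCls_smul_root_eq_zero b)

theorem coverMap_coverElt (h : IsForestBasis F b) (z : σ) :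
    coverMap F b (F.coverElt K z) = b z := by
  generalize hn : F.depth z = n
  induction n generalizing z with
  | zero =>
    rcases hp : F.par z with _ | ⟨y, a⟩
    · rw [Forest.coverElt, F.extend_root _ hp, Forest.coverGen, dif_pos hp, coverMap]
      refine (freeLift_basis _ _ _ _).trans ?_
      exact h.idem_smul z
    · have := F.depth_succ hp
      omega
  | succ n ih =>
    rcases hp : F.par z with _ | ⟨y, a⟩
    · rw [F.depth_root hp] at hn
      omega
    · have hd := F.depth_succ hp
      rw [Forest.coverElt, F.extend_child _ hp, map_smul]
      exact (congrArg _ (ih y (by omega))).trans (h.arr_smul hp)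

theorem coverMap_surjective (h : IsForestBasis F b) : Function.Surjective (coverMap F b) := by
  have : (⊤ : Submodule K M) ≤ (LinearMap.range (coverMap F b)).restrictScalars K := by
    rw [← b.span_eq, Submodule.span_le]
    rintro _ ⟨z, rfl⟩
    exact ⟨_, h.coverMap_coverElt z⟩
  exact fun x => this Submodule.mem_top

variable (F b) in
/-- The expansion of a product of an arrow with a skeleton element, lifted to the projective module
on the roots. -/
def expand (q : σ × Arr V) : F.Cover K :=
  (b.repr (arrElt K L q.2 • b q.1)).sum fun z c => c • F.coverElt K z

variable (F b) in
/-- The relation of a critical pair. -/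
def relElt (q : F.Critical) : F.Cover K :=
  -- The idempotent places the relation in the component at the end of the arrow, so that a free
  -- generator at that vertex maps exactly to it.
  idem K L q.1.2.2.1 • (arrElt K L q.1.2 • F.coverElt K q.1.1 - expand F b q.1)

theorem coverMap_expand (h : IsForestBasis F b) (q : σ × Arr V) :
    coverMap F b (expand F b q) = arrElt K L q.2 • b q.1 := by
  have : coverMap F b (expand F b q) =
      (b.repr (arrElt K L q.2 • b q.1)).sum fun z c => c • b z := by
    rw [expand, Finsupp.sum, map_sum]
    refine Finset.sum_congr rfl fun z _ => ?_
    refine ((coverMap F b).restrictScalars K).map_smul _ _ |>.trans ?_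
    exact congrArg _ (h.coverMap_coverElt z)
  rw [this]
  exact b.linearCombination_repr _

theorem coverMap_relElt (h : IsForestBasis F b) (q : F.Critical) :
    coverMap F b (relElt F b q) = 0 := by
  rw [relElt, map_smul, map_sub, h.coverMap_expand, map_smul, h.coverMap_coverElt, sub_self,
    smul_zero]

/-- Along a missing edge the skeleton condition only allows nodes of greater depth, and lifting
preserves depth. -/
theorem expand_mem_rad (h : IsForestBasis F b) (q : F.Critical) :
    expand F b q.1 ∈ rad K V L (F.Cover K) (F.depth q.1.1 + 1) := by
  refine Submodule.sum_mem _ fun z hz => ?_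
  have := (b.mem_span_image.1 (h.childless q.2.1 q.2.2)) hz
  refine ((rad K V L (F.Cover K) (F.depth q.1.1 + 1)).restrictScalars K).smul_mem _ ?_
  exact rad_antitone this (F.extend_mem_rad _ z)

theorem relElt_mem_rad (h : IsForestBasis F b) (q : F.Critical) :
    relElt F b q ∈ rad K V L (F.Cover K) (F.depth q.1.1 + 1) :=
  Submodule.smul_mem _ _ (sub_mem (arrElt_smul_mem_rad _ (F.extend_mem_rad _ _))
    (h.expand_mem_rad q))

/-- The relation lies in J^(depth+1) P, so `L - depth` further arrows reach J^(L+1) P = 0. This is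
where the truncation lengths of `Forest.Syz` come from. -/
theorem pathCls_smul_relElt (h : IsForestBasis F b) (q : F.Critical) (j : V)
    (p : Quiver.Path q.1.2.2.1 j) (hp : L - F.depth q.1.1 ≤ p.length) :
    pathCls K L p • relElt F b q = 0 := by
  have h1 := pathCls_smul_mem_rad p (h.relElt_mem_rad q)
  rw [rad_eq_bot_of_le (by omega)] at h1
  exact (Submodule.mem_bot _).1 h1

/-- The map from the syzygy to the projective module on the roots. -/
def syzMap (h : IsForestBasis F b) : F.Syz K →ₗ[TruncAlg K V L] F.Cover K :=
  freeLift _ (relElt F b) h.pathCls_smul_relElt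

theorem range_syzMap_le (h : IsForestBasis F b) (N : Submodule (TruncAlg K V L) (F.Cover K))
    (hN : ∀ q, relElt F b q ∈ N) : LinearMap.range h.syzMap ≤ N := by
  rintro _ ⟨x, rfl⟩
  let B := ForestMod.basis K (freeForest (fun q : F.Critical => q.1.2.2.1)
    (fun q => L - F.depth q.1.1) F.sub_depth_le)
  have hx : x ∈ Submodule.span K (Set.range B) := B.mem_span x
  induction hx using Submodule.span_induction with
  | zero => rw [map_zero]; exact zero_mem _
  | add x y _ _ hx hy => rw [map_add]; exact add_mem hx hy
  | smul c x _ hx =>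
    have : h.syzMap (c • x) = c • h.syzMap x := (h.syzMap.restrictScalars K).map_smul c x
    rw [this]
    exact (N.restrictScalars K).smul_mem _ hx
  | mem x hx =>
    obtain ⟨z, rfl⟩ := hx
    have : h.syzMap (B z) = pathCls K L z.2.1.2 • relElt F b z.1 := freeLift_basis _ _ _ _
    rw [this]
    exact N.smul_mem _ (hN _)

theorem relElt_mem_range (h : IsForestBasis F b) (q : F.Critical) :
    relElt F b q ∈ LinearMap.range h.syzMap := by
  by_cases hq : 0 < L - F.depth q.1.1
  · refine ⟨freeGen K (v := fun q : F.Critical => q.1.2.2.1)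
      (m := fun q => L - F.depth q.1.1) F.sub_depth_le q hq, ?_⟩
    refine (freeLift_basis _ _ _ _).trans ?_
    change idem K L _ • relElt F b q = _
    exact idem_smul_idem_smul (K := K) _ _
  -- At depth L the free summand is zero, and so is the relation, as it lies in J^(L+1) P.
  · have h1 := h.relElt_mem_rad q
    rw [rad_eq_bot_of_le (by omega)] at h1
    rw [(Submodule.mem_bot _).1 h1]
    exact zero_mem _

/-- The sum is closed under vertices and arrows and contains the generators at the roots: an arrow
leads a lifted node to a lifted child, or its relation rewrites the result in terms of lifted nodes.
-/
theorem span_coverElt_sup_range (h : IsForestBasis F b) :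
    Submodule.span K (Set.range (F.coverElt K)) ⊔ (LinearMap.range h.syzMap).restrictScalars K =
      ⊤ := by
  set U := Submodule.span K (Set.range (F.coverElt K)) ⊔
    (LinearMap.range h.syzMap).restrictScalars K with hU
  have hcov : ∀ z, F.coverElt K z ∈ U := fun z =>
    Submodule.mem_sup_left (Submodule.subset_span ⟨z, rfl⟩)
  have hidem : ∀ (i : V), ∀ m ∈ Submodule.span K (Set.range (F.coverElt K)),
      idem K L i • m ∈ Submodule.span K (Set.range (F.coverElt K)) := by
    intro i m hm
    induction hm using Submodule.span_induction with
    | zero => rw [smul_zero]; exact zero_mem _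
    | add x y _ _ hx hy => rw [smul_add]; exact add_mem hx hy
    | smul c x _ hx => rw [smul_comm_scalar]; exact Submodule.smul_mem _ _ hx
    | mem x hx =>
      obtain ⟨z, rfl⟩ := hx
      by_cases hi : i = F.vtx z
      · rw [hi, F.idem_smul_coverElt]
        exact Submodule.subset_span ⟨z, rfl⟩
      · rw [← F.idem_smul_coverElt, idem_smul_idem_smul_ne hi]
        exact zero_mem _
  have hi : ∀ i : V, ∀ m ∈ U, idem K L i • m ∈ U := by
    intro i m hm
    obtain ⟨x, hx, y, hy, rfl⟩ := Submodule.mem_sup.1 hm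
    rw [smul_add]
    exact add_mem (Submodule.mem_sup_left (hidem i x hx))
      (Submodule.mem_sup_right (Submodule.smul_mem (LinearMap.range h.syzMap) _ hy))
  have ha : ∀ a : Arr V, ∀ m ∈ U, arrElt K L a • m ∈ U := by
    intro a m hm
    obtain ⟨x, hx, y, hy, rfl⟩ := Submodule.mem_sup.1 hm
    rw [smul_add]
    refine add_mem ?_
      (Submodule.mem_sup_right (Submodule.smul_mem (LinearMap.range h.syzMap) _ hy))
    clear hm
    induction hx using Submodule.span_induction with
    | zero => rw [smul_zero]; exact zero_mem _
    | add x y _ _ hx hy => rw [smul_add]; exact add_mem hx hy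
    | smul c x _ hx => rw [smul_comm_scalar]; exact Submodule.smul_mem _ _ hx
    | mem x hx =>
      obtain ⟨z, rfl⟩ := hx
      by_cases hs : a.1 = F.vtx z
      · by_cases hc : ∃ z', F.par z' = some (z, a)
        · obtain ⟨z', hz'⟩ := hc
          have : arrElt K L a • F.coverElt K z = F.coverElt K z' := (F.extend_child _ hz').symm
          rw [this]
          exact hcov _
        · push Not at hc
          have hrel := h.relElt_mem_range ⟨(z, a), hs, hc⟩
          have : arrElt K L a • F.coverElt K z = relElt F b ⟨(z, a), hs, hc⟩ +
              idem K L a.2.1 • expand F b (z, a) := by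
            rw [relElt, smul_sub, sub_add_cancel, ← mul_smul, idem_mul_arrElt]
          rw [this]
          refine add_mem (Submodule.mem_sup_right hrel) (hi _ _ ?_)
          exact Submodule.sum_mem _ fun z _ => U.smul_mem _ (hcov z)
      · rw [← F.idem_smul_coverElt, ← mul_smul, arrElt_mul_idem_ne K L (Ne.symm hs), zero_smul]
        exact zero_mem _
  rw [eq_top_iff, ← (ForestMod.basis K (freeForest (fun r : F.Root => F.vtx r.1)
    (fun _ => L + 1) fun _ => le_rfl)).span_eq, Submodule.span_le]
  rintro _ ⟨⟨r, ⟨⟨j, p⟩, hp⟩⟩, rfl⟩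
  have h1 := pathCls_smul_freeGen (K := K) (v := fun r : F.Root => F.vtx r.1)
    (m := fun _ => L + 1) (fun _ => le_rfl) p hp
  rw [SetLike.mem_coe, ← h1]
  refine smul_mem_of_gen hi ha _ ?_
  have h2 := hcov r.1
  rwa [Forest.coverElt, F.extend_root _ r.2, Forest.coverGen, dif_pos r.2] at h2

/-- Write a kernel element as a combination of lifted nodes plus relations. The lifted nodes map to
a basis of `M`, so the combination is zero. -/
theorem range_syzMap (h : IsForestBasis F b) :
    LinearMap.range h.syzMap = LinearMap.ker (coverMap F b) := by
  have := Fintype.ofFinite σ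
  have hle : LinearMap.range h.syzMap ≤ LinearMap.ker (coverMap F b) :=
    h.range_syzMap_le _ fun q => h.coverMap_relElt q
  refine le_antisymm hle fun x hx => ?_
  obtain ⟨s, hs, r, hr, rfl⟩ := Submodule.mem_sup.1
    (h.span_coverElt_sup_range.symm ▸ Submodule.mem_top : x ∈ _)
  have hr0 : coverMap F b r = 0 := hle hr
  have hs0 : coverMap F b s = 0 := by
    have : coverMap F b (s + r) = 0 := hx
    rwa [map_add, hr0, add_zero] at this
  obtain ⟨c, rfl⟩ := (Submodule.mem_span_range_iff_exists_fun K).1 hs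
  have hc : ∑ z, c z • b z = 0 := by
    rw [← hs0, map_sum]
    refine Finset.sum_congr rfl fun z _ => ?_
    refine Eq.trans ?_ (((coverMap F b).restrictScalars K).map_smul _ _).symm
    exact congrArg _ (h.coverMap_coverElt z).symm
  have hc0 := Fintype.linearIndependent_iff.1 b.linearIndependent c hc
  have : ∑ z, c z • F.coverElt K z = 0 := Finset.sum_eq_zero fun z _ => by rw [hc0, zero_smul]
  rw [this, zero_add]
  exact hr

/-- The map is onto the kernel of the cover, whose dimension is dim P - dim M. By the counting
inequality this is at least the dimension of the source, so nothing is killed. -/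
theorem syzMap_injective (h : IsForestBasis F b) : Function.Injective h.syzMap := by
  have hfin1 : FiniteDimensional K (F.Cover K) :=
    (ForestMod.basis K (freeForest (fun r : F.Root => F.vtx r.1) (fun _ => L + 1)
      fun _ => le_rfl)).finiteDimensional_of_finite
  have hfin2 : FiniteDimensional K (F.Syz K) :=
    (ForestMod.basis K (freeForest (fun q : F.Critical => q.1.2.2.1)
    (fun q => L - F.depth q.1.1) F.sub_depth_le)).finiteDimensional_of_finite
  have h1 := LinearMap.finrank_range_add_finrank_ker ((coverMap F b).restrictScalars K)
  have h2 := LinearMap.finrank_range_add_finrank_ker (h.syzMap.restrictScalars K)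
  have h3 : LinearMap.range ((coverMap F b).restrictScalars K) = ⊤ :=
    LinearMap.range_eq_top.2 h.coverMap_surjective
  have h4 : LinearMap.range (h.syzMap.restrictScalars K) =
      LinearMap.ker ((coverMap F b).restrictScalars K) := by
    ext x
    exact SetLike.ext_iff.1 h.range_syzMap x
  rw [h3, finrank_top, Module.finrank_eq_nat_card_basis b, finrank_forestMod] at h1
  rw [h4, finrank_forestMod] at h2
  have h5 := F.card_add_card_le
  have h6 : Module.finrank K (LinearMap.ker (h.syzMap.restrictScalars K)) = 0 := by omega
  rw [Submodule.finrank_eq_zero] at h6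
  exact fun x y hxy => (LinearMap.ker_eq_bot.1 h6 : Function.Injective _) hxy

end IsForestBasis

end Syzygy

/-! ### Projective dimension and syzygies -/

section ProjDim

variable {K : Type u} {V : Type} [Field K] [Fintype V] [Quiver.{0} V] [∀ i j : V, Finite (i ⟶ j)]
  {L : ℕ} {σ : Type} [Finite σ]
variable {M : Type u} [AddCommGroup M] [Module K M] [Module (TruncAlg K V L) M]
  [IsScalarTower K (TruncAlg K V L) M]

variable (K V L) in
/-- The projective dimension of the module is less than `n`. -/
abbrev PdLT (M : Type u) [AddCommGroup M] [Module (TruncAlg K V L) M] (n : ℕ) : Prop :=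
  HasProjectiveDimensionLT (ModuleCat.of (TruncAlg K V L) M) n

theorem pdLT_zero_iff (M : Type u) [AddCommGroup M] [Module (TruncAlg K V L) M] :
    PdLT K V L M 0 ↔ Subsingleton M := by
  rw [PdLT, hasProjectiveDimensionLT_zero_iff_isZero, ModuleCat.isZero_iff_subsingleton]

/-- Nakayama's lemma, from the nilpotence of J and without any finiteness of the module. -/
theorem eq_top_of_sup_rad_one_eq_top (N : Submodule (TruncAlg K V L) M)
    (h : N ⊔ rad K V L M 1 = ⊤) : N = ⊤ := by
  have : ∀ l, N ⊔ rad K V L M l = ⊤ := by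
    intro l
    induction l with
    | zero => rw [rad_zero, sup_top_eq]
    | succ l ih =>
      rw [eq_top_iff, ← h]
      refine sup_le le_sup_left ?_
      rw [rad_succ, rad_zero, ← ih, Submodule.smul_sup, ← rad_succ]
      exact sup_le (Submodule.smul_le_right.trans le_sup_left) le_sup_right
  have h1 := this (L + 1)
  rwa [rad_eq_bot, sup_bot_eq] at h1

/-- For positive `n` this is dimension shifting. For `n = 0`, a section of the cover is onto by
Nakayama, because the relations lie in J P; so projectivity of `M` makes the cover injective and the
syzygy zero. -/
theorem IsForestBasis.pdLT_succ_iff {F : Forest V L σ} {b : Module.Basis σ K M}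
    (h : IsForestBasis F b) (n : ℕ) : PdLT K V L M (n + 1) ↔ PdLT K V L (F.Syz K) n := by
  have hproj : Projective (ModuleCat.of (TruncAlg K V L) (F.Cover K)) :=
    (IsProjective.iff_projective _).1 freeMod_projective
  cases n with
  | zero =>
    rw [zero_add, PdLT, ← projective_iff_hasProjectiveDimensionLT_one,
      ← IsProjective.iff_projective, pdLT_zero_iff]
    constructor
    · intro hM
      obtain ⟨s, hs⟩ := Module.projective_lifting_property (coverMap F b) LinearMap.id
        h.coverMap_surjective
      have htop : LinearMap.range s = ⊤ := by
        refine eq_top_of_sup_rad_one_eq_top _ (eq_top_iff.2 fun x _ => ?_)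
        rw [← add_sub_cancel (s (coverMap F b x)) x]
        refine Submodule.add_mem_sup ⟨_, rfl⟩ ?_
        have hx : x - s (coverMap F b x) ∈ LinearMap.ker (coverMap F b) := by
          rw [LinearMap.mem_ker, map_sub, sub_eq_zero]
          exact (LinearMap.congr_fun hs _).symm
        rw [← h.range_syzMap] at hx
        exact h.range_syzMap_le _ (fun q => rad_antitone (Nat.le_add_left 1 _)
          (h.relElt_mem_rad q)) hx
      have hinj : Function.Injective (coverMap F b) := by
        intro x y hxy
        obtain ⟨x', rfl⟩ := LinearMap.range_eq_top.1 htop x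
        obtain ⟨y', rfl⟩ := LinearMap.range_eq_top.1 htop y
        have hx' : coverMap F b (s x') = x' := LinearMap.congr_fun hs x'
        have hy' : coverMap F b (s y') = y' := LinearMap.congr_fun hs y'
        rw [hx', hy'] at hxy
        rw [hxy]
      refine ⟨fun x y => h.syzMap_injective (hinj ?_)⟩
      have hk : ∀ x, coverMap F b (h.syzMap x) = 0 := fun x => by
        have : h.syzMap x ∈ LinearMap.range h.syzMap := ⟨x, rfl⟩
        rw [h.range_syzMap] at this
        exact this
      rw [hk, hk]
    · intro hsub
      have hk : LinearMap.ker (coverMap F b) = ⊥ := by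
        rw [← h.range_syzMap, eq_bot_iff]
        rintro _ ⟨x, rfl⟩
        rw [Subsingleton.elim x 0, map_zero]
        exact zero_mem _
      have hP : Module.Projective (TruncAlg K V L) (F.Cover K) := freeMod_projective
      exact Module.Projective.of_equiv
        (LinearEquiv.ofBijective (coverMap F b) ⟨LinearMap.ker_eq_bot.1 hk, h.coverMap_surjective⟩)
  | succ n =>
    have hS := LinearMap.shortExact_shortComplexKer h.coverMap_surjective
    rw [PdLT, PdLT]
    refine (hS.hasProjectiveDimensionLT_X₃_iff n hproj).trans ?_
    let e : F.Syz K ≃ₗ[TruncAlg K V L] LinearMap.ker (coverMap F b) :=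
      (LinearEquiv.ofInjective h.syzMap h.syzMap_injective).trans
        (LinearEquiv.ofEq _ _ h.range_syzMap)
    exact ⟨fun _ => hasProjectiveDimensionLT_of_iso e.toModuleIso.symm _,
      fun _ => hasProjectiveDimensionLT_of_iso e.toModuleIso _⟩

end ProjDim

/-! ## Path lengths -/

section PathSup

variable {V : Type} [Quiver.{0} V]

theorem length_le_pathSup {e j : V} (p : Quiver.Path e j) : (p.length : ℕ∞) ≤ pathSup e :=
  le_iSup₂ (f := fun (j : V) (p : Quiver.Path e j) => (p.length : ℕ∞)) j p

theorem natCast_le_pathSup_iff {e : V} {n : ℕ} :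
    (n : ℕ∞) ≤ pathSup e ↔ ∃ (j : V) (p : Quiver.Path e j), n ≤ p.length := by
  constructor
  · intro h
    by_contra! hlt
    cases n with
    | zero => exact absurd (hlt e .nil) (by simp)
    | succ n =>
      have : pathSup e ≤ n := iSup₂_le fun j p => by
        exact_mod_cast Nat.le_of_lt_succ (hlt j p)
      have := h.trans this
      rw [Nat.cast_le] at this
      omega
  · rintro ⟨j, p, h⟩
    exact le_trans (by exact_mod_cast h) (length_le_pathSup p)

theorem pathSup_add_one_le {e j : V} (a : e ⟶ j) : pathSup j + 1 ≤ pathSup e := by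
  rw [← ENat.forall_natCast_le_iff_le]
  intro n hn
  cases n with
  | zero => simp
  | succ n =>
    rw [Nat.cast_succ] at hn
    have hn' : (n : ℕ∞) ≤ pathSup j := (ENat.add_le_add_iff_right ENat.one_ne_top).1 hn
    obtain ⟨k, p, hp⟩ := natCast_le_pathSup_iff.1 hn'
    refine natCast_le_pathSup_iff.2 ⟨k, a.toPath.comp p, ?_⟩
    rw [Quiver.Path.length_comp, Quiver.Path.length_toPath]
    omega

theorem pathSup_add_length_le {e j : V} (p : Quiver.Path e j) :
    pathSup j + p.length ≤ pathSup e := by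
  induction p with
  | nil => simp
  | cons p a ih =>
    refine le_trans ?_ ih
    rw [Quiver.Path.length_cons, Nat.cast_succ, add_comm (p.length : ℕ∞), ← add_assoc]
    gcongr
    exact pathSup_add_one_le a

variable [Finite V] [∀ i j : V, Finite (i ⟶ j)]

/-- Only finitely many arrows leave `e`, so one with the best end point attains the supremum, also
when it is infinite. -/
theorem exists_arrow_pathSup {e : V} (h : 1 ≤ pathSup e) :
    ∃ (j : V) (_ : e ⟶ j), pathSup j + 1 = pathSup e := by
  have hne : Nonempty (Σ j : V, (e ⟶ j)) := by
    obtain ⟨j, p, hp⟩ := natCast_le_pathSup_iff (n := 1).1 (by simpa using h)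
    obtain ⟨n, hn⟩ : ∃ n, p.length = n + 1 := ⟨p.length - 1, by omega⟩
    obtain ⟨k, a, -⟩ := p.eq_toPath_comp_of_length_eq_succ hn
    exact ⟨⟨k, a⟩⟩
  obtain ⟨⟨j, a⟩, hmax⟩ := Finite.exists_max fun x : Σ j : V, (e ⟶ j) => pathSup x.1
  refine ⟨j, a, le_antisymm (pathSup_add_one_le a) (iSup₂_le fun k p => ?_)⟩
  rcases hn : p.length with _ | n
  · simp
  · obtain ⟨k', a', q, hq, -⟩ := p.eq_toPath_comp_of_length_eq_succ hn
    rw [Nat.cast_succ]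
    gcongr
    exact (hq ▸ length_le_pathSup q).trans (hmax ⟨k', a'⟩)

theorem exists_path_pathSup {e : V} (m : ℕ) (h : (m : ℕ∞) ≤ pathSup e) :
    ∃ (j : V) (p : Quiver.Path e j), p.length = m ∧ pathSup j + m = pathSup e := by
  induction m generalizing e with
  | zero => exact ⟨e, .nil, rfl, by simp⟩
  | succ m ih =>
    rw [Nat.cast_succ] at h
    obtain ⟨j, a, hj⟩ := exists_arrow_pathSup (le_trans (by simp) h)
    rw [← hj] at h
    obtain ⟨k, p, hp, hk⟩ := ih ((ENat.add_le_add_iff_right ENat.one_ne_top).1 h)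
    refine ⟨k, a.toPath.comp p, ?_, ?_⟩
    · rw [Quiver.Path.length_comp, Quiver.Path.length_toPath]
      omega
    · rw [Nat.cast_succ, ← add_assoc, hk, hj]

end PathSup

/-! ## The degrees -/

section Ldeg

variable (L : ℕ)

theorem ldeg_natCast (l c : ℕ) :
    ldeg L l (c : ℕ∞) = ((c / (L + 1) + (c + l) / (L + 1) : ℕ) : ℕ∞) := rfl

variable {L}

theorem ldeg_le_ldeg {l l' : ℕ} {c c' : ℕ∞} (hc : c ≤ c') (h : c + l ≤ c' + l') :
    ldeg L l c ≤ ldeg L l' c' := by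
  induction c' using ENat.recTopCoe with
  | top => exact le_top
  | coe c' =>
    induction c using ENat.recTopCoe with
    | top => simp at hc
    | coe c =>
      rw [ldeg_natCast, ldeg_natCast]
      norm_cast at hc h ⊢
      exact Nat.add_le_add (Nat.div_le_div_right hc) (Nat.div_le_div_right h)

/-- The two quotients trade places: `c + m` is bounded by `c'`, and `c + (L + 1)` by `c' + (L + 1 -
m)`; the summand `L + 1` produces the 1. -/
theorem one_add_ldeg_le {m : ℕ} (hm : m ≤ L) {c c' : ℕ∞} (h : c + m ≤ c') :
    1 + ldeg L m c ≤ ldeg L (L + 1 - m) c' := by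
  induction c' using ENat.recTopCoe with
  | top => exact le_top
  | coe c' =>
    induction c using ENat.recTopCoe with
    | top => simp at h
    | coe c =>
      rw [ldeg_natCast, ldeg_natCast]
      norm_cast at h ⊢
      have h1 : (c + m) / (L + 1) ≤ c' / (L + 1) := Nat.div_le_div_right h
      have h2 : (c + (L + 1)) / (L + 1) ≤ (c' + (L + 1 - m)) / (L + 1) :=
        Nat.div_le_div_right (by omega)
      rw [Nat.add_div_right _ (show 0 < L + 1 from Nat.succ_pos L)] at h2
      omega

theorem ldeg_eq_one_add {m : ℕ} (hm : m ≤ L) (c : ℕ∞) :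
    ldeg L (L + 1 - m) (c + m) = 1 + ldeg L m c := by
  induction c using ENat.recTopCoe with
  | top => rfl
  | coe c =>
    rw [ldeg_natCast, ← Nat.cast_add, ldeg_natCast]
    norm_cast
    have : c + m + (L + 1 - m) = c + (L + 1) := by omega
    rw [this, Nat.add_div_right _ (show 0 < L + 1 from Nat.succ_pos L)]
    omega

theorem ldeg_eq_zero {m : ℕ} (hm : m ≤ L) {c : ℕ∞} (h : c < m) : ldeg L (L + 1 - m) c = 0 := by
  induction c using ENat.recTopCoe with
  | top => simp at h
  | coe c =>
    rw [ldeg_natCast]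
    norm_cast at h ⊢
    rw [Nat.div_eq_of_lt (by omega), Nat.div_eq_of_lt (by omega)]

/-- The recursion matching syzygies: for 1 ≤ m ≤ L, the first syzygy of Λe/J^m e is the sum of
Λe_j/J^(L+1-m)e_j over all paths of length `m` from `e` to `j`. A longest continuation attains the
bound. -/
theorem ldeg_pathSup_le_iff {V : Type} [Quiver.{0} V] [Finite V] [∀ i j : V, Finite (i ⟶ j)]
    {m : ℕ} (hm : m ≤ L) (e : V) (n : ℕ∞) : ldeg L (L + 1 - m) (pathSup e) ≤ n ↔
      ∀ (j : V) (p : Quiver.Path e j), p.length = m → 1 + ldeg L m (pathSup j) ≤ n := by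
  constructor
  · intro h j p hp
    refine (one_add_ldeg_le hm ?_).trans h
    rw [← hp]
    exact pathSup_add_length_le p
  · intro h
    rcases le_or_gt (m : ℕ∞) (pathSup e) with hme | hme
    · obtain ⟨j, p, hp, hj⟩ := exists_path_pathSup m hme
      rw [← hj, ldeg_eq_one_add hm]
      exact h j p hp
    · rw [ldeg_eq_zero hm hme]
      exact bot_le

end Ldeg

/-! ## Projective dimensions -/

section Pd

variable {K : Type u} {V : Type} [Field K] [Fintype V] [Quiver.{0} V] [∀ i j : V, Finite (i ⟶ j)]
  {L : ℕ}

/-- The projective dimension of Λe/J^m e is (L+1-m)-deg(c(e)) for 1 ≤ m ≤ L. The syzygy is again of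
this form with all truncations at most L, so induction on `n` over all families at once works. -/
theorem pdLT_freeMod_iff (n : ℕ) {R : Type} [Finite R] (v : R → V) (m : R → ℕ)
    (hm : ∀ r, m r ≤ L + 1) (hm' : ∀ r, m r ≤ L) :
    PdLT K V L (FreeMod K v m hm) n ↔
      ∀ r, 1 ≤ m r → 1 + ldeg L (L + 1 - m r) (pathSup (v r)) ≤ n := by
  induction n generalizing R with
  | zero =>
    rw [pdLT_zero_iff]
    constructor
    · intro hs r hr
      exact absurd (Subsingleton.elim _ _)
        ((ForestMod.basis K (freeForest v m hm)).ne_zero ⟨r, ⟨⟨_, .nil⟩, hr⟩⟩)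
    · intro h
      refine ⟨fun f g => funext fun z => ?_⟩
      have h1 := z.2.2
      have h2 := h z.1 (by omega)
      simp at h2
  | succ n ih =>
    rw [(ForestMod.isForestBasis K (freeForest v m hm)).pdLT_succ_iff, ih _ _ _ fun q =>
      Nat.sub_le _ _]
    -- This turns the condition at a root into one on the paths of length `m r`; such a path is a
    -- path of length `m r - 1` in the tree followed by an arrow, hence a critical pair.
    have key : ∀ r, (1 + ldeg L (L + 1 - m r) (pathSup (v r)) ≤ ((n + 1 : ℕ) : ℕ∞)) ↔
        ∀ (j : V) (p : Quiver.Path (v r) j), p.length = m r →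
          1 + ldeg L (m r) (pathSup j) ≤ n := by
      intro r
      rw [← ldeg_pathSup_le_iff (hm' r), Nat.cast_succ, add_comm,
        ENat.add_le_add_iff_right ENat.one_ne_top]
    simp only [key]
    constructor
    · intro h r hr j p hp
      cases p with
      | nil => simp only [Quiver.Path.length_nil] at hp; omega
      | cons p a =>
        rw [Quiver.Path.length_cons] at hp
        have := hm' r
        have := h ⟨(⟨r, ⟨⟨_, p⟩, by change p.length < m r; omega⟩⟩, ⟨_, _, a⟩), rfl,
          freePar_ne_some (by omega) _⟩ (by change 1 ≤ L - p.length; omega)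
        change 1 + ldeg L (L + 1 - (L - p.length)) (pathSup j) ≤ _ at this
        rwa [show L + 1 - (L - p.length) = m r by omega] at this
    · rintro h ⟨⟨⟨r, ⟨⟨k, p⟩, hp⟩⟩, ⟨k', j, a⟩⟩, hs, hc⟩ hq
      change k' = k at hs
      subst hs
      change p.length < m r at hp
      -- Children are missing only at the last level of the free forest.
      have hlen : p.length + 1 = m r := by
        by_contra hne
        have hlt : p.length + 1 < m r := by omega
        exact hc (⟨r, ⟨⟨j, p.cons a⟩, hlt⟩⟩ : FreeNode v m) (freePar_cons p a hlt)
      have := h r (by omega) j (p.cons a) hlen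
      have := hm' r
      change 1 + ldeg L (L + 1 - (L - p.length)) (pathSup j) ≤ _
      rwa [show L + 1 - (L - p.length) = m r by omega]

variable {σ : Type} [Finite σ] {M : Type u} [AddCommGroup M] [Module K M]
  [Module (TruncAlg K V L) M] [IsScalarTower K (TruncAlg K V L) M]

theorem IsForestBasis.pdLT_succ_iff_critical {F : Forest V L σ} {b : Module.Basis σ K M}
    (h : IsForestBasis F b) (n : ℕ) : PdLT K V L M (n + 1) ↔ ∀ q : F.Critical,
      F.depth q.1.1 < L → 1 + ldeg L (F.depth q.1.1 + 1) (pathSup q.1.2.2.1) ≤ n := by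
  rw [h.pdLT_succ_iff, pdLT_freeMod_iff _ _ _ _ fun q => Nat.sub_le _ _]
  refine forall_congr' fun q => ?_
  constructor
  · intro h1 h2
    have := h1 (by omega)
    rwa [show L + 1 - (L - F.depth q.1.1) = F.depth q.1.1 + 1 by omega] at this
  · intro h1 h2
    rw [show L + 1 - (L - F.depth q.1.1) = F.depth q.1.1 + 1 by omega]
    exact h1 (by omega)

end Pd

/-! ## Numerical description -/

section Numeric

variable {V : Type} [Fintype V] [Quiver.{0} V] [∀ i j : V, Finite (i ⟶ j)] {L : ℕ}

/-- The number of arrows ending in `j` that start at an element of a family with `s i` elements at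
each vertex `i`. -/
def arrowCount (s : V → ℕ) (j : V) : ℕ := ∑ i, s i * Nat.card (i ⟶ j)

theorem arrowCount_mono {s t : V → ℕ} {j : V} (h : ∀ i, (i ⟶ j) → s i ≤ t i) :
    arrowCount s j ≤ arrowCount t j := by
  refine Finset.sum_le_sum fun i _ => ?_
  rcases isEmpty_or_nonempty (i ⟶ j) with he | ⟨⟨a⟩⟩
  · simp
  · exact Nat.mul_le_mul_right _ (h i a)

variable {σ : Type} [Finite σ] (F : Forest V L σ)

/-- The pairs of a node of depth `l` and an arrow from there to `j`. -/
abbrev Forest.Pair (F : Forest V L σ) (l : ℕ) (j : V) : Type :=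
  {q : σ × Arr V // F.depth q.1 = l ∧ q.2.1 = F.vtx q.1 ∧ q.2.2.1 = j}

theorem Forest.card_pair (l : ℕ) (j : V) :
    Nat.card (F.Pair l j) = arrowCount (F.count l) j := by
  let e : F.Pair l j ≃ Σ i : V, {z // F.depth z = l ∧ F.vtx z = i} × (i ⟶ j) :=
    { toFun := fun q => ⟨q.1.2.1, ⟨q.1.1, q.2.1, q.2.2.1.symm⟩, cast (congrArg (q.1.2.1 ⟶ ·) q.2.2.2) q.1.2.2.2⟩
      invFun := fun x => ⟨(x.2.1.1, ⟨x.1, j, x.2.2⟩), x.2.1.2.1, x.2.1.2.2.symm, rfl⟩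
      left_inv := by
        rintro ⟨⟨z, ⟨i, k, a⟩⟩, h1, h2, h3⟩
        change k = j at h3
        subst h3
        rfl
      right_inv := by
        rintro ⟨i, ⟨z, h1, h2⟩, a⟩
        rfl }
  rw [Nat.card_congr e, Nat.card_sigma, arrowCount]
  exact Finset.sum_congr rfl fun i _ => Nat.card_prod _ _

/-- A node that is not a root gives the pair of its parent and the arrow leading to it. -/
theorem Forest.exists_par (l : ℕ) (j : V) (z : {z // F.depth z = l + 1 ∧ F.vtx z = j}) :
    ∃ q : F.Pair l j, F.par z.1 = some q.1 := by
  obtain ⟨z, hd, hv⟩ := z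
  rcases hp : F.par z with _ | ⟨y, a⟩
  · rw [F.depth_root hp] at hd
    omega
  · have h1 := F.depth_succ hp
    exact ⟨⟨(y, a), by change F.depth y = l; omega, F.src hp, (F.tgt hp).trans hv⟩, rfl⟩

/-- The map from nodes of depth `l + 1` to pairs. -/
def Forest.toPair (l : ℕ) (j : V) (z : {z // F.depth z = l + 1 ∧ F.vtx z = j}) : F.Pair l j :=
  (F.exists_par l j z).choose

theorem Forest.par_eq_toPair (l : ℕ) (j : V) (z : {z // F.depth z = l + 1 ∧ F.vtx z = j}) :
    F.par z.1 = some (F.toPair l j z).1 := (F.exists_par l j z).choose_spec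

theorem Forest.toPair_injective (l : ℕ) (j : V) : Function.Injective (F.toPair l j) := by
  intro z z' h
  refine Subtype.ext (F.inj (F.par_eq_toPair l j z) ?_)
  rw [h]
  exact F.par_eq_toPair l j z'

theorem Forest.count_succ_le (l : ℕ) (j : V) :
    F.count (l + 1) j ≤ arrowCount (F.count l) j := by
  rw [← F.card_pair]
  exact Nat.card_le_card_of_injective _ (F.toPair_injective l j)

/-- Nodes of depth `l + 1` inject into the pairs through their last edge; a critical pair is one
outside the image. -/
theorem Forest.exists_critical_iff (l : ℕ) (j : V) :
    (∃ q : F.Critical, F.depth q.1.1 = l ∧ q.1.2.2.1 = j) ↔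
      F.count (l + 1) j < arrowCount (F.count l) j := by
  rw [← F.card_pair]
  constructor
  · rintro ⟨⟨q, hs, hc⟩, hd, ht⟩
    refine lt_of_not_ge fun hle => ?_
    obtain ⟨z, hz⟩ := ((F.toPair_injective l j).bijective_of_nat_card_le hle).2 ⟨q, hd, hs, ht⟩
    have := F.par_eq_toPair l j z
    rw [hz] at this
    exact hc _ this
  · intro h
    by_contra! hn
    refine h.ne (Nat.card_eq_of_bijective (F.toPair l j) ⟨F.toPair_injective l j, ?_⟩)
    rintro ⟨q, hd, hs, ht⟩
    by_contra! hq
    refine hn ⟨q, hs, fun z hz => ?_⟩ hd ht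
    refine hq ⟨z, ?_, ?_⟩ (Subtype.ext (Option.some.inj ?_))
    · rw [F.depth_succ hz, hd]
    · rw [← ht, ← F.tgt hz]
    · rw [← F.par_eq_toPair, hz]

/-- The numerical projective dimension of a layering: the supremum of the contributions of the
critical pairs. -/
def critSup (L : ℕ) (s : ℕ → V → ℕ) : ℕ∞ :=
  ⨆ (l : ℕ) (j : V) (_ : l < L ∧ s (l + 1) j < arrowCount (s l) j), (1 + ldeg L (l + 1) (pathSup j))

theorem critSup_le_iff {s : ℕ → V → ℕ} {n : ℕ∞} : critSup L s ≤ n ↔ ∀ (l : ℕ) (j : V), l < L →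
    s (l + 1) j < arrowCount (s l) j → 1 + ldeg L (l + 1) (pathSup j) ≤ n := by
  simp only [critSup, iSup_le_iff, and_imp]

open Classical in
/-- The projective dimension computed from a layering. -/
def numPdim (L : ℕ) (s : ℕ → V → ℕ) : WithBot ℕ∞ :=
  if ∀ l i, s l i = 0 then ⊥ else (critSup L s : ℕ∞)

variable {K : Type u} [Field K] {M : Type u} [AddCommGroup M] [Module K M]
  [Module (TruncAlg K V L) M] [IsScalarTower K (TruncAlg K V L) M]

theorem eq_of_forall_natCast_le_iff {x y : ℕ∞} (h : ∀ n : ℕ, x ≤ n ↔ y ≤ n) : x = y := by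
  apply le_antisymm
  · induction y using ENat.recTopCoe with
    | top => exact le_top
    | coe n => exact (h n).2 le_rfl
  · induction x using ENat.recTopCoe with
    | top => exact le_top
    | coe n => exact (h n).1 le_rfl

/-- The right side only sees the multiplicities in the layers, so this gives constancy on strata.
The zero module has to be split off, its dimension being `⊥`. -/
theorem IsForestBasis.projectiveDimension_eq {F : Forest V L σ} {b : Module.Basis σ K M}
    (h : IsForestBasis F b) :
    projectiveDimension (ModuleCat.of (TruncAlg K V L) M) = numPdim L F.count := by
  have hempty : (∀ l i, F.count l i = 0) ↔ Subsingleton M := by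
    constructor
    · intro h0
      have : IsEmpty σ := ⟨fun z => by
        have h1 := h0 (F.depth z) (F.vtx z)
        rw [Forest.count, Finite.card_eq_zero_iff] at h1
        exact h1.false ⟨z, rfl, rfl⟩⟩
      exact b.repr.toEquiv.subsingleton
    · intro hs l i
      rw [Forest.count, Finite.card_eq_zero_iff]
      exact ⟨fun z => b.ne_zero z.1 (Subsingleton.elim _ _)⟩
  by_cases h0 : ∀ l i, F.count l i = 0
  · rw [numPdim, if_pos h0, projectiveDimension_eq_bot_iff, ModuleCat.isZero_iff_subsingleton]
    exact hempty.1 h0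
  · rw [numPdim, if_neg h0]
    have hbot : projectiveDimension (ModuleCat.of (TruncAlg K V L) M) ≠ ⊥ := by
      rw [Ne, projectiveDimension_eq_bot_iff, ModuleCat.isZero_iff_subsingleton]
      exact fun hs => h0 (hempty.2 hs)
    obtain ⟨x, hx⟩ := WithBot.ne_bot_iff_exists.1 hbot
    rw [← hx]
    congr 1
    refine eq_of_forall_natCast_le_iff fun n => ?_
    have h1 : x ≤ n ↔ PdLT K V L M (n + 1) := by
      rw [← WithBot.coe_le_coe, hx]
      exact projectiveDimension_le_iff _ n
    rw [h1, h.pdLT_succ_iff_critical, critSup_le_iff]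
    constructor
    · intro h2 l j hl hc
      obtain ⟨q, rfl, rfl⟩ := (F.exists_critical_iff l j).2 hc
      exact h2 q hl
    · intro h2 q hq
      exact h2 _ _ hq ((F.exists_critical_iff _ _).1 ⟨q, rfl, rfl⟩)

end Numeric

/-! ## Comparison of layerings -/

section Compare

variable {V : Type} [Fintype V] [Quiver.{0} V] [∀ i j : V, Finite (i ⟶ j)] {L : ℕ}

/-- The conditions satisfied by the multiplicities in the radical layers of a module. -/
structure Realizable (L : ℕ) (s : ℕ → V → ℕ) : Prop where
  eq_zero : ∀ l i, L < l → s l i = 0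
  le_arrowCount : ∀ l j, s (l + 1) j ≤ arrowCount (s l) j

/-- One more step of depth is paid for by the arrow: c(j) + (l+1) ≤ c(i) + l. Thus weights do not
decrease from a node to its parent. -/
theorem ldeg_le_ldeg_of_arrow {i j : V} (a : i ⟶ j) (l : ℕ) :
    ldeg L (l + 1) (pathSup j) ≤ ldeg L l (pathSup i) := by
  have h := pathSup_add_one_le a
  refine ldeg_le_ldeg (le_self_add.trans h) ?_
  rw [Nat.cast_succ, add_comm (l : ℕ∞), ← add_assoc]
  gcongr

theorem ldeg_one_le_ldeg_one_of_arrow {i j : V} (a : i ⟶ j) :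
    ldeg L 1 (pathSup j) ≤ ldeg L 1 (pathSup i) := by
  have h := le_self_add.trans (pathSup_add_one_le a)
  exact ldeg_le_ldeg h (by gcongr)

theorem ldeg_mono_left {l l' : ℕ} (h : l ≤ l') (c : ℕ∞) : ldeg L l c ≤ ldeg L l' c :=
  ldeg_le_ldeg le_rfl (by gcongr)

variable {s t : ℕ → V → ℕ}

theorem le_critSup {l : ℕ} {j : V} (hl : l < L) (h : s (l + 1) j < arrowCount (s l) j) :
    1 + ldeg L (l + 1) (pathSup j) ≤ critSup L s := critSup_le_iff.1 le_rfl l j hl h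

/-- Saturation: a missing child here would contribute a weight above the supremum. -/
theorem Realizable.eq_arrowCount (hs : Realizable L s) {l : ℕ} {j : V} (hl : l < L)
    (h : critSup L s < 1 + ldeg L (l + 1) (pathSup j)) : s (l + 1) j = arrowCount (s l) j := by
  refine le_antisymm (hs.le_arrowCount l j) (le_of_not_gt fun hlt => ?_)
  exact absurd (le_critSup hl hlt) (not_le.2 h)

/-- The supremum over the critical pairs is monotone along the dominance order. -/
theorem critSup_le_critSup (hs : Realizable L s) (ht : Realizable L t)
    (htot : ∀ i, ∑ l ∈ Finset.range (L + 1), s l i = ∑ l ∈ Finset.range (L + 1), t l i)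
    (hpar : ∀ r i, ∑ l ∈ Finset.range r, s l i ≤ ∑ l ∈ Finset.range r, t l i) :
    critSup L s ≤ critSup L t := by
  refine critSup_le_iff.2 fun l j hl hcrit => le_of_not_gt fun hlt => ?_
  have h0 : ∀ i, s 0 i ≤ t 0 i := fun i => by simpa using hpar 1 i
  -- Positions heavier than `critSup L t` are saturated in `t`, and their parents are heavy too, so
  -- the inequality at the top propagates through the layers.
  have hle : ∀ (k : ℕ) (x : V), k ≤ L → (1 ≤ k → critSup L t < 1 + ldeg L k (pathSup x)) →
      s k x ≤ t k x := by
    intro k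
    induction k with
    | zero => exact fun x _ _ => h0 x
    | succ k ih =>
      intro x hk hx
      have hx' := hx (by omega)
      rw [ht.eq_arrowCount (by omega) hx']
      refine (hs.le_arrowCount k x).trans (arrowCount_mono fun i a => ih i (by omega) fun _ => ?_)
      exact hx'.trans_le (by gcongr; exact ldeg_le_ldeg_of_arrow a k)
  have hstrict : s (l + 1) j < t (l + 1) j := by
    rw [ht.eq_arrowCount hl hlt]
    refine hcrit.trans_le (arrowCount_mono fun i a => hle l i hl.le fun _ => ?_)
    exact hlt.trans_le (by gcongr; exact ldeg_le_ldeg_of_arrow a l)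
  -- From layer `l + 1` on, weights at `j` only grow, so `s` stays below `t`, strictly at `l + 1`.
  -- Equal totals would then force `s` above `t` on the first `l + 1` layers.
  have hsum : ∑ k ∈ Finset.Ico (l + 1) (L + 1), s k j < ∑ k ∈ Finset.Ico (l + 1) (L + 1), t k j := by
    refine Finset.sum_lt_sum (fun k hk => ?_) ⟨l + 1, by simp [hl], hstrict⟩
    rw [Finset.mem_Ico] at hk
    refine hle k j (by omega) fun _ => hlt.trans_le ?_
    gcongr
    exact ldeg_mono_left hk.1 _
  have h1 := htot j
  rw [← Finset.sum_range_add_sum_Ico _ (show l + 1 ≤ L + 1 by omega),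
    ← Finset.sum_range_add_sum_Ico _ (show l + 1 ≤ L + 1 by omega)] at h1
  have h2 := hpar (l + 1) j
  omega

/-- There are finitely many positions, so a supremum above some `x` is a maximum. -/
theorem exists_critSup_eq {x : ℕ∞} (h : x < critSup L s) : ∃ (l : ℕ) (j : V), l < L ∧
    s (l + 1) j < arrowCount (s l) j ∧ critSup L s = 1 + ldeg L (l + 1) (pathSup j) := by
  let C := {q : Fin L × V // s (q.1 + 1) q.2 < arrowCount (s q.1) q.2}
  have hne : Nonempty C := by
    by_contra hC
    rw [not_nonempty_iff] at hC
    refine absurd h (not_lt.2 (critSup_le_iff.2 fun l j hl hc => ?_))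
    exact (hC.false ⟨(⟨l, hl⟩, j), hc⟩).elim
  obtain ⟨⟨⟨⟨l, hl⟩, j⟩, hc⟩, hmax⟩ :=
    Finite.exists_max fun q : C => 1 + ldeg L (q.1.1 + 1) (pathSup q.1.2)
  refine ⟨l, j, hl, hc, le_antisymm (critSup_le_iff.2 fun l' j' hl' hc' => ?_) (le_critSup hl hc)⟩
  exact hmax ⟨(⟨l', hl'⟩, j'), hc'⟩

/-- A strict increase of the supremum over the critical pairs along the dominance order is explained
by a composition factor. -/
theorem exists_of_critSup_lt (hs : Realizable L s) (ht : Realizable L t)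
    (htot : ∀ i, ∑ l ∈ Finset.range (L + 1), s l i = ∑ l ∈ Finset.range (L + 1), t l i)
    (h0 : ∀ i, s 0 i ≤ t 0 i) (hlt : critSup L s < critSup L t) :
    ∃ (l : ℕ) (j : V), 1 ≤ l ∧ l ≤ L ∧ 0 < s l j ∧
      critSup L t = 1 + ldeg L l (pathSup j) := by
  classical
  by_cases hex : ∃ k, ∃ x : V, k + 1 ≤ L ∧
      critSup L t ≤ 1 + ldeg L (k + 1) (pathSup x) ∧ t (k + 1) x < s (k + 1) x
  · obtain ⟨x, hk, hU, hx⟩ := Nat.find_spec hex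
    set k := Nat.find hex with hkdef
    refine ⟨k + 1, x, by omega, hk, by omega, le_antisymm hU (le_critSup (by omega) ?_)⟩
    refine hx.trans_le ((hs.le_arrowCount k x).trans (arrowCount_mono fun i a => ?_))
    rcases hk' : k with _ | k'
    · exact h0 i
    · by_contra! hlt'
      refine Nat.find_min hex (m := k') (by omega) ⟨i, by omega, hU.trans ?_, hlt'⟩
      rw [hk']
      gcongr
      exact ldeg_le_ldeg_of_arrow a (k' + 1)
  · push Not at hex
    exfalso
    -- Now `s ≤ t` at all heavy positions. This establishes the reverse inequality at the sources of
    -- arrows into heavy positions.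
    have key : ∀ (k : ℕ) (x x' : V), (x ⟶ x') → k + 1 ≤ L →
        critSup L t ≤ 1 + ldeg L (k + 1) (pathSup x') → t k x ≤ s k x := by
      intro k
      induction k with
      | zero =>
        intro x x' a hk hU
        -- The arrow out of `x` makes `x` heavy in every positive layer. Hence `s ≤ t` throughout,
        -- and equal totals give equality, in particular at the top.
        have hle : ∀ l ∈ Finset.range (L + 1), s l x ≤ t l x := by
          intro l hl
          rw [Finset.mem_range] at hl
          rcases l with _ | l
          · exact h0 x
          · refine hex l x (by omega) (hU.trans ?_)
            gcongr
            exact (ldeg_one_le_ldeg_one_of_arrow a).trans (ldeg_mono_left (by omega) _)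
        exact (((Finset.sum_eq_sum_iff_of_le hle).1 (htot x)) 0 (by simp)).ge
      | succ k ih =>
        intro x x' a hk hU
        have hU' : critSup L t ≤ 1 + ldeg L (k + 1) (pathSup x) :=
          hU.trans (by gcongr; exact ldeg_le_ldeg_of_arrow a (k + 1))
        rw [hs.eq_arrowCount (by omega) (hlt.trans_le hU')]
        exact (ht.le_arrowCount k x).trans
          (arrowCount_mono fun i b => ih i x b (by omega) hU')
    -- At a critical position of `t` attaining the supremum, `s` is saturated with at least as many
    -- arrows as `t`, hence exceeds `t` there.
    obtain ⟨l, j, hl, hc, heq⟩ := exists_critSup_eq hlt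
    have h1 : arrowCount (t l) j ≤ arrowCount (s l) j :=
      arrowCount_mono fun i a => key l i j a (by omega) heq.le
    rw [← hs.eq_arrowCount hl (hlt.trans_eq heq)] at h1
    have h2 := hex l j (by omega) heq.le
    omega

/-- The projective dimensions along the dominance order. -/
theorem numPdim_of_dominates (hs : Realizable L s) (ht : Realizable L t)
    (htot : ∀ i, ∑ l ∈ Finset.range (L + 1), s l i = ∑ l ∈ Finset.range (L + 1), t l i)
    (hpar : ∀ r i, ∑ l ∈ Finset.range r, s l i ≤ ∑ l ∈ Finset.range r, t l i) :
    numPdim L t = numPdim L s ∨ (numPdim L s < numPdim L t ∧ ∃ (l : ℕ) (j : V), 1 ≤ l ∧ l ≤ L ∧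
      0 < s l j ∧ numPdim L t = ((1 + ldeg L l (pathSup j) : ℕ∞) : WithBot ℕ∞)) := by
  have hzero : ∀ {s t : ℕ → V → ℕ}, Realizable L t →
      (∀ i, ∑ l ∈ Finset.range (L + 1), s l i = ∑ l ∈ Finset.range (L + 1), t l i) →
      (∀ l i, s l i = 0) → ∀ l i, t l i = 0 := by
    intro s t ht htot h l i
    by_cases hl : L < l
    · exact ht.eq_zero l i hl
    · have := htot i
      rw [Finset.sum_eq_zero fun l _ => h l i, eq_comm, Finset.sum_eq_zero_iff] at this
      exact this l (Finset.mem_range.2 (by omega))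
  by_cases h : ∀ l i, s l i = 0
  · left
    rw [numPdim, numPdim, if_pos h, if_pos (hzero ht htot h)]
  · have h' : ¬ ∀ l i, t l i = 0 := fun h' => h (hzero hs (fun i => (htot i).symm) h')
    rw [numPdim, numPdim, if_neg h, if_neg h']
    rcases (critSup_le_critSup hs ht htot hpar).eq_or_lt with heq | hlt
    · left
      rw [heq]
    · right
      obtain ⟨l, j, h1, h2, h3, h4⟩ :=
        exists_of_critSup_lt hs ht htot (fun i => by simpa using hpar 1 i) hlt
      exact ⟨WithBot.coe_lt_coe.2 hlt, l, j, h1, h2, h3, by rw [h4]⟩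

end Compare

/-! ## Points of the module variety -/

section Points

variable {K : Type u} {V : Type} [Field K] [Fintype V] [Quiver.{0} V] {L d : ℕ}

instance (x : ModVariety K V L d) : Module K x.Carrier := inferInstanceAs (Module K (Fin d → K))

theorem ModVariety.smul_def (x : ModVariety K V L d) (r : TruncAlg K V L) (m : x.Carrier) :
    r • m = x.action r m := rfl

instance (x : ModVariety K V L d) : IsScalarTower K (TruncAlg K V L) x.Carrier where
  smul_assoc c r m := by
    rw [ModVariety.smul_def, ModVariety.smul_def, map_smul]
    rfl

/-- The standard basis of the module of a point. -/
def ModVariety.basis (x : ModVariety K V L d) : Module.Basis (Fin d) K x.Carrier :=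
  Pi.basisFun K (Fin d)

instance (x : ModVariety K V L d) : FiniteDimensional K x.Carrier :=
  x.basis.finiteDimensional_of_finite

theorem ModVariety.finrank_carrier (x : ModVariety K V L d) : Module.finrank K x.Carrier = d :=
  Module.finrank_fin_fun K

/-- A semisimple sequence, extended by zero. -/
def seqFun (S : SemisimpleSeq V L) (l : ℕ) (i : V) : ℕ :=
  if h : l < L + 1 then S ⟨l, h⟩ i else 0

theorem seqFun_coe (S : SemisimpleSeq V L) (l : Fin (L + 1)) (i : V) : seqFun S l i = S l i := by
  rw [seqFun, dif_pos l.2]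

theorem sum_seqFun (S : SemisimpleSeq V L) (i : V) :
    ∑ l ∈ Finset.range (L + 1), seqFun S l i = ∑ l, S l i := by
  rw [← Fin.sum_univ_eq_sum_range]
  exact Finset.sum_congr rfl fun l _ => seqFun_coe S l i

theorem sum_Iic_eq (S : SemisimpleSeq V L) (r : Fin (L + 1)) (i : V) :
    ∑ l ∈ Finset.Iic r, S l i = ∑ l ∈ Finset.range (r + 1), seqFun S l i := by
  refine Finset.sum_bij (fun l _ => (l : ℕ)) ?_ ?_ ?_ ?_
  · intro l hl
    rw [Finset.mem_Iic] at hl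
    rw [Finset.mem_range]
    exact Nat.lt_succ_of_le hl
  · intro l _ l' _ h
    exact Fin.ext h
  · intro l hl
    rw [Finset.mem_range] at hl
    refine ⟨⟨l, by omega⟩, ?_, rfl⟩
    rw [Finset.mem_Iic]
    exact Nat.le_of_lt_succ hl
  · intro l _
    exact (seqFun_coe S l i).symm

theorem dominates_iff (S' S : SemisimpleSeq V L) : dominates S' S ↔
    (∀ i, ∑ l ∈ Finset.range (L + 1), seqFun S l i = ∑ l ∈ Finset.range (L + 1), seqFun S' l i) ∧
    ∀ r i, ∑ l ∈ Finset.range r, seqFun S l i ≤ ∑ l ∈ Finset.range r, seqFun S' l i := by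
  simp only [dominates, sum_seqFun, sum_Iic_eq]
  refine and_congr_right fun h => ⟨fun h' r i => ?_, fun h' r i => h' _ i⟩
  -- Partial sums outside the original index range are empty or equal to the totals.
  rcases r with _ | r
  · simp
  · by_cases hr : r < L + 1
    · exact h' ⟨r, hr⟩ i
    · have hz : ∀ T : SemisimpleSeq V L, ∑ l ∈ Finset.range (r + 1), seqFun T l i =
          ∑ l ∈ Finset.range (L + 1), seqFun T l i := by
        intro T
        symm
        refine Finset.sum_subset (Finset.range_mono (by omega)) fun l _ hl => ?_
        rw [Finset.mem_range] at hl
        rw [seqFun, dif_neg hl]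
      rw [hz, hz, sum_seqFun, sum_seqFun, h i]

variable {σ : Type} [Finite σ]

/-- The layering of a forest. -/
def Forest.seq (F : Forest V L σ) : SemisimpleSeq V L := fun l i => F.count l i

theorem Forest.count_eq_zero (F : Forest V L σ) {l : ℕ} (hl : L < l) (i : V) :
    F.count l i = 0 := by
  rw [Forest.count, Finite.card_eq_zero_iff]
  refine ⟨fun z => ?_⟩
  have := F.depth_le z.1
  have := z.2.1
  omega

theorem Forest.seqFun_seq (F : Forest V L σ) : seqFun F.seq = F.count := by
  funext l i
  rw [seqFun]
  split_ifs with h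
  · rfl
  · rw [F.count_eq_zero (by omega)]

theorem Forest.realizable [∀ i j : V, Finite (i ⟶ j)] (F : Forest V L σ) :
    Realizable L (seqFun F.seq) := by
  rw [F.seqFun_seq]
  exact ⟨fun l i hl => F.count_eq_zero hl i, F.count_succ_le⟩

theorem IsForestBasis.mem_layerStratum_iff {x : ModVariety K V L d} {F : Forest V L σ}
    {b : Module.Basis σ K x.Carrier} (h : IsForestBasis F b) (S : SemisimpleSeq V L) :
    x ∈ layerStratum K d S ↔ S = F.seq := by
  have := Fintype.ofFinite σ
  rw [layerStratum, Set.mem_ofPred_eq, h.hasRadLayering_iff]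
  exact ⟨fun h => funext₂ h, fun h l i => congrFun₂ h l i⟩

/-- Indexing the nodes by `Fin d` lets the forest define further points of the same variety. -/
theorem ModVariety.exists_isForestBasis (x : ModVariety K V L d) :
    ∃ (F : Forest V L (Fin d)) (b : Module.Basis (Fin d) K x.Carrier), IsForestBasis F b := by
  obtain ⟨σ, _, F, b, h⟩ := TruncPath.exists_isForestBasis K V L x.Carrier
  have hcard : Fintype.card σ = d := by
    rw [← Module.finrank_eq_card_basis b, x.finrank_carrier]
  let e : σ ≃ Fin d := Fintype.equivFinOfCardEq hcard
  refine ⟨{ vtx := fun z => F.vtx (e.symm z)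
            depth := fun z => F.depth (e.symm z)
            par := fun z => (F.par (e.symm z)).map fun q => (e q.1, q.2)
            src := ?_, tgt := ?_, depth_succ := ?_, depth_root := ?_, inj := ?_,
            depth_le := fun z => F.depth_le _ }, b.reindex e, ⟨?_, ?_, ?_⟩⟩
  · intro z y a hz
    obtain ⟨⟨y', a'⟩, hq, he⟩ := Option.map_eq_some_iff.1 hz
    cases he
    rw [e.symm_apply_apply]
    exact F.src hq
  · intro z y a hz
    obtain ⟨⟨y', a'⟩, hq, he⟩ := Option.map_eq_some_iff.1 hz
    cases he
    exact F.tgt hq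
  · intro z y a hz
    obtain ⟨⟨y', a'⟩, hq, he⟩ := Option.map_eq_some_iff.1 hz
    cases he
    rw [e.symm_apply_apply]
    exact F.depth_succ hq
  · intro z hz
    exact F.depth_root (Option.map_eq_none_iff.1 hz)
  · intro z z' q hz hz'
    obtain ⟨⟨y, a⟩, hq, he⟩ := Option.map_eq_some_iff.1 hz
    obtain ⟨⟨y', a'⟩, hq', he'⟩ := Option.map_eq_some_iff.1 hz'
    rw [← he'] at he
    simp only [Prod.mk.injEq, EmbeddingLike.apply_eq_iff_eq] at he
    obtain ⟨rfl, rfl⟩ := he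
    exact e.symm.injective (F.inj hq hq')
  · intro y
    rw [b.reindex_apply]
    exact h.idem_smul _
  · intro z y a hz
    obtain ⟨⟨y', a'⟩, hq, he⟩ := Option.map_eq_some_iff.1 hz
    cases he
    rw [b.reindex_apply, b.reindex_apply, e.symm_apply_apply]
    exact h.arr_smul hq
  · intro y a ha hc
    rw [b.reindex_apply]
    refine Submodule.span_mono ?_ (h.childless (y := e.symm y) (a := a) ha fun z hz => ?_)
    · rintro _ ⟨z, hz, rfl⟩
      refine ⟨e z, ?_, ?_⟩
      · simpa using hz
      · rw [b.reindex_apply, e.symm_apply_apply]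
    · refine hc (e z) ?_
      rw [Option.map_eq_some_iff]
      exact ⟨_, by rw [e.symm_apply_apply]; exact hz, by simp⟩

variable [∀ i j : V, Finite (i ⟶ j)]

/-- The projective dimension is determined by the radical layering. -/
theorem pdim_eq_numPdim {S : SemisimpleSeq V L} {x : ModVariety K V L d}
    (hx : x ∈ layerStratum K d S) : x.pdim = numPdim L (seqFun S) := by
  obtain ⟨F, b, h⟩ := x.exists_isForestBasis
  rw [(h.mem_layerStratum_iff S).1 hx, F.seqFun_seq]
  exact h.projectiveDimension_eq

theorem realizable_of_mem {S : SemisimpleSeq V L} {x : ModVariety K V L d}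
    (hx : x ∈ layerStratum K d S) : Realizable L (seqFun S) := by
  obtain ⟨F, b, h⟩ := x.exists_isForestBasis
  rw [(h.mem_layerStratum_iff S).1 hx]
  exact F.realizable

theorem seqPdim_eq_numPdim {S : SemisimpleSeq V L} (hS : (layerStratum K d S).Nonempty) :
    seqPdim K d S = numPdim L (seqFun S) := by
  rw [seqPdim, dif_pos hS]
  exact pdim_eq_numPdim hS.some_mem

theorem ModVariety.exists_mem_layerStratum (x : ModVariety K V L d) :
    ∃ S : SemisimpleSeq V L, x ∈ layerStratum K d S := by
  obtain ⟨F, b, h⟩ := x.exists_isForestBasis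
  exact ⟨F.seq, (h.mem_layerStratum_iff _).2 rfl⟩

end Points

/-! ## Semicontinuity of the radical filtration -/

section Closure

variable {K : Type u} {V : Type} [Field K] [Fintype V] [Quiver.{0} V] {L d : ℕ}

theorem mem_zariskiClosure_iff {Z : Set (ModVariety K V L d)} {x : ModVariety K V L d} :
    x ∈ zariskiClosure Z ↔ ∀ P : MvPolynomial (Gen V × Fin d × Fin d) K,
      (∀ y ∈ Z, MvPolynomial.eval y.coords P = 0) → MvPolynomial.eval x.coords P = 0 := by
  simp only [zariskiClosure, Set.mem_ofPred_eq, MvPolynomial.mem_zeroLocus_iff,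
    MvPolynomial.mem_vanishingIdeal_iff, Set.forall_mem_image, MvPolynomial.aeval_eq_eval]

theorem subset_zariskiClosure (Z : Set (ModVariety K V L d)) : Z ⊆ zariskiClosure Z :=
  fun _ hx => mem_zariskiClosure_iff.2 fun _ hP => hP _ hx

variable (K d) in
/-- The generic matrix of a generator. -/
def genMat (g : Gen V) :
    Matrix (Fin d) (Fin d) (MvPolynomial (Gen V × Fin d × Fin d) K) :=
  Matrix.of fun a b => MvPolynomial.X (g, a, b)

theorem genMat_map_eval (x : ModVariety K V L d) (g : Gen V) :
    (genMat K d g).map (MvPolynomial.eval x.coords) = LinearMap.toMatrix' (x.1 g) := by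
  ext a b
  simp [genMat, ModVariety.coords]

/-- The matrix entries of a path are polynomials in the coordinates of the point, which makes rank
conditions on paths Zariski closed. -/
theorem evalPath_genMat_map_eval (x : ModVariety K V L d) {i j : V} (p : Quiver.Path i j) :
    (evalPath (genMat K d) p).map (MvPolynomial.eval x.coords) =
      LinearMap.toMatrix' (x.action (pathCls K L p)) := by
  induction p with
  | nil =>
    rw [← idem_eq_pathCls]
    exact (genMat_map_eval x _).trans
      (congrArg LinearMap.toMatrix' (x.action_gen (.inl i)).symm)
  | cons p a ih =>
    rw [pathCls_cons, map_mul, LinearMap.toMatrix'_mul, evalPath, Matrix.map_mul, ih,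
      genMat_map_eval, ← x.action_gen]
    rfl

/-- The images of the standard basis vectors under the paths of length `r` ending in `i`. -/
def ModVariety.pathVecs (x : ModVariety K V L d) (r : ℕ) (i : V) : Set (Fin d → K) :=
  {v | ∃ (j : V) (p : Quiver.Path j i) (k : Fin d), p.length = r ∧
    v = x.action (pathCls K L p) (Pi.single k 1)}

theorem map_idem_rad {M ι : Type*} [AddCommGroup M] [Module K M] [Module (TruncAlg K V L) M]
    [IsScalarTower K (TruncAlg K V L) M] (g : ι → M) (hg : Submodule.span K (Set.range g) = ⊤)
    (r : ℕ) (i : V) :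
    ((rad K V L M r).restrictScalars K).map (lsmulK M (idem K L i)) = Submodule.span K
      {v | ∃ (j : V) (p : Quiver.Path j i) (k : ι), p.length = r ∧ v = pathCls K L p • g k} := by
  rw [rad_eq_span g hg, Submodule.map_span]
  apply le_antisymm
  · rw [Submodule.span_le]
    rintro _ ⟨_, ⟨j, i', p, k, hp, rfl⟩, rfl⟩
    rw [lsmulK_apply, ← mul_smul]
    by_cases h : i' = i
    · subst h
      rw [idem_mul_pathCls]
      exact Submodule.subset_span ⟨j, p, k, hp, rfl⟩
    · rw [idem_eq_pathCls, pathCls_mul_ne _ _ _ _ h, zero_smul]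
      exact zero_mem _
  · apply Submodule.span_mono
    rintro _ ⟨j, p, k, hp, rfl⟩
    exact ⟨_, ⟨j, i, p, k, hp, rfl⟩, by rw [lsmulK_apply, ← mul_smul, idem_mul_pathCls]⟩

theorem ModVariety.radDim_eq_finrank_span (x : ModVariety K V L d) (r : ℕ) (i : V) :
    radDim K V L x.Carrier r i = Module.finrank K (Submodule.span K (x.pathVecs r i)) := by
  rw [radDim_eq_finrank_map, map_idem_rad _ x.basis.span_eq]
  have : {v | ∃ (j : V) (p : Quiver.Path j i) (k : Fin d), p.length = r ∧
      v = pathCls K L p • x.basis k} = x.pathVecs r i := by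
    simp only [ModVariety.pathVecs, ← Pi.basisFun_apply K]
    rfl
  rw [this]
  rfl

/-- The dimension of `e_i J^r M` is lower semicontinuous. -/
theorem exists_radDim_le {Z : Set (ModVariety K V L d)} {x : ModVariety K V L d}
    (hx : x ∈ zariskiClosure Z) (r : ℕ) (i : V) :
    ∃ y ∈ Z, radDim K V L x.Carrier r i ≤ radDim K V L y.Carrier r i := by
  classical
  -- A basis of `e_i J^r M` at `x` is chosen among path images. Applying the same paths to the same
  -- vectors at another point, a left inverse `g` turns independence into a determinant that equals
  -- 1 at `x`.
  obtain ⟨B, hB, hspan, hli⟩ := exists_linearIndependent K (x.pathVecs r i)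
  have hfin : Finite B := hli.finite
  have := Fintype.ofFinite B
  have hcard : radDim K V L x.Carrier r i = Fintype.card B := by
    rw [x.radDim_eq_finrank_span, ← hspan, ← finrank_span_eq_card hli, Subtype.range_coe]
  choose j p k hp hv using fun t : B => hB t.2
  obtain ⟨g, hg⟩ := LinearMap.exists_leftInverse_of_injective (Fintype.linearCombination K
    ((↑) : B → Fin d → K)) (LinearMap.ker_eq_bot.2 hli.fintypeLinearCombination_injective)
  let A : Matrix B B (MvPolynomial (Gen V × Fin d × Fin d) K) :=
    (LinearMap.toMatrix' g).map MvPolynomial.C *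
      Matrix.of fun a t => evalPath (genMat K d) (p t) a (k t)
  have hA : ∀ (y : ModVariety K V L d) (s t : B), MvPolynomial.eval y.coords (A s t) =
      g (y.action (pathCls K L (p t)) (Pi.single (k t) 1)) s := by
    intro y s t
    rw [← LinearMap.toMatrix'_mulVec g]
    have hs : A s t = ∑ a, MvPolynomial.C (LinearMap.toMatrix' g s a) *
        evalPath (genMat K d) (p t) a (k t) := rfl
    rw [hs, map_sum, Matrix.mulVec, dotProduct]
    simp only [map_mul, MvPolynomial.eval_C]
    refine Finset.sum_congr rfl fun a _ => ?_
    congr 1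
    have h := congrFun₂ (evalPath_genMat_map_eval y (p t)) a (k t)
    rw [Matrix.map_apply, LinearMap.toMatrix'_apply] at h
    rw [h]
  have hdet : MvPolynomial.eval x.coords A.det ≠ 0 := by
    have : (MvPolynomial.eval x.coords).mapMatrix A = 1 := by
      ext s t
      rw [RingHom.mapMatrix_apply, Matrix.map_apply, hA, ← hv]
      have := congrFun (LinearMap.congr_fun hg (Pi.single t 1)) s
      rw [LinearMap.comp_apply, Fintype.linearCombination_apply_single, one_smul] at this
      rw [this, LinearMap.id_apply, Matrix.one_apply, Pi.single_apply]
    rw [RingHom.map_det, this, Matrix.det_one]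
    exact one_ne_zero
  -- Were the dimension smaller on all of `Z`, the determinant would vanish on `Z` and hence at `x`.
  by_contra! hlt
  refine hdet (mem_zariskiClosure_iff.1 hx _ fun y hy => ?_)
  by_contra hne
  refine absurd (hlt y hy) (not_lt.2 ?_)
  rw [RingHom.map_det] at hne
  have hw : LinearIndependent K fun t : B =>
      y.action (pathCls K L (p t)) (Pi.single (k t) (1 : K)) := by
    refine LinearIndependent.of_comp g ?_
    have hcols : (g ∘ fun t : B => y.action (pathCls K L (p t)) (Pi.single (k t) (1 : K))) =
        ((MvPolynomial.eval y.coords).mapMatrix A).col := by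
      funext t s
      exact (hA y s t).symm
    rw [hcols]
    exact Matrix.linearIndependent_cols_of_det_ne_zero hne
  rw [hcard, ← finrank_span_eq_card hw, y.radDim_eq_finrank_span]
  refine Submodule.finrank_mono (Submodule.span_mono ?_)
  rintro _ ⟨t, rfl⟩
  exact ⟨j t, p t, k t, hp t, rfl⟩

theorem radDim_zero_eq {S : SemisimpleSeq V L} {x : ModVariety K V L d}
    (hx : x ∈ layerStratum K d S) (r : ℕ) (i : V) : radDim K V L x.Carrier 0 i =
      ∑ l ∈ Finset.range r, seqFun S l i + radDim K V L x.Carrier r i := by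
  induction r with
  | zero => simp
  | succ r ih =>
    rw [ih, Finset.sum_range_succ, add_assoc]
    congr 1
    rw [seqFun]
    split_ifs with h
    · rw [(hasRadLayering_iff S x.Carrier).1 hx ⟨r, h⟩ i, add_comm]
    · rw [radDim_eq_zero (by omega), radDim_eq_zero (by omega)]

theorem ModVariety.sum_radDim_zero (x : ModVariety K V L d) :
    ∑ i, radDim K V L x.Carrier 0 i = d := by
  classical
  obtain ⟨F, b, h⟩ := x.exists_isForestBasis
  have : ∀ i, radDim K V L x.Carrier 0 i = (Finset.univ.filter fun z => F.vtx z = i).card := by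
    intro i
    rw [h.radDim_eq, Nat.card_eq_fintype_card, Fintype.card_subtype]
    simp
  simp only [this]
  rw [← Finset.card_eq_sum_card_fiberwise fun z _ => Finset.mem_univ (F.vtx z)]
  simp

/-- The layerings in the closure of a stratum dominate the layering of the stratum. -/
theorem dominates_of_mem_zariskiClosure {S S' : SemisimpleSeq V L} {x : ModVariety K V L d}
    (hx : x ∈ zariskiClosure (layerStratum K d S)) (hx' : x ∈ layerStratum K d S') :
    dominates S' S := by
  -- Semicontinuity gives an inequality at each vertex, and both sides add up to `d`.
  have hzero : ∀ y ∈ layerStratum K d S, ∀ i,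
      radDim K V L x.Carrier 0 i = radDim K V L y.Carrier 0 i := by
    intro y hy
    have hle : ∀ i ∈ Finset.univ, radDim K V L x.Carrier 0 i ≤ radDim K V L y.Carrier 0 i := by
      intro i _
      obtain ⟨y', hy', h⟩ := exists_radDim_le hx 0 i
      rw [radDim_zero_eq hy' (L + 1), radDim_eq_zero le_rfl] at h
      rwa [radDim_zero_eq hy (L + 1), radDim_eq_zero le_rfl]
    intro i
    refine (Finset.sum_eq_sum_iff_of_le hle).1 ?_ i (Finset.mem_univ i)
    rw [x.sum_radDim_zero, y.sum_radDim_zero]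
  rw [dominates_iff]
  constructor
  · intro i
    obtain ⟨y, hy, -⟩ := exists_radDim_le hx 0 i
    have h := hzero y hy i
    rw [radDim_zero_eq hx' (L + 1), radDim_zero_eq hy (L + 1), radDim_eq_zero le_rfl,
      radDim_eq_zero le_rfl] at h
    exact h.symm
  · intro r i
    obtain ⟨y, hy, h⟩ := exists_radDim_le hx r i
    have h0 := hzero y hy i
    rw [radDim_zero_eq hx' r, radDim_zero_eq hy r] at h0
    omega

/-- The limit of an affine line all of whose other points lie in a set. -/
theorem mem_zariskiClosure_of_line [Infinite K] {Z : Set (ModVariety K V L d)}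
    (γ : K → ModVariety K V L d) (u v : Gen V × Fin d × Fin d → K)
    (hγ : ∀ t c, (γ t).coords c = u c + t * v c) (hZ : ∀ t ≠ 0, γ t ∈ Z) :
    γ 0 ∈ zariskiClosure Z := by
  refine mem_zariskiClosure_iff.2 fun P hP => ?_
  -- The restriction of `P` to the line; it vanishes at all nonzero `t`, which are infinitely many.
  let q : Polynomial K :=
    MvPolynomial.aeval (fun c => Polynomial.C (u c) + Polynomial.X * Polynomial.C (v c)) P
  have hq : ∀ t, q.eval t = MvPolynomial.eval (γ t).coords P := by
    intro t
    have : (γ t).coords = fun c => (Polynomial.aeval t)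
        (Polynomial.C (u c) + Polynomial.X * Polynomial.C (v c)) := by
      funext c
      simp only [hγ, map_add, map_mul, Polynomial.aeval_C, Polynomial.aeval_X,
        Algebra.algebraMap_self, RingHom.id_apply]
    rw [this, ← Polynomial.coe_aeval_eq_eval, ← MvPolynomial.aeval_eq_eval]
    exact (MvPolynomial.comp_aeval_apply _ (Polynomial.aeval t) P)
  rw [← hq, show q = 0 from Polynomial.eq_zero_of_infinite_isRoot q ?_, Polynomial.eval_zero]
  refine (Set.Finite.infinite_compl (Set.finite_singleton (0 : K))).mono fun t ht => ?_
  change q.eval t = 0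
  rw [hq]
  exact hP _ (hZ t ht)

end Closure

/-! ## Degenerations of forests -/

namespace Forest

section Cut

variable {V : Type} [Quiver.{0} V] {L : ℕ} {σ : Type} (F : Forest V L σ)

/-- The node `z` is a descendant of the node `x` or equal to it. -/
def Desc (x z : σ) : Prop := Relation.ReflTransGen (fun y z => ∃ a, F.par z = some (y, a)) x z

variable {F}

theorem Desc.refl (x : σ) : F.Desc x x := Relation.ReflTransGen.refl

theorem desc_iff {x y z : σ} {a : Arr V} (hz : F.par z = some (y, a)) (hx : z ≠ x) :
    F.Desc x z ↔ F.Desc x y := by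
  constructor
  · intro h
    rcases Relation.ReflTransGen.cases_tail h with rfl | ⟨y', h', a', hy'⟩
    · exact absurd rfl hx
    · rw [hz] at hy'
      cases hy'
      exact h'
  · exact fun h => h.tail ⟨a, hz⟩

theorem not_desc_of_root {x z : σ} (hz : F.par z = none) (hx : z ≠ x) : ¬ F.Desc x z := by
  intro h
  rcases Relation.ReflTransGen.cases_tail h with rfl | ⟨y', h', a', hy'⟩
  · exact hx rfl
  · rw [hz] at hy'
    cases hy'

theorem _root_.TruncPath.pathSup_tgt_add_one_le (a : Arr V) {i : V} (h : a.1 = i) :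
    pathSup a.2.1 + 1 ≤ pathSup i := h ▸ pathSup_add_one_le a.2.2

/-- `k` is the length of the path of arrows from `x` down to `z`. -/
theorem Desc.exists_depth_eq {x z : σ} (h : F.Desc x z) :
    ∃ k : ℕ, F.depth z = F.depth x + k ∧ pathSup (F.vtx z) + k ≤ pathSup (F.vtx x) := by
  induction h with
  | refl => exact ⟨0, rfl, by simp⟩
  | tail _ hz ih =>
    obtain ⟨a, hz⟩ := hz
    obtain ⟨k, hk, hle⟩ := ih
    refine ⟨k + 1, by rw [F.depth_succ hz, hk, add_assoc], le_trans ?_ hle⟩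
    have := pathSup_tgt_add_one_le a (F.src hz)
    rw [F.tgt hz] at this
    rw [Nat.cast_succ, add_comm (k : ℕ∞), ← add_assoc]
    gcongr

theorem Desc.depth_le_depth {x z : σ} (h : F.Desc x z) : F.depth x ≤ F.depth z := by
  obtain ⟨k, hk, -⟩ := h.exists_depth_eq
  omega

theorem not_desc_par {x y : σ} {a : Arr V} (hx : F.par x = some (y, a)) : ¬ F.Desc x y := by
  intro h
  have := h.depth_le_depth
  have := F.depth_succ hx
  omega

variable (F)

open Classical in
/-- The forest obtained by removing the edge above a node. -/
def cut (x : σ) : Forest V L σ where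
  vtx := F.vtx
  depth z := if F.Desc x z then F.depth z - F.depth x else F.depth z
  par z := if z = x then none else F.par z
  src h := by
    split_ifs at h
    exact F.src h
  tgt h := by
    split_ifs at h
    exact F.tgt h
  depth_succ {z y a} h := by
    split_ifs at h with hz
    rw [desc_iff h hz]
    split_ifs with hy
    · have := hy.depth_le_depth
      have := F.depth_succ h
      omega
    · exact F.depth_succ h
  depth_root {z} h := by
    split_ifs at h with hz
    · subst hz
      rw [if_pos (Desc.refl z), Nat.sub_self]
    · rw [if_neg (not_desc_of_root h hz), F.depth_root h]
  inj {z z' q} h h' := by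
    split_ifs at h h'
    exact F.inj h h'
  depth_le z := by
    have := F.depth_le z
    split_ifs <;> omega

variable {F}

theorem cut_par_self (x : σ) : (F.cut x).par x = none := if_pos rfl

theorem cut_par_ne {x z : σ} (h : z ≠ x) : (F.cut x).par z = F.par z := if_neg h

theorem cut_depth_of_desc {x z : σ} (h : F.Desc x z) :
    (F.cut x).depth z = F.depth z - F.depth x := if_pos h

theorem cut_depth_of_not_desc {x z : σ} (h : ¬ F.Desc x z) :
    (F.cut x).depth z = F.depth z := if_neg h

theorem par_of_cut_par {x z : σ} {q : σ × Arr V} (h : (F.cut x).par z = some q) :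
    z ≠ x ∧ F.par z = some q := by
  by_cases hz : z = x
  · subst hz
    rw [cut_par_self] at h
    cases h
  · exact ⟨hz, (cut_par_ne hz).symm.trans h⟩

variable [Finite σ] [Fintype V] [∀ i j : V, Finite (i ⟶ j)]

theorem numPdim_count (F : Forest V L σ) (x : σ) : numPdim L F.count = (critSup L F.count : ℕ∞) := by
  refine if_neg fun h => ?_
  have h1 := h (F.depth x) (F.vtx x)
  rw [Forest.count, Finite.card_eq_zero_iff] at h1
  exact h1.false ⟨x, rfl, rfl⟩

/-- The pair of the removed edge becomes critical and contributes the stated weight. No other pair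
exceeds it: those in the branch move up to smaller depth, and the rest were critical before. -/
theorem critSup_cut {x : σ} (hx : 1 ≤ F.depth x)
    (hlt : critSup L F.count < 1 + ldeg L (F.depth x) (pathSup (F.vtx x))) :
    critSup L (F.cut x).count = 1 + ldeg L (F.depth x) (pathSup (F.vtx x)) := by
  apply le_antisymm
  · rw [critSup_le_iff]
    intro l j hl hc
    obtain ⟨⟨⟨y, a⟩, hs, hy⟩, rfl, rfl⟩ := ((F.cut x).exists_critical_iff l j).2 hc
    change a.1 = F.vtx y at hs
    change 1 + ldeg L ((F.cut x).depth y + 1) (pathSup a.2.1) ≤ _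
    change (F.cut x).depth y < L at hl
    have ha := pathSup_tgt_add_one_le a hs
    -- A node `k` steps below `x` has depth `k` after the cut, and an arrow from it ends at a vertex
    -- whose `pathSup` plus `k + 1` is at most that of `F.vtx x`.
    by_cases hd : F.Desc x y
    · obtain ⟨k, hk, hle⟩ := hd.exists_depth_eq
      rw [cut_depth_of_desc hd, hk, Nat.add_sub_cancel_left]
      have hle' : pathSup a.2.1 + ((k + 1 : ℕ) : ℕ∞) ≤ pathSup (F.vtx x) := by
        rw [Nat.cast_succ, add_comm (k : ℕ∞), ← add_assoc]
        exact le_trans (by gcongr) hle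
      gcongr
      exact ldeg_le_ldeg (le_self_add.trans hle') (hle'.trans le_self_add)
    · rw [cut_depth_of_not_desc hd] at hl ⊢
      by_cases hp : F.par x = some (y, a)
      · rw [F.depth_succ hp, F.tgt hp]
      · refine le_trans (le_critSup hl ?_) hlt.le
        refine (F.exists_critical_iff _ _).1 ⟨⟨(y, a), hs, fun z hz => ?_⟩, rfl, rfl⟩
        have hzx : z ≠ x := by
          rintro rfl
          exact hp hz
        exact hy z ((cut_par_ne hzx).trans hz)
  · rcases hp : F.par x with _ | ⟨y, a⟩
    · rw [F.depth_root hp] at hx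
      omega
    · rw [F.depth_succ hp, ← F.tgt hp, ← cut_depth_of_not_desc (not_desc_par hp)]
      have hdx := F.depth_le x
      rw [F.depth_succ hp, ← cut_depth_of_not_desc (not_desc_par hp)] at hdx
      refine le_critSup hdx (((F.cut x).exists_critical_iff _ _).1
        ⟨⟨(y, a), F.src hp, fun z hz => ?_⟩, rfl, rfl⟩)
      obtain ⟨hzx, hz⟩ := par_of_cut_par hz
      exact hzx (F.inj hz hp)

end Cut

/-! ### Points given by weighted forests -/

section Weighted

variable {K : Type u} {V : Type} [Field K] [Fintype V] [Quiver.{0} V] {L d : ℕ}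
variable (F : Forest V L (Fin d))

/-- The point of the module variety given by a forest with weights on the edges. -/
def point (w : Fin d → K) : ModVariety K V L d :=
  ⟨F.act K w, fun f hf => by
    have : FreeAlgebra.lift K (F.act K w) = (F.algHom w).comp (FreeAlgebra.lift K (gen K L)) := by
      ext g
      simp [F.algHom_gen]
    rw [this, AlgHom.comp_apply, hf, map_zero]⟩

variable {F}

theorem point_gen_smul (w : Fin d → K) (g : Gen V) (m : (F.point w).Carrier) :
    gen K L g • m = F.act K w g m := by
  rw [ModVariety.smul_def, ModVariety.action_gen]
  rfl

theorem point_basis_apply (w : Fin d → K) (y : Fin d) : (F.point w).basis y =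
    @Pi.single (Fin d) (fun _ => K) _ (fun a b => Classical.propDecidable (a = b)) y 1 := by
  rw [Subsingleton.elim (fun a b => Classical.propDecidable (a = b)) (instDecidableEqFin d)]
  exact Pi.basisFun_apply K (Fin d) y

theorem point_idem_smul (w : Fin d → K) (y : Fin d) :
    idem K L (F.vtx y) • (F.point w).basis y = (F.point w).basis y := by
  refine (point_gen_smul w (.inl (F.vtx y)) _).trans ?_
  refine (congrArg (F.act K w (.inl (F.vtx y))) (point_basis_apply w y)).trans ?_
  refine (F.act_inl_single w (F.vtx y) y).trans ?_
  exact (if_pos rfl).trans (point_basis_apply w y).symm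

theorem point_arr_smul (w : Fin d → K) {y z : Fin d} {a : Arr V} (h : F.par z = some (y, a)) :
    arrElt K L a • (F.point w).basis y = w z • (F.point w).basis z := by
  refine (point_gen_smul w (.inr a) _).trans ?_
  refine (congrArg (F.act K w (.inr a)) (point_basis_apply w y)).trans ?_
  refine (F.act_inr_single w h).trans ?_
  exact congrArg (fun v : Fin d → K => w z • v) (point_basis_apply w z).symm

theorem point_arr_smul_of_childless (w : Fin d → K) {y : Fin d} {a : Arr V}
    (h : ∀ z, F.par z ≠ some (y, a)) : arrElt K L a • (F.point w).basis y = 0 := by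
  refine (point_gen_smul w (.inr a) _).trans ?_
  refine (congrArg (F.act K w (.inr a)) (point_basis_apply w y)).trans ?_
  exact F.act_inr_single_of_childless w h

/-- Nonzero weights can be removed by rescaling the basis. -/
theorem point_isForestBasis {w : Fin d → K} (v : Fin d → Kˣ)
    (h : ∀ {z y a}, F.par z = some (y, a) → (v y : K) * w z = v z) :
    IsForestBasis F ((F.point w).basis.unitsSMul v) where
  idem_smul y := by
    rw [Module.Basis.unitsSMul_apply, Units.smul_def, smul_comm_scalar, point_idem_smul]
  arr_smul hz := by
    rw [Module.Basis.unitsSMul_apply, Module.Basis.unitsSMul_apply, Units.smul_def, Units.smul_def,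
      smul_comm_scalar, point_arr_smul w hz, smul_smul, h hz]
  childless _ hc := by
    rw [Module.Basis.unitsSMul_apply, Units.smul_def, smul_comm_scalar,
      point_arr_smul_of_childless w hc, smul_zero]
    exact zero_mem _

theorem point_arr_smul_of_cut {x y : Fin d} {a : Arr V}
    (hc : ∀ z, (F.cut x).par z ≠ some (y, a)) {w : Fin d → K} (hw : w x = 0) :
    arrElt K L a • (F.point w).basis y = 0 := by
  by_cases hp : F.par x = some (y, a)
  · rw [point_arr_smul _ hp, hw, zero_smul]
  · refine point_arr_smul_of_childless _ fun z hz => hc z ?_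
    have hzx : z ≠ x := by
      rintro rfl
      exact hp hz
    exact (cut_par_ne hzx).trans hz

/-- Vanishing weights remove edges. -/
theorem point_isForestBasis_cut {x : Fin d} {w : Fin d → K} (hw : w x = 0)
    (hw' : ∀ z ≠ x, w z = 1) : IsForestBasis (F.cut x) (F.point w).basis where
  idem_smul y := point_idem_smul w y
  arr_smul {z y a} hz := by
    obtain ⟨hzx, hz⟩ := par_of_cut_par hz
    rw [point_arr_smul _ hz, hw' z hzx, one_smul]
  childless {y a} _ hc := by
    rw [point_arr_smul_of_cut hc hw]
    exact zero_mem _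

theorem point_zero_isForestBasis (x : Fin d) :
    IsForestBasis (F.cut x) (F.point (Function.update 1 x (0 : K))).basis :=
  point_isForestBasis_cut (Function.update_self _ _ _) fun _ hz => Function.update_of_ne hz _ _

theorem point_isForestBasis_of_ne_zero (x : Fin d) (hx : F.par x ≠ none) {t : K} (ht : t ≠ 0) :
    ∃ b : Module.Basis (Fin d) K (F.point (Function.update 1 x t)).Carrier,
      IsForestBasis F b := by
  classical
  -- Scaling every node of the branch by `t` absorbs the weight of the edge above `x`; edges inside
  -- or outside the branch are unaffected.
  refine ⟨_, point_isForestBasis (fun z => if F.Desc x z then Units.mk0 t ht else 1)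
    @fun z y a hz => ?_⟩
  by_cases hzx : z = x
  · subst hzx
    simp [not_desc_par hz, Desc.refl]
  · simp [desc_iff hz hzx, hzx]

/-- Only the edge above `x` involves `t`, and it does so linearly; the points therefore move along
an affine line. -/
theorem act_update (x : Fin d) (t : K) (g : Gen V) (f : Fin d → K) (z : Fin d) :
    F.act K (Function.update 1 x t) g f z = F.act K (Function.update 1 x 0) g f z +
      t * (F.act K (Function.update 1 x 1) g f z - F.act K (Function.update 1 x 0) g f z) := by
  classical
  rcases g with i | a
  · simp only [act_inl, sub_self, mul_zero, add_zero]
  · rcases hp : F.par z with _ | ⟨y, a'⟩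
    · simp only [F.act_inr_of_none _ _ _ hp, sub_self, mul_zero, add_zero]
    · simp only [F.act_inr_of_some _ _ _ hp]
      by_cases hz : z = x
      · subst hz
        by_cases ha : a' = a <;> simp [ha]
      · simp [hz]

theorem point_zero_mem_zariskiClosure [Infinite K] {S : SemisimpleSeq V L} (hS : S = F.seq)
    {x : Fin d} (hx : F.par x ≠ none) :
    F.point (Function.update 1 x (0 : K)) ∈ zariskiClosure (layerStratum K d S) := by
  refine mem_zariskiClosure_of_line (fun t => F.point (Function.update 1 x t))
    (F.point (Function.update 1 x 0)).coords
    (fun c => (F.point (Function.update 1 x 1)).coords c -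
      (F.point (Function.update 1 x 0)).coords c) (fun t c => ?_) fun t ht => ?_
  · simp only [ModVariety.coords, LinearMap.toMatrix'_apply]
    exact F.act_update x t c.1 _ c.2.1
  · obtain ⟨b, hb⟩ := F.point_isForestBasis_of_ne_zero x hx ht
    exact (hb.mem_layerStratum_iff S).2 hS

end Weighted

end Forest

/-! ### Realizing the larger values, and the theorem -/

variable {K : Type u} {V : Type} [Field K] [Fintype V] [Quiver.{0} V] {L d : ℕ}
  [∀ i j : V, Finite (i ⟶ j)]

/-- Cutting off the branch at a composition factor realizes its contribution to the projective
dimension in the closure of a stratum. -/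
theorem exists_pdim_eq_of_lt [Infinite K] {S : SemisimpleSeq V L}
    (hS : (layerStratum K d S).Nonempty) {l : Fin (L + 1)} {j : V} (hl : 1 ≤ (l : ℕ))
    (hpos : 0 < S l j)
    (hlt : numPdim L (seqFun S) < ((1 + ldeg L l (pathSup j) : ℕ∞) : WithBot ℕ∞)) :
    ∃ y ∈ zariskiClosure (layerStratum K d S),
      y.pdim = ((1 + ldeg L l (pathSup j) : ℕ∞) : WithBot ℕ∞) := by
  obtain ⟨x, hx⟩ := hS
  obtain ⟨F, b, hF⟩ := x.exists_isForestBasis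
  have hSF := (hF.mem_layerStratum_iff S).1 hx
  rw [hSF] at hpos
  -- A composition factor `S_j` of layer `l` is a node of the skeleton. Its depth is positive, so
  -- there is an edge above it to cut.
  obtain ⟨⟨z, hz, hj⟩⟩ := (Nat.card_pos_iff.1 hpos).1
  rw [hSF, F.seqFun_seq, F.numPdim_count z, WithBot.coe_lt_coe, ← hz, ← hj] at hlt
  rw [← hz] at hl
  have hpar : F.par z ≠ none := by
    intro h
    rw [F.depth_root h] at hl
    omega
  refine ⟨_, Forest.point_zero_mem_zariskiClosure hSF hpar, ?_⟩
  rw [ModVariety.pdim, (Forest.point_zero_isForestBasis z).projectiveDimension_eq,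
    Forest.numPdim_count _ z, Forest.critSup_cut hl hlt, hz, hj]

end
end TruncPath

theorem theorem15 {K : Type u} [Field K] [Infinite K] {V : Type} [Fintype V] [Quiver.{0} V]
    [∀ i j : V, Finite (i ⟶ j)] (L : ℕ) (hL : 0 < L) (d : ℕ)
    (S : SemisimpleSeq V L) (hd : totalDim S = d) (hS : (layerStratum K d S).Nonempty) :
    (∀ S' : SemisimpleSeq V L, ∀ x ∈ layerStratum K d S', x.pdim = seqPdim K d S') ∧
    ModVariety.pdim '' zariskiClosure (layerStratum K d S) =
      {n | ∃ S' : SemisimpleSeq V L, dominates S' S ∧ (layerStratum K d S').Nonempty ∧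
        n = seqPdim K d S'} ∧
    ModVariety.pdim '' zariskiClosure (layerStratum K d S) =
      {seqPdim K d S} ∪ {n | seqPdim K d S < n ∧ ∃ (l : Fin (L + 1)) (j : V),
        1 ≤ (l : ℕ) ∧ 0 < S l j ∧ n = ((1 + ldeg L l (pathSup j) : ℕ∞) : WithBot ℕ∞)} := by
  have hpdim : ∀ S' : SemisimpleSeq V L, ∀ x ∈ layerStratum K d S', x.pdim = seqPdim K d S' :=
    fun S' x hx => by rw [pdim_eq_numPdim hx, seqPdim_eq_numPdim ⟨x, hx⟩]
  have h₁ : ModVariety.pdim '' zariskiClosure (layerStratum K d S) ⊆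
      {n | ∃ S' : SemisimpleSeq V L, dominates S' S ∧ (layerStratum K d S').Nonempty ∧
        n = seqPdim K d S'} := by
    rintro _ ⟨x, hx, rfl⟩
    obtain ⟨S', hx'⟩ := x.exists_mem_layerStratum
    exact ⟨S', dominates_of_mem_zariskiClosure hx hx', ⟨x, hx'⟩, hpdim S' x hx'⟩
  have h₂ : {n | ∃ S' : SemisimpleSeq V L, dominates S' S ∧ (layerStratum K d S').Nonempty ∧
        n = seqPdim K d S'} ⊆
      {seqPdim K d S} ∪ {n | seqPdim K d S < n ∧ ∃ (l : Fin (L + 1)) (j : V),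
        1 ≤ (l : ℕ) ∧ 0 < S l j ∧ n = ((1 + ldeg L l (pathSup j) : ℕ∞) : WithBot ℕ∞)} := by
    rintro _ ⟨S', hdom, hS', rfl⟩
    rw [seqPdim_eq_numPdim hS, seqPdim_eq_numPdim hS']
    obtain ⟨htot, hpar⟩ := (dominates_iff S' S).1 hdom
    obtain ⟨x, hx⟩ := hS
    obtain ⟨x', hx'⟩ := hS'
    rcases numPdim_of_dominates (realizable_of_mem hx) (realizable_of_mem hx') htot hpar with
      h | ⟨hlt, l, j, h1, hl, hpos, h⟩
    · exact Or.inl h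
    · refine Or.inr ⟨hlt, ⟨l, Nat.lt_succ_of_le hl⟩, j, h1, ?_, h⟩
      rwa [← seqFun_coe S]
  have h₃ : {seqPdim K d S} ∪ {n | seqPdim K d S < n ∧ ∃ (l : Fin (L + 1)) (j : V),
        1 ≤ (l : ℕ) ∧ 0 < S l j ∧ n = ((1 + ldeg L l (pathSup j) : ℕ∞) : WithBot ℕ∞)} ⊆
      ModVariety.pdim '' zariskiClosure (layerStratum K d S) := by
    rintro n (rfl | ⟨hlt, l, j, h1, hpos, rfl⟩)
    · obtain ⟨x, hx⟩ := hS
      exact ⟨x, subset_zariskiClosure _ hx, hpdim S x hx⟩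
    · rw [seqPdim_eq_numPdim hS] at hlt
      exact exists_pdim_eq_of_lt hS h1 hpos hlt
  -- The three sets are compared in a cycle, so three inclusions give both equalities.
  exact ⟨hpdim, h₁.antisymm (h₂.trans h₃), (h₁.trans h₂).antisymm h₃⟩
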